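/- Let $U'$ and $U$ be connected (Hausdorff, second countable) complex manifolds and let $\eta\colon U'\to U$ be a finite surjective holomorphic map, i.e. $\eta$ is holomorphic, proper, surjective and has finite fibres. A distribution on $U$ is a coherent subsheaf $W\subset T_U$ of the holomorphic tangent sheaf which is saturated, i.e. $T_U/W$ is torsion-free. For a distribution $W\subset T_U$ let $Q\subset\Omega_U$ be the kernel of the natural map $\Omega_U\to W^*$, let $Q^{sat}\subset\Omega_{U'}$ be the saturation of the image of $\eta^*Q\to\eta^*\Omega_U\to\Omega_{U'}$ (the sheaf of $1$-forms $\omega$ such that locally $f\omega$ lies in this image for some holomorphic function $f$ which does not vanish identically on any nonempty open set), put $S:=\Omega_{U'}/Q^{sat}$, and define the lifting of $W$ to be $\eta^{-1}W:=S^*\subset T_{U'}$, i.e. the sheaf of holomorphic vector fields on open subsets of $U'$ that are annihilated by $Q^{sat}$. Let $W_1,W_2\subset T_U$ be distributions. If $$T_{U'}=\eta^{-1}W_1\oplus\eta^{-1}W_2,$$ then $$T_U=W_1\oplus W_2.$$ (Both are equalities of sheaves: internal direct sums of subsheaves.) -/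

import Mathlib

open Bundle TopologicalSpace
open scoped Manifold ContDiff

/-- The model of an `n`-dimensional complex manifold (without boundary): `ℂⁿ`. -/
noncomputable abbrev modelC (n : ℕ) :
    ModelWithCorners ℂ (EuclideanSpace ℂ (Fin n)) (EuclideanSpace ℂ (Fin n)) :=
  modelWithCornersSelf ℂ (EuclideanSpace ℂ (Fin n))

section Functions

variable {n : ℕ} {M : Type*} [TopologicalSpace M] [ChartedSpace (EuclideanSpace ℂ (Fin n)) M]

/-- `f` is a holomorphic function on the open set `V`, i.e. `f ∈ 𝒪_M(V)`. (The values of `f`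
outside `V` are irrelevant.) -/
def IsHolFun (V : Opens M) (f : M → ℂ) : Prop :=
  ContMDiffOn (modelC n) (modelWithCornersSelf ℂ ℂ) ω f V

/-- `f` does not vanish identically on any nonempty open subset of `V`; for a holomorphic `f` on
`V` this says that the germ of `f` at each point `x ∈ V` is a nonzero element (that is, a
nonzerodivisor) of the local ring `𝒪_{M,x}`. -/
def NowhereLocallyZero (V : Opens M) (f : M → ℂ) : Prop :=
  ∀ O : Opens M, O ≤ V → (O : Set M).Nonempty → ∃ x ∈ O, f x ≠ 0

end Functions

section Sheaves

variable {n : ℕ} {M : Type*} [TopologicalSpace M] [ChartedSpace (EuclideanSpace ℂ (Fin n)) M]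
  (F : Type*) [NormedAddCommGroup F] [NormedSpace ℂ F]
  (E : M → Type*) [TopologicalSpace (TotalSpace F E)] [∀ x, TopologicalSpace (E x)]
  [FiberBundle F E]

/-- `s` is a holomorphic section over the open set `V` of the bundle `E` with model fibre `F`.
(The values of `s` outside `V` are irrelevant.) -/
def IsHolSection (V : Opens M) (s : Π x, E x) : Prop :=
  ContMDiffOn (modelC n) ((modelC n).prod (modelWithCornersSelf ℂ F)) ω
    (fun x => TotalSpace.mk' F x (s x)) V

variable {F E} in
theorem IsHolSection.of_locally {V : Opens M} {s : Π x, E x}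
    (h : ∀ x ∈ V, ∃ V' ≤ V, x ∈ V' ∧ ∃ t, IsHolSection (n := n) F E V' t ∧ ∀ y ∈ V', s y = t y) :
    IsHolSection (n := n) F E V s := by
  intro x hx
  obtain ⟨V', -, hxV', t, ht, hst⟩ := h x hx
  have h1 := (ht x hxV').contMDiffAt (V'.isOpen.mem_nhds hxV')
  refine (h1.congr_of_eventuallyEq ?_).contMDiffWithinAt
  filter_upwards [V'.isOpen.mem_nhds hxV'] with y hy
  rw [hst y hy]

variable {F E} in
theorem IsHolSection.mono {V V' : Opens M} {s : Π x, E x} (hs : IsHolSection (n := n) F E V s)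
    (h : V' ≤ V) : IsHolSection (n := n) F E V' s :=
  ContMDiffOn.mono hs h

variable [∀ x, AddCommGroup (E x)] [∀ x, Module ℂ (E x)]

/-- A subsheaf of `𝒪_M`-modules of the sheaf of holomorphic sections of the bundle `E`:
for each open `V` a set `sec V` of holomorphic sections over `V` which is an `𝒪_M(V)`-submodule,
compatible with restriction, and such that a section belonging locally to the subsheaf belongs to
it. Sections over `V` are represented by functions on all of `M`, of which only the values on `V`
matter (this is part of `mem_of_locally`). -/
structure ModuleSubsheaf where
  sec : Opens M → Set (Π x, E x)
  isHol : ∀ {V s}, s ∈ sec V → IsHolSection (n := n) F E V s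
  zero_mem : ∀ V, (0 : Π x, E x) ∈ sec V
  add_mem : ∀ {V s t}, s ∈ sec V → t ∈ sec V → s + t ∈ sec V
  smul_mem : ∀ {V f s}, IsHolFun (n := n) V f → s ∈ sec V → (fun x => f x • s x) ∈ sec V
  restrict : ∀ {V V' s}, V' ≤ V → s ∈ sec V → s ∈ sec V'
  mem_of_locally : ∀ {V s},
    (∀ x ∈ V, ∃ V' ≤ V, x ∈ V' ∧ ∃ t ∈ sec V', ∀ y ∈ V', s y = t y) → s ∈ sec V

variable {F E}

namespace ModuleSubsheaf

/-- The subsheaf `G` of the sheaf `ℰ` of sections of `E` is saturated: `ℰ / G` is torsion-free. -/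
def IsSaturated (G : ModuleSubsheaf (n := n) F E) : Prop :=
  ∀ (V : Opens M) (f : M → ℂ) (s : Π x, E x), IsHolFun (n := n) V f → NowhereLocallyZero V f →
    IsHolSection (n := n) F E V s → (fun x => f x • s x) ∈ G.sec V → s ∈ G.sec V

/-- The subsheaf `G` is of finite type: locally there are finitely many sections of `G` generating
`G`. As `G` is a subsheaf of a locally free sheaf of finite rank, this is equivalent to `G` being a
coherent sheaf (Oka's theorem). -/
def IsFiniteType (G : ModuleSubsheaf (n := n) F E) : Prop :=
  ∀ x : M, ∃ V : Opens M, x ∈ V ∧ ∃ (k : ℕ) (g : Fin k → Π x, E x), (∀ i, g i ∈ G.sec V) ∧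
    ∀ V' ≤ V, ∀ s ∈ G.sec V', ∀ y ∈ V', ∃ V'' ≤ V', y ∈ V'' ∧
      ∃ f : Fin k → M → ℂ, (∀ i, IsHolFun (n := n) V'' (f i)) ∧
        ∀ z ∈ V'', s z = ∑ i, f i z • g i z

/-- The sheaf `ℰ` of sections of `E` is the (internal) direct sum of its subsheaves `G₁`, `G₂`:
over each open set, every section of `ℰ` is the sum of a section of `G₁` and one of `G₂`, and
`G₁ ∩ G₂ = 0`. -/
def IsDirectSum (G₁ G₂ : ModuleSubsheaf (n := n) F E) : Prop :=
  ∀ V : Opens M,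
    (∀ s : Π x, E x, IsHolSection (n := n) F E V s →
      ∃ s₁ ∈ G₁.sec V, ∃ s₂ ∈ G₂.sec V, ∀ x ∈ V, s x = s₁ x + s₂ x) ∧
    (∀ s ∈ G₁.sec V ∩ G₂.sec V, ∀ x ∈ V, s x = 0)

end ModuleSubsheaf

theorem IsHolFun.mono {V V' : Opens M} {f : M → ℂ} (hf : IsHolFun (n := n) V f)
    (h : V' ≤ V) : IsHolFun (n := n) V' f :=
  ContMDiffOn.mono hf h

theorem IsHolFun.mul {V : Opens M} {f g : M → ℂ} (hf : IsHolFun (n := n) V f)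
    (hg : IsHolFun (n := n) V g) : IsHolFun (n := n) V (fun x => f x * g x) :=
  ContMDiffOn.mul hf hg

theorem NowhereLocallyZero.mono {V V' : Opens M} {f : M → ℂ} (hf : NowhereLocallyZero V f)
    (h : V' ≤ V) : NowhereLocallyZero V' f :=
  fun O hO hne => hf O (hO.trans h) hne

theorem NowhereLocallyZero.mul {V : Opens M} {f g : M → ℂ} (hf : NowhereLocallyZero V f)
    (hfc : IsHolFun (n := n) V f) (hg : NowhereLocallyZero V g) :
    NowhereLocallyZero V (fun x => f x * g x) := by
  intro O hO hne
  obtain ⟨x, hx, hfx⟩ := hf O hO hne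
  have hc : ContinuousOn f O := (ContMDiffOn.continuousOn hfc).mono hO
  have ho : IsOpen ((O : Set M) ∩ f ⁻¹' {0}ᶜ) :=
    hc.isOpen_inter_preimage O.isOpen isOpen_compl_singleton
  obtain ⟨y, hy, hgy⟩ := hg ⟨_, ho⟩ (fun z hz => hO hz.1) ⟨x, hx, hfx⟩
  exact ⟨y, hy.1, mul_ne_zero hy.2 hgy⟩

variable [VectorBundle ℂ F E]

theorem IsHolSection.zero [ContMDiffVectorBundle ω F E (modelC n)] (V : Opens M) :
    IsHolSection (n := n) F E V 0 :=
  (Bundle.contMDiff_zeroSection ℂ E).contMDiffOn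

theorem IsHolSection.add {V : Opens M} {s t : Π x, E x} (hs : IsHolSection (n := n) F E V s)
    (ht : IsHolSection (n := n) F E V t) : IsHolSection (n := n) F E V (s + t) :=
  ContMDiffOn.add_section hs ht

theorem IsHolSection.smul {V : Opens M} {f : M → ℂ} {s : Π x, E x} (hf : IsHolFun (n := n) V f)
    (hs : IsHolSection (n := n) F E V s) : IsHolSection (n := n) F E V (fun x => f x • s x) :=
  ContMDiffOn.smul_section hf hs

namespace ModuleSubsheaf

/-- The saturation `G^sat` of `G` in the sheaf `ℰ` of sections of `E`, i.e. the kernel of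
`ℰ → (ℰ / G) / Torsion`: the sections some nonzero multiple of which lies locally in `G`. -/
def saturation [ContMDiffVectorBundle ω F E (modelC n)] (G : ModuleSubsheaf (n := n) F E) :
    ModuleSubsheaf (n := n) F E where
  sec V := {s | IsHolSection (n := n) F E V s ∧ ∀ x ∈ V, ∃ V' ≤ V, x ∈ V' ∧ ∃ f : M → ℂ,
    IsHolFun (n := n) V' f ∧ NowhereLocallyZero V' f ∧ (fun x => f x • s x) ∈ G.sec V'}
  isHol hs := hs.1
  zero_mem V := ⟨IsHolSection.zero V, fun x hx => ⟨V, le_rfl, hx, fun _ => 1, contMDiffOn_const,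
    fun O _ ⟨y, hy⟩ => ⟨y, hy, one_ne_zero⟩, by
      convert G.zero_mem V using 1
      funext y
      exact smul_zero _⟩⟩
  add_mem := by
    rintro V s t ⟨hs, hs'⟩ ⟨ht, ht'⟩
    refine ⟨hs.add ht, fun x hx => ?_⟩
    obtain ⟨A, hA, hxA, f, hf, hf0, hfs⟩ := hs' x hx
    obtain ⟨B, hB, hxB, g, hg, hg0, hgt⟩ := ht' x hx
    have hA' : A ⊓ B ≤ A := inf_le_left
    have hB' : A ⊓ B ≤ B := inf_le_right
    refine ⟨A ⊓ B, hA'.trans hA, ⟨hxA, hxB⟩, fun x => f x * g x, (hf.mono hA').mul (hg.mono hB'),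
      (hf0.mono hA').mul (hf.mono hA') (hg0.mono hB'), ?_⟩
    have h1 := G.smul_mem (hg.mono hB') (G.restrict hA' hfs)
    have h2 := G.smul_mem (hf.mono hA') (G.restrict hB' hgt)
    have h3 := G.add_mem h1 h2
    convert h3 using 1
    funext y
    simp [smul_smul, mul_comm]
  smul_mem := by
    rintro V f s hf ⟨hs, hs'⟩
    refine ⟨hs.smul hf, fun x hx => ?_⟩
    obtain ⟨A, hA, hxA, g, hg, hg0, hgs⟩ := hs' x hx
    refine ⟨A, hA, hxA, g, hg, hg0, ?_⟩
    convert G.smul_mem (hf.mono hA) hgs using 1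
    funext y
    simp [smul_smul, mul_comm]
  restrict := by
    rintro V V' s h ⟨hs, hs'⟩
    refine ⟨hs.mono h, fun x hx => ?_⟩
    obtain ⟨A, hA, hxA, g, hg, hg0, hgs⟩ := hs' x (h hx)
    exact ⟨A ⊓ V', inf_le_right, ⟨hxA, hx⟩, g, hg.mono inf_le_left, hg0.mono inf_le_left,
      G.restrict inf_le_left hgs⟩
  mem_of_locally := by
    intro V s h
    refine ⟨IsHolSection.of_locally fun x hx => ?_, fun x hx => ?_⟩
    · obtain ⟨V', h1, h2, t, ht, h3⟩ := h x hx
      exact ⟨V', h1, h2, t, ht.1, h3⟩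
    · obtain ⟨V', h1, h2, t, ht, h3⟩ := h x hx
      obtain ⟨A, hA, hxA, g, hg, hg0, hgs⟩ := ht.2 x h2
      refine ⟨A, hA.trans h1, hxA, g, hg, hg0, G.mem_of_locally fun y hy => ?_⟩
      exact ⟨A, le_rfl, hy, _, hgs, fun z hz => by simp only [h3 z (hA hz)]⟩

end ModuleSubsheaf

end Sheaves

section Tangent

variable {n : ℕ} (M : Type*) [TopologicalSpace M] [ChartedSpace (EuclideanSpace ℂ (Fin n)) M]
  [IsManifold (modelC n) ω M]

/-- The holomorphic tangent space of `M` at `x`. -/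
abbrev TanC (n : ℕ) (M : Type*) [TopologicalSpace M]
    [ChartedSpace (EuclideanSpace ℂ (Fin n)) M] (x : M) : Type :=
  TangentSpace (modelC n) x

/-- The holomorphic cotangent space of `M` at `x`. -/
abbrev CotC (n : ℕ) (M : Type*) [TopologicalSpace M]
    [ChartedSpace (EuclideanSpace ℂ (Fin n)) M] (x : M) : Type :=
  TangentSpace (modelC n) x →L[ℂ] Bundle.Trivial M ℂ x

/-- Subsheaves of `𝒪_M`-modules of the tangent sheaf `T_M` (holomorphic vector fields). -/
abbrev TangentSubsheaf (n : ℕ) (M : Type*) [TopologicalSpace M]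
    [ChartedSpace (EuclideanSpace ℂ (Fin n)) M] [IsManifold (modelC n) ω M] :=
  ModuleSubsheaf (n := n) (EuclideanSpace ℂ (Fin n)) (TanC n M)

/-- Subsheaves of `𝒪_M`-modules of the cotangent sheaf `Ω_M` (holomorphic `1`-forms). -/
abbrev CotangentSubsheaf (n : ℕ) (M : Type*) [TopologicalSpace M]
    [ChartedSpace (EuclideanSpace ℂ (Fin n)) M] [IsManifold (modelC n) ω M] :=
  ModuleSubsheaf (n := n) (EuclideanSpace ℂ (Fin n) →L[ℂ] ℂ) (CotC n M)

variable {M}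

/-- A distribution on `M`: a saturated coherent subsheaf of the tangent sheaf `T_M`. -/
def IsDistribution (W : TangentSubsheaf n M) : Prop :=
  W.IsFiniteType ∧ W.IsSaturated

/-- The kernel `Q` of `Ω_M → W^*` for a subsheaf `W ⊆ T_M`: the `1`-forms vanishing on the
sections of `W`. -/
def formsVanishingOn (W : TangentSubsheaf n M) : CotangentSubsheaf n M where
  sec V := {θ | IsHolSection (n := n) (EuclideanSpace ℂ (Fin n) →L[ℂ] ℂ) (CotC n M) V θ ∧
    ∀ V' ≤ V, ∀ X ∈ W.sec V', ∀ x ∈ V', θ x (X x) = 0}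
  isHol h := h.1
  zero_mem V := ⟨IsHolSection.zero V, fun _ _ _ _ _ _ => rfl⟩
  add_mem := by
    rintro V s t ⟨hs, hs'⟩ ⟨ht, ht'⟩
    refine ⟨hs.add ht, fun V' h X hX x hx => ?_⟩
    have h1 := hs' V' h X hX x hx
    have h2 := ht' V' h X hX x hx
    change s x (X x) + t x (X x) = 0
    rw [h1, h2]
    exact add_zero _
  smul_mem := by
    rintro V f s hf ⟨hs, hs'⟩
    refine ⟨hs.smul hf, fun V' h X hX x hx => ?_⟩
    have h1 := hs' V' h X hX x hx
    change f x • s x (X x) = 0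
    rw [h1]
    exact smul_zero _
  restrict := by
    rintro V V' s h ⟨hs, hs'⟩
    exact ⟨hs.mono h, fun A hA => hs' A (hA.trans h)⟩
  mem_of_locally := by
    intro V s h
    refine ⟨IsHolSection.of_locally fun x hx => ?_, fun A hA X hX x hx => ?_⟩
    · obtain ⟨V', h1, h2, t, ht, h3⟩ := h x hx
      exact ⟨V', h1, h2, t, ht.1, h3⟩
    · obtain ⟨V', h1, h2, t, ht, h3⟩ := h x (hA hx)
      rw [h3 x h2]
      exact ht.2 (A ⊓ V') inf_le_right X (W.restrict inf_le_left hX) x ⟨hx, h2⟩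

/-- The image of `S^* = (Ω_M / Q)^*` in `Ω_M^* = T_M` for a subsheaf `Q ⊆ Ω_M`: the vector fields
killed by the sections of `Q`. -/
def fieldsKilledBy (Q : CotangentSubsheaf n M) : TangentSubsheaf n M where
  sec V := {X | IsHolSection (n := n) (EuclideanSpace ℂ (Fin n)) (TanC n M) V X ∧
    ∀ V' ≤ V, ∀ θ ∈ Q.sec V', ∀ x ∈ V', θ x (X x) = 0}
  isHol h := h.1
  zero_mem V := ⟨IsHolSection.zero V, fun _ _ θ _ x _ => map_zero (θ x)⟩
  add_mem := by
    rintro V s t ⟨hs, hs'⟩ ⟨ht, ht'⟩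
    refine ⟨hs.add ht, fun V' h θ hθ x hx => ?_⟩
    have h1 := hs' V' h θ hθ x hx
    have h2 := ht' V' h θ hθ x hx
    refine (map_add (θ x) (s x) (t x)).trans ?_
    rw [h1, h2]
    exact add_zero _
  smul_mem := by
    rintro V f s hf ⟨hs, hs'⟩
    refine ⟨hs.smul hf, fun V' h θ hθ x hx => ?_⟩
    have h1 := hs' V' h θ hθ x hx
    refine (map_smul (θ x) (f x) (s x)).trans ?_
    rw [h1]
    exact smul_zero _
  restrict := by
    rintro V V' s h ⟨hs, hs'⟩
    exact ⟨hs.mono h, fun A hA => hs' A (hA.trans h)⟩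
  mem_of_locally := by
    intro V s h
    refine ⟨IsHolSection.of_locally fun x hx => ?_, fun A hA θ hθ x hx => ?_⟩
    · obtain ⟨V', h1, h2, t, ht, h3⟩ := h x hx
      exact ⟨V', h1, h2, t, ht.1, h3⟩
    · obtain ⟨V', h1, h2, t, ht, h3⟩ := h x (hA hx)
      rw [h3 x h2]
      exact ht.2 (A ⊓ V') inf_le_right θ (Q.restrict inf_le_left hθ) x ⟨hx, h2⟩

end Tangent

section Lifting

variable {m n : ℕ} {M : Type*} [TopologicalSpace M] [ChartedSpace (EuclideanSpace ℂ (Fin m)) M]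
  [IsManifold (modelC m) ω M]
  {N : Type*} [TopologicalSpace N] [ChartedSpace (EuclideanSpace ℂ (Fin n)) N]
  [IsManifold (modelC n) ω N]

/-- A finite surjective map of complex manifolds: holomorphic, proper, with finite fibres, and
surjective. -/
structure IsFiniteSurjective (m n : ℕ) {M : Type*} [TopologicalSpace M]
    [ChartedSpace (EuclideanSpace ℂ (Fin m)) M] {N : Type*} [TopologicalSpace N]
    [ChartedSpace (EuclideanSpace ℂ (Fin n)) N] (η : M → N) : Prop where
  isHol : ContMDiff (modelC m) (modelC n) ω η
  isProper : IsProperMap η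
  finite_fibres : ∀ y, (η ⁻¹' {y}).Finite
  surjective : Function.Surjective η

/-- The pull-back `η^*θ` of a `1`-form: `(η^*θ)_x = θ_{η(x)} ∘ dη_x`. -/
noncomputable def pullbackForm (η : M → N) (θ : Π y, CotC n N y) : Π x, CotC m M x :=
  fun x => (θ (η x)).comp (mfderiv (modelC m) (modelC n) η x)

/-- The image of `η^*Q → η^*Ω_N → Ω_M` for a subsheaf `Q ⊆ Ω_N`: the `1`-forms which are locally
`𝒪_M`-linear combinations of pull-backs of sections of `Q`. -/
noncomputable def pullbackForms (η : M → N) (Q : CotangentSubsheaf n N) : CotangentSubsheaf m M where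
  sec V := {ω' | IsHolSection (n := m) (EuclideanSpace ℂ (Fin m) →L[ℂ] ℂ) (CotC m M) V ω' ∧
    ∀ x ∈ V, ∃ V' ≤ V, x ∈ V' ∧ ∃ O : Opens N, Set.MapsTo η V' O ∧
      ∃ (k : ℕ) (f : Fin k → M → ℂ) (θ : Fin k → Π y, CotC n N y),
        (∀ i, IsHolFun (n := m) V' (f i)) ∧ (∀ i, θ i ∈ Q.sec O) ∧
        ∀ z ∈ V', ω' z = ∑ i, f i z • pullbackForm η (θ i) z}
  isHol h := h.1
  zero_mem V := ⟨IsHolSection.zero V, fun x hx => ⟨V, le_rfl, hx, ⊤, fun _ _ => trivial, 0,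
    fun i => i.elim0, fun i => i.elim0, fun i => i.elim0, fun i => i.elim0,
    fun z _ => by simp⟩⟩
  add_mem := by
    rintro V s t ⟨hs, hs'⟩ ⟨ht, ht'⟩
    refine ⟨hs.add ht, fun x hx => ?_⟩
    obtain ⟨A, hA, hxA, O, hO, k, f, θ, hf, hθ, h1⟩ := hs' x hx
    obtain ⟨B, hB, hxB, P, hP, l, g, ξ, hg, hξ, h2⟩ := ht' x hx
    refine ⟨A ⊓ B, inf_le_left.trans hA, ⟨hxA, hxB⟩, O ⊓ P, fun z hz => ⟨hO hz.1, hP hz.2⟩, k + l,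
      Fin.append f g, fun i => Fin.addCases (motive := fun _ => Π y, CotC n N y) θ ξ i,
      fun i => ?_, fun i => ?_, fun z hz => ?_⟩
    · refine Fin.addCases (fun j => ?_) (fun j => ?_) i
      · simpa using (hf j).mono inf_le_left
      · simpa using (hg j).mono inf_le_right
    · refine Fin.addCases (fun j => ?_) (fun j => ?_) i
      · simpa using Q.restrict inf_le_left (hθ j)
      · simpa using Q.restrict inf_le_right (hξ j)
    · rw [Fin.sum_univ_add]
      simp only [Fin.append_left, Fin.append_right, Fin.addCases_left, Fin.addCases_right]
      rw [← h1 z hz.1, ← h2 z hz.2]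
      rfl
  smul_mem := by
    rintro V g s hg ⟨hs, hs'⟩
    refine ⟨hs.smul hg, fun x hx => ?_⟩
    obtain ⟨A, hA, hxA, O, hO, k, f, θ, hf, hθ, h1⟩ := hs' x hx
    refine ⟨A, hA, hxA, O, hO, k, fun i x => g x * f i x, θ, fun i => (hg.mono hA).mul (hf i), hθ,
      fun z hz => ?_⟩
    simp only [h1 z hz, Finset.smul_sum, smul_smul]
  restrict := by
    rintro V V' s h ⟨hs, hs'⟩
    refine ⟨hs.mono h, fun x hx => ?_⟩
    obtain ⟨A, hA, hxA, O, hO, k, f, θ, hf, hθ, h1⟩ := hs' x (h hx)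
    exact ⟨A ⊓ V', inf_le_right, ⟨hxA, hx⟩, O, fun z hz => hO hz.1, k, f, θ,
      fun i => (hf i).mono inf_le_left, hθ, fun z hz => h1 z hz.1⟩
  mem_of_locally := by
    intro V s h
    refine ⟨IsHolSection.of_locally fun x hx => ?_, fun x hx => ?_⟩
    · obtain ⟨V', h1, h2, t, ht, h3⟩ := h x hx
      exact ⟨V', h1, h2, t, ht.1, h3⟩
    · obtain ⟨V', h1, h2, t, ht, h3⟩ := h x hx
      obtain ⟨A, hA, hxA, O, hO, k, f, θ, hf, hθ, h4⟩ := ht.2 x h2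
      exact ⟨A, hA.trans h1, hxA, O, hO, k, f, θ, hf, hθ, fun z hz => by
        rw [h3 z (hA hz), h4 z hz]⟩

/-- The lifting `η^{-1} W ⊆ T_M` of a distribution `W ⊆ T_N`: let `Q` be the kernel of
`Ω_N → W^*`, let `Q^sat` be the saturation in `Ω_M` of the image of `η^*Q`, and let `S` be
`Ω_M / Q^sat`; then `η^{-1} W = S^* ⊆ T_M`. -/
noncomputable def lifting (η : M → N) (W : TangentSubsheaf n N) : TangentSubsheaf m M :=
  fieldsKilledBy (pullbackForms (m := m) η (formsVanishingOn W)).saturation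

end Lifting

/-! ### Analytic dependence of quotients along a compact family -/

section Superposition

open Filter Topology

variable {X E F : Type*} [TopologicalSpace X] [CompactSpace X]
  [NormedAddCommGroup E] [NormedSpace ℂ E] [NormedAddCommGroup F] [NormedSpace ℂ F]

/-! Finite fibres exclude `m > n`, because `n` holomorphic functions on an open set of `ℂᵐ` then
have an infinite common level set (`exists_infinite_fibre`). Surjectivity excludes `m < n` by Sard.
So the dimensions agree, and over every nonempty open set of the target there is a point where `dη`
is bijective. Near such a point a common section of `W₁` and `W₂` lifts to a common section of the
two liftings, hence vanishes; continuity then gives `W₁ ∩ W₂ = 0` everywhere.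

For existence, let `s` be a holomorphic field near `y₀`. The splitting upstairs shows that local
generators of `W₁` and `W₂` span the tangent space at some point near `y₀`, so a frame can be chosen
from them whose determinant `δ` is not identically zero on any nonempty open set
(`exists_adapted_frame`). Cramer's rule gives `δ s = A₁ + A₂` with `Aᵢ` in `Wᵢ`. What must be
excluded is a pole of `A₁ / δ`.

Write `J` for the Jacobian of `η` in charts and `p` for the projection to the first summand
upstairs. Where `J` is invertible and `δ ≠ 0`, the pull-back of `A₁ / δ` is `J p J⁻¹ s`. Multiplied
by `det J` it becomes `J p adj(J) s`, which is continuous everywhere upstairs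
(`exists_norm_det_jacobian_mul_le`). The factor `|det J|²` is exactly the real Jacobian, so changing
variables and using properness makes `A₁ / δ` square integrable near `y₀`
(`exists_lintegral_sq_ne_top`).

A square-integrable quotient `a / d` of holomorphic functions is holomorphic
(`exists_eq_mul_of_lintegral_div_sq`): on almost every parallel disc it has no pole and obeys the
mean value property, while its mean over small circles avoiding the zeros of `d` is analytic in the
centre. Thus `s₁ = A₁ / δ` is holomorphic. Since `δ s₁` and `δ (s - s₁)` lie in `W₁` and `W₂`,
saturation puts `s₁` and `s - s₁` there. Trivial intersection makes the local decompositions unique,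
so they glue. -/

/-- The pointwise extension of a continuous multilinear map to continuous functions on a compact
space. -/
noncomputable def ContinuousMultilinearMap.superpose (X : Type*) [TopologicalSpace X]
    [CompactSpace X] {ι : Type*} [Fintype ι] (q : ContinuousMultilinearMap ℂ (fun _ : ι => E) F) :
    ContinuousMultilinearMap ℂ (fun _ : ι => C(X, E)) C(X, F) :=
  MultilinearMap.mkContinuous
    { toFun := fun u => ⟨fun t => q fun i => u i t, by fun_prop⟩
      map_update_add' := by
        intro _ u i v w
        ext t
        have h : ∀ v : C(X, E), (fun j => Function.update u i v j t)
            = Function.update (fun j => u j t) i (v t) := by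
          intro v; ext j; by_cases hj : j = i
          · subst hj; simp
          · simp [hj]
        simp [h]
      map_update_smul' := by
        intro _ u i c v
        ext t
        have h : ∀ v : C(X, E), (fun j => Function.update u i v j t)
            = Function.update (fun j => u j t) i (v t) := by
          intro v; ext j; by_cases hj : j = i
          · subst hj; simp
          · simp [hj]
        simp [h] }
    ‖q‖ fun u => by
      rw [ContinuousMap.norm_le _ (by positivity)]
      intro t
      refine (q.le_opNorm _).trans ?_
      gcongr with i
      exact (u i).norm_coe_le_norm t

theorem ContinuousMultilinearMap.norm_superpose_le {ι : Type*} [Fintype ι]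
    (q : ContinuousMultilinearMap ℂ (fun _ : ι => E) F) : ‖q.superpose X‖ ≤ ‖q‖ :=
  MultilinearMap.mkContinuous_norm_le _ (norm_nonneg _) _

/-- The formal multilinear series of the superposition operator `u ↦ f ∘ u`. -/
noncomputable def FormalMultilinearSeries.superpose (X : Type*) [TopologicalSpace X]
    [CompactSpace X] (p : FormalMultilinearSeries ℂ E F) :
    FormalMultilinearSeries ℂ C(X, E) C(X, F) :=
  fun k => (p k).superpose X

/-- Superposing does not increase the norm of any coefficient, so every geometric bound persists. -/
theorem FormalMultilinearSeries.radius_le_radius_superpose (p : FormalMultilinearSeries ℂ E F) :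
    p.radius ≤ (p.superpose X).radius := by
  refine ENNReal.le_of_forall_nnreal_lt fun r hr => ?_
  obtain ⟨C, -, hC⟩ := p.norm_mul_pow_le_of_lt_radius hr
  refine (p.superpose X).le_radius_of_bound C fun k => le_trans ?_ (hC k)
  gcongr
  exact (p k).norm_superpose_le

/-- Evaluation at `t` is continuous and linear on `C(X, E)`, so it commutes with the convergent sum.
-/
theorem FormalMultilinearSeries.superpose_sum_apply [CompleteSpace F]
    (p : FormalMultilinearSeries ℂ E F) {u : C(X, E)}
    (hu : u ∈ Metric.eball (0 : C(X, E)) p.radius) (t : X) :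
    (p.superpose X).sum u t = p.sum (u t) := by
  have hs : Summable fun k => p.superpose X k fun _ => u :=
    ((p.superpose X).summable_norm_apply
      (Metric.eball_subset_eball p.radius_le_radius_superpose hu)).of_norm
  exact (ContinuousMap.evalCLM ℂ t).map_tsum hs

/-- For analytic `a`, `d` and a compact family of points `γ t` at which `d` does not vanish, the
functions `t ↦ a (x + γ t) / d (x + γ t)` depend analytically on `x`. -/
theorem exists_analyticAt_div_comp_add {a d : E → ℂ} {p q : FormalMultilinearSeries ℂ E ℂ}
    {R : ENNReal} (ha : HasFPowerSeriesOnBall a p 0 R) (hd : HasFPowerSeriesOnBall d q 0 R)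
    (γ : C(X, E)) (hγ : γ ∈ Metric.eball (0 : C(X, E)) R) (hγd : ∀ t, d (γ t) ≠ 0) :
    ∃ g : E → C(X, ℂ), AnalyticAt ℂ g 0 ∧
      ∀ᶠ x in 𝓝 0, ∀ t, g x t = a (x + γ t) / d (x + γ t) := by
  -- Translating the whole family `γ` by `x` is an affine map into a Banach space. Composing it with
  -- an analytic superposition operator turns joint behaviour in `(x, t)` into analyticity in `x`
  -- alone.
  let K : E → C(X, E) := fun x => ContinuousMap.const X x + γ
  have hK0 : K 0 = γ := by ext t; simp [K]
  have hKa : AnalyticAt ℂ K 0 := by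
    have : AnalyticAt ℂ (fun x : E => (ContinuousLinearMap.const ℂ X : E →L[ℂ] C(X, E)) x) 0 :=
      ContinuousLinearMap.analyticAt _ _
    exact this.add analyticAt_const
  have key : ∀ {f : E → ℂ} {p : FormalMultilinearSeries ℂ E ℂ},
      HasFPowerSeriesOnBall f p 0 R → AnalyticAt ℂ (fun x => (p.superpose X).sum (K x)) 0 ∧
      ∀ᶠ x in 𝓝 0, ∀ t, (p.superpose X).sum (K x) t = f (x + γ t) := by
    intro f p hf
    have hpos : 0 < (p.superpose X).radius :=
      (hf.r_pos.trans_le hf.r_le).trans_le p.radius_le_radius_superpose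
    have h1 := (p.superpose X).hasFPowerSeriesOnBall hpos
    have h2 : AnalyticAt ℂ (p.superpose X).sum (K 0) := by
      refine h1.analyticAt_of_mem ?_
      rw [hK0]
      exact Metric.eball_subset_eball (hf.r_le.trans p.radius_le_radius_superpose) hγ
    refine ⟨h2.fun_comp hKa, ?_⟩
    have h3 : ∀ᶠ x in 𝓝 0, K x ∈ Metric.eball (0 : C(X, E)) R :=
      hKa.continuousAt.eventually_mem (Metric.isOpen_eball.mem_nhds (by rwa [hK0]))
    filter_upwards [h3] with x hx t
    rw [p.superpose_sum_apply (Metric.eball_subset_eball hf.r_le hx)]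
    have h4 : K x t ∈ Metric.eball (0 : E) R := by
      rw [mem_eball_zero_iff] at hx ⊢
      refine lt_of_le_of_lt ?_ hx
      exact enorm_le_iff_norm_le.2 ((K x).norm_coe_le_norm t)
    have h5 := hf.sum h4
    rw [zero_add] at h5
    rw [← h5]
    simp [K]
  obtain ⟨ha1, ha2⟩ := key ha
  obtain ⟨hd1, hd2⟩ := key hd
  -- A nowhere vanishing function on the compact `X` is a unit of the Banach algebra `C(X, ℂ)`, and
  -- inversion is analytic at units.
  have hu : IsUnit ((q.superpose X).sum (K 0)) := by
    rw [ContinuousMap.isUnit_iff_forall_ne_zero]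
    intro t
    have := hd2.self_of_nhds t
    rw [this, zero_add]
    exact hγd t
  obtain ⟨U, hU⟩ := hu
  have hinv : AnalyticAt ℂ (fun x => Ring.inverse ((q.superpose X).sum (K x))) 0 := by
    have := analyticAt_inverse (𝕜 := ℂ) U
    exact this.fun_comp_of_eq hd1 hU.symm
  refine ⟨_, ha1.mul hinv, ?_⟩
  have hun : ∀ᶠ x in 𝓝 0, IsUnit ((q.superpose X).sum (K x)) :=
    hd1.continuousAt.eventually_mem (Units.isOpen.mem_nhds (by exact ⟨U, hU⟩))
  filter_upwards [ha2, hd2, hun] with x h1 h2 h3 t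
  have h4 := congrArg (fun f : C(X, ℂ) => f t) (Ring.mul_inverse_cancel _ h3)
  simp only [ContinuousMap.mul_apply, ContinuousMap.one_apply] at h4
  rw [h2 t] at h4
  have h5 : d (x + γ t) ≠ 0 := fun h => by simp [h] at h4
  rw [Pi.mul_apply, ContinuousMap.mul_apply, h1 t, eq_div_iff h5, mul_assoc, mul_comm _ (d _), h4,
    mul_one]

end Superposition

/-! ### Square-integrable quotients in one variable -/

section OneVariable

open Filter Topology MeasureTheory Metric

theorem lintegral_ball_inv_sq_eq_top {r : ℝ} (hr : 0 < r) (z₀ : ℂ) :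
    ∫⁻ z in ball z₀ r, (‖z - z₀‖ₑ⁻¹) ^ 2 = ⊤ := by
  by_contra hfin
  have h0 : ∫⁻ z in ball (0 : ℂ) r, (‖z‖ₑ⁻¹) ^ 2 ≠ ⊤ := by
    rw [← lintegral_indicator measurableSet_ball] at hfin ⊢
    rw [← lintegral_sub_right_eq_self _ z₀] at ⊢
    have : (fun z : ℂ => (ball (0 : ℂ) r).indicator (fun z => ‖z‖ₑ⁻¹ ^ 2) (z - z₀))
        = (ball z₀ r).indicator fun z => ‖z - z₀‖ₑ⁻¹ ^ 2 := by
      ext z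
      simp [Set.indicator, dist_eq_norm]
    rw [this]
    exact hfin
  have h1 : Integrable (fun z : ℂ => (Set.Iio r).indicator (fun y : ℝ => (y⁻¹) ^ 2) ‖z‖) := by
    refine ⟨by
      refine Measurable.aestronglyMeasurable ?_
      exact ((measurable_id.inv.pow_const 2).indicator measurableSet_Iio).comp measurable_norm, ?_⟩
    rw [← lintegral_indicator measurableSet_ball] at h0
    refine lt_of_le_of_lt (lintegral_mono fun z => ?_) (lt_top_iff_ne_top.2 h0)
    by_cases hz : ‖z‖ < r
    · simp only [Set.indicator, Set.mem_Iio, hz, if_true, mem_ball, dist_zero_right, enorm_pow]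
      gcongr
      by_cases hz0 : z = 0
      · simp [hz0]
      · rw [enorm_inv (by simpa using hz0), enorm_norm]
    · simp [Set.indicator, hz]
  -- In polar coordinates the area element contributes one factor `y`, leaving the divergent
  -- integral of `1 / y` at `0`.
  rw [integrable_fun_norm_addHaar (μ := volume)
    (f := (Set.Iio r).indicator (fun y : ℝ => (y⁻¹) ^ 2))] at h1
  rw [Complex.finrank_real_complex] at h1
  have h2 : IntegrableOn (fun y : ℝ => y⁻¹) (Set.Ioo 0 r) := by
    refine (h1.mono_set (Set.Ioo_subset_Ioi_self)).congr_fun (fun y hy => ?_) measurableSet_Ioo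
    have : y ≠ 0 := hy.1.ne'
    simp [Set.indicator, hy.2]
    field_simp
  have h3 : IntervalIntegrable (fun y : ℝ => y⁻¹) volume 0 r := by
    rw [intervalIntegrable_iff_integrableOn_Ioo_of_le hr.le]
    exact h2
  rw [intervalIntegrable_inv_iff] at h3
  rcases h3 with h3 | h3
  · exact hr.ne h3
  · exact h3 Set.left_mem_uIcc

/-- An `L²` quotient of holomorphic functions of one variable is holomorphic. -/
theorem AnalyticAt.exists_eq_mul_of_lintegral_div_sq {a d : ℂ → ℂ} {z₀ : ℂ}
    (ha : AnalyticAt ℂ a z₀) (hd : AnalyticAt ℂ d z₀) (hd0 : ¬ ∀ᶠ z in 𝓝 z₀, d z = 0)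
    {s : Set ℂ} (hs : s ∈ 𝓝 z₀) (hL : ∫⁻ z in s, ‖a z / d z‖ₑ ^ 2 ≠ ⊤) :
    ∃ c : ℂ → ℂ, AnalyticAt ℂ c z₀ ∧ ∀ᶠ z in 𝓝 z₀, a z = d z * c z := by
  by_cases ha0 : ∀ᶠ z in 𝓝 z₀, a z = 0
  · exact ⟨fun _ => 0, analyticAt_const, by simpa using ha0⟩
  obtain ⟨k, u, hu, hu0, hdu⟩ := hd.exists_eventuallyEq_pow_smul_nonzero_iff.2 hd0
  obtain ⟨l, v, hv, hv0, hav⟩ := ha.exists_eventuallyEq_pow_smul_nonzero_iff.2 ha0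
  have hun : ∀ᶠ z in 𝓝 z₀, u z ≠ 0 := hu.continuousAt.eventually_ne hu0
  rcases le_or_gt k l with hkl | hkl
  · refine ⟨fun z => (z - z₀) ^ (l - k) * (v z / u z), by fun_prop (disch := assumption), ?_⟩
    filter_upwards [hdu, hav, hun] with z h1 h2 h3
    rw [h1, h2, smul_eq_mul, smul_eq_mul]
    obtain ⟨j, rfl⟩ := Nat.exists_eq_add_of_le hkl
    field_simp
    rw [Nat.add_sub_cancel_left, pow_add]
    ring
  -- Here `d` vanishes to higher order than `a`, so `|a / d| ≥ C / |z - z₀|` close to `z₀`, which is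
  -- not square integrable. The restriction to the unit disc around `z₀` lets a pole of any order be
  -- bounded below by a simple one.
  · exfalso
    have hq : ContinuousAt (fun z => ‖v z / u z‖) z₀ :=
      (hv.continuousAt.div hu.continuousAt hu0).norm
    obtain ⟨C, hC0, hC⟩ : ∃ C : ℝ, 0 < C ∧ C < ‖v z₀ / u z₀‖ :=
      exists_between (norm_pos_iff.2 (div_ne_zero hv0 hu0))
    have hCn : ∀ᶠ z in 𝓝 z₀, C < ‖v z / u z‖ := hq.eventually_const_lt hC
    have hball : ∀ᶠ z in 𝓝 z₀, z ∈ ball z₀ 1 := ball_mem_nhds z₀ one_pos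
    obtain ⟨r, hr, hr'⟩ := Metric.mem_nhds_iff.1
      (((hdu.and hav).and (hun.and (hCn.and hball))).and hs)
    have key : ∀ z ∈ ball z₀ r, ENNReal.ofReal C ^ 2 * ((‖z - z₀‖ₑ⁻¹) ^ 2) ≤ ‖a z / d z‖ₑ ^ 2
        ∨ z = z₀ := by
      intro z hz
      by_cases hzz : z = z₀
      · exact Or.inr hzz
      refine Or.inl ?_
      obtain ⟨⟨⟨h1, h2⟩, h3, h4, h5⟩, -⟩ := hr' hz
      have hne : z - z₀ ≠ 0 := sub_ne_zero.2 hzz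
      rw [← mul_pow]
      gcongr
      rw [← enorm_inv hne, ← ofReal_norm, ← ofReal_norm, ← ENNReal.ofReal_mul hC0.le]
      apply ENNReal.ofReal_le_ofReal
      have : a z / d z = v z / u z * ((z - z₀) ^ (k - l))⁻¹ := by
        rw [h1, h2, smul_eq_mul, smul_eq_mul]
        obtain ⟨j, rfl⟩ := Nat.exists_eq_add_of_lt hkl
        rw [add_assoc, Nat.add_sub_cancel_left, pow_add]
        field_simp
      rw [this, norm_mul]
      gcongr
      rw [norm_inv, norm_inv, norm_pow]
      have hp : 0 < ‖z - z₀‖ := norm_pos_iff.2 hne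
      have hlt : ‖z - z₀‖ < 1 := by simpa [dist_eq_norm] using h5
      gcongr
      exact pow_le_of_le_one hp.le hlt.le (by omega)
    have h6 : ∫⁻ z in ball z₀ r, ENNReal.ofReal C ^ 2 * ((‖z - z₀‖ₑ⁻¹) ^ 2)
        ≤ ∫⁻ z in ball z₀ r, ‖a z / d z‖ₑ ^ 2 := by
      refine lintegral_mono_ae ?_
      have hne : ∀ᵐ z ∂(volume.restrict (ball z₀ r)), z ≠ z₀ :=
        ae_restrict_of_ae (by simp [ae_iff])
      filter_upwards [ae_restrict_mem measurableSet_ball, hne] with z hz hz'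
      exact (key z hz).resolve_right hz'
    rw [lintegral_const_mul' _ _ (by simp), lintegral_ball_inv_sq_eq_top hr, ENNReal.mul_top
      (by simp [hC0])] at h6
    refine hL (top_le_iff.1 (h6.trans (lintegral_mono_set fun z hz => (hr' hz).2)))

/-- Mean value property for an `L²` quotient of holomorphic functions on a disc. -/
theorem mul_circleAverage_div_eq {a d : ℂ → ℂ} {ε : ℝ} (hε : 0 < ε)
    (ha : AnalyticOnNhd ℂ a (closedBall 0 ε)) (hd : AnalyticOnNhd ℂ d (closedBall 0 ε))
    (hd0 : ∀ z ∈ sphere (0 : ℂ) ε, d z ≠ 0)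
    (hL : ∫⁻ z in ball 0 ε, ‖a z / d z‖ₑ ^ 2 ≠ ⊤) :
    d 0 * Real.circleAverage (fun z => a z / d z) 0 ε = a 0 := by
  have hconn : IsPreconnected (closedBall (0 : ℂ) ε) := (convex_closedBall 0 ε).isPreconnected
  have hne : ∀ z ∈ closedBall (0 : ℂ) ε, ¬ ∀ᶠ w in 𝓝 z, d w = 0 := by
    intro z hz h
    have h1 := hd.eqOn_zero_of_preconnected_of_eventuallyEq_zero hconn hz h
    have hmem : (ε : ℂ) ∈ sphere (0 : ℂ) ε := by simp [abs_of_pos hε]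
    exact hd0 _ hmem (h1 (sphere_subset_closedBall hmem))
  -- Inside the disc the quotient extends by square integrability; on the boundary circle `d` has no
  -- zero and plain division works.
  have hloc : ∀ z ∈ closedBall (0 : ℂ) ε, ∃ c : ℂ → ℂ, AnalyticAt ℂ c z ∧
      ∀ᶠ w in 𝓝 z, a w = d w * c w := by
    intro z hz
    by_cases hz' : z ∈ ball (0 : ℂ) ε
    · exact (ha z hz).exists_eq_mul_of_lintegral_div_sq (hd z hz) (hne z hz)
        (isOpen_ball.mem_nhds hz') hL
    · have hzs : d z ≠ 0 := hd0 z (by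
        rw [mem_sphere]; rw [mem_closedBall] at hz; rw [mem_ball, not_lt] at hz'
        exact le_antisymm hz hz')
      refine ⟨fun w => a w / d w, (ha z hz).div (hd z hz) hzs, ?_⟩
      filter_upwards [(hd z hz).continuousAt.eventually_ne hzs] with w hw
      field_simp
  choose! c hc hac using hloc
  -- Zeros of `d` are isolated, so neighbouring local quotients agree and the diagonal `z ↦ c z z`
  -- is one function: continuous on the closed disc and holomorphic inside.
  have hloc2 : ∀ z ∈ closedBall (0 : ℂ) ε, ∀ᶠ w in 𝓝 z, w ∈ closedBall (0 : ℂ) ε →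
      c w w = c z w := by
    intro z hz
    have h1 : ∀ᶠ w in 𝓝 z, w ≠ z → d w ≠ 0 := by
      have := (hd z hz).eventually_eq_zero_or_eventually_ne_zero.resolve_left (hne z hz)
      exact eventually_nhdsWithin_iff.1 this
    filter_upwards [h1, hac z hz] with w h2 h3 hw
    by_cases hwz : w = z
    · rw [hwz]
    · have h4 := (hac w hw).self_of_nhds
      rw [h3] at h4
      exact (mul_left_cancel₀ (h2 hwz) h4).symm
  have hm : Real.circleAverage (fun z => c z z) 0 ε = c 0 0 := by
    have habs : |ε| = ε := abs_of_pos hε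
    refine circleAverage_of_differentiable_on_off_countable Set.countable_empty ?_ ?_
    · rw [habs]
      intro z hz
      have h1 : ContinuousWithinAt (c z) (closedBall 0 ε) z :=
        (hc z hz).continuousAt.continuousWithinAt
      refine h1.congr_of_eventuallyEq ?_ rfl
      filter_upwards [mem_nhdsWithin_of_mem_nhds (hloc2 z hz), self_mem_nhdsWithin] with w h2 h3
      exact h2 h3
    · rw [habs]
      intro z hz
      have hz' := ball_subset_closedBall hz.1
      refine (hc z hz').differentiableAt.congr_of_eventuallyEq ?_
      filter_upwards [hloc2 z hz', isOpen_ball.mem_nhds hz.1] with w h2 h3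
      exact h2 (ball_subset_closedBall h3)
  have hcong : Real.circleAverage (fun z => a z / d z) 0 ε
      = Real.circleAverage (fun z => c z z) 0 ε := by
    refine Real.circleAverage_congr_sphere fun z hz => ?_
    rw [abs_of_pos hε] at hz
    have h1 := (hac z (sphere_subset_closedBall hz)).self_of_nhds
    have h2 := hd0 z hz
    rw [h1]
    field_simp
  rw [hcong, hm]
  exact (hac 0 (mem_closedBall_self hε.le)).self_of_nhds.symm

end OneVariable

/-! ### Square-integrable quotients in several variables -/

section Division

open Filter Topology MeasureTheory Metric

/-- Averaging over a circle, as a functional on the continuous functions on the circle. -/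
noncomputable def circleAverageCLM {ε : ℝ} (hε : 0 ≤ ε) : C(sphere (0 : ℂ) ε, ℂ) →L[ℂ] ℂ :=
  have hcont : Continuous fun θ : ℝ =>
      (⟨circleMap 0 ε θ, circleMap_mem_sphere 0 hε θ⟩ : sphere (0 : ℂ) ε) :=
    (continuous_circleMap 0 ε).subtype_mk _
  LinearMap.mkContinuous
    { toFun := fun g => (2 * Real.pi : ℝ)⁻¹ • ∫ θ in (0 : ℝ)..2 * Real.pi,
        g ⟨circleMap 0 ε θ, circleMap_mem_sphere 0 hε θ⟩
      map_add' := fun f g => by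
        simp only [ContinuousMap.add_apply]
        rw [intervalIntegral.integral_add, smul_add]
        · exact (f.continuous.comp hcont).intervalIntegrable _ _
        · exact (g.continuous.comp hcont).intervalIntegrable _ _
      map_smul' := fun c f => by
        simp only [ContinuousMap.smul_apply, RingHom.id_apply]
        rw [intervalIntegral.integral_smul, smul_comm] }
    1 fun g => by
      have h1 : ‖∫ θ in (0 : ℝ)..2 * Real.pi, g ⟨circleMap 0 ε θ, circleMap_mem_sphere 0 hε θ⟩‖
          ≤ ‖g‖ * |2 * Real.pi - 0| :=
        intervalIntegral.norm_integral_le_of_norm_le_const fun θ _ => g.norm_coe_le_norm _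
      have hpi : 0 < 2 * Real.pi := Real.two_pi_pos
      rw [sub_zero, abs_of_pos hpi] at h1
      change ‖(2 * Real.pi : ℝ)⁻¹ • (_ : ℂ)‖ ≤ _
      rw [norm_smul, norm_inv, Real.norm_of_nonneg hpi.le, one_mul, inv_mul_le_iff₀ hpi, mul_comm _ ‖g‖]
      exact h1

theorem circleAverageCLM_eq {ε : ℝ} (hε : 0 ≤ ε) (g : C(sphere (0 : ℂ) ε, ℂ)) {f : ℂ → ℂ}
    (h : ∀ t : sphere (0 : ℂ) ε, g t = f t) :
    circleAverageCLM hε g = Real.circleAverage f 0 ε := by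
  change (2 * Real.pi : ℝ)⁻¹ • (_ : ℂ) = _
  rw [Real.circleAverage]
  congr 1
  exact intervalIntegral.integral_congr fun θ _ => h _

variable {E : Type*} [NormedAddCommGroup E] [NormedSpace ℂ E]

/-- Some `e` near `0` has `d e ≠ 0`, so by the identity theorem `d` is not identically zero near `0`
on the complex line through `e`. Its zeros there are isolated, and a small circle avoids them. -/
theorem exists_line_ne_zero {d : E → ℂ} (hd : AnalyticAt ℂ d 0)
    (hd0 : ¬ ∀ᶠ x in 𝓝 0, d x = 0) {r : ℝ} (hr : 0 < r) :
    ∃ e : E, ‖e‖ < r ∧ ∃ ε ∈ Set.Ioo (0 : ℝ) 1, ∀ z ∈ sphere (0 : ℂ) ε, d (z • e) ≠ 0 := by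
  obtain ⟨ρ, hρ, hρd⟩ := Metric.eventually_nhds_iff_ball.1 hd.eventually_analyticAt
  have h1 : ∃ᶠ x in 𝓝 0, d x ≠ 0 := not_eventually.1 hd0
  obtain ⟨e, hde, he⟩ := (h1.and_eventually (ball_mem_nhds 0 (lt_min hr hρ))).exists
  rw [dist_zero_right] at he
  refine ⟨e, he.trans_le (min_le_left _ _), ?_⟩
  have hD : AnalyticOnNhd ℂ (fun z : ℂ => d (z • e)) (closedBall 0 1) := by
    intro z hz
    have h2 : AnalyticAt ℂ d (z • e) := by
      refine hρd _ ?_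
      rw [mem_ball_zero_iff, norm_smul]
      rw [mem_closedBall_zero_iff] at hz
      refine lt_of_le_of_lt (mul_le_of_le_one_left (norm_nonneg _) hz)
        (he.trans_le (min_le_right _ _))
    exact h2.fun_comp_of_eq (analyticAt_id.smul analyticAt_const) rfl
  have hn : ¬ ∀ᶠ z : ℂ in 𝓝 0, d (z • e) = 0 := fun h => by
    have h3 := hD.eqOn_zero_of_preconnected_of_eventuallyEq_zero
      (convex_closedBall 0 1).isPreconnected (mem_closedBall_self zero_le_one) h
    have h4 := h3 (show (1 : ℂ) ∈ closedBall (0 : ℂ) 1 by simp)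
    simp [hde] at h4
  have h5 := (hD 0 (by simp)).eventually_eq_zero_or_eventually_ne_zero.resolve_left hn
  obtain ⟨δ, hδ, hδd⟩ := Metric.mem_nhds_iff.1 (eventually_nhdsWithin_iff.1 h5)
  obtain ⟨ε, hε0, hε1⟩ := exists_between (lt_min hδ one_pos)
  refine ⟨ε, ⟨hε0, hε1.trans_le (min_le_right _ _)⟩, fun z hz => ?_⟩
  have hzn : ‖z‖ = ε := by simpa using hz
  refine hδd ?_ ?_
  · simpa [hzn] using hε1.trans_le (min_le_left _ _)
  · rintro rfl
    simp at hzn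
    exact hε0.ne hzn

variable [FiniteDimensional ℂ E] [MeasurableSpace E] [BorelSpace E] (μ : Measure E)
  [μ.IsAddHaarMeasure]

/-- Tonelli: a function with finite integral near `0` has finite integral over almost all translates
of a disc in a given direction. -/
theorem ae_lintegral_line_ne_top {h : E → ENNReal} (hm : Measurable h)
    (hfin : ∫⁻ x, h x ∂μ ≠ ⊤) (e : E) (ε : ℝ) :
    ∀ᵐ x ∂μ, ∫⁻ z in ball (0 : ℂ) ε, h (x + z • e) ≠ ⊤ := by
  have : SecondCountableTopology E := by
    have := FiniteDimensional.proper ℂ E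
    infer_instance
  have : SigmaFinite μ := by
    have := FiniteDimensional.proper ℂ E
    infer_instance
  have hmeas : Measurable fun p : E × ℂ => h (p.1 + p.2 • e) := hm.comp
    (measurable_fst.add (measurable_snd.smul_const e))
  have h1 : ∫⁻ x, (∫⁻ z in ball (0 : ℂ) ε, h (x + z • e)) ∂μ ≠ ⊤ := by
    rw [lintegral_lintegral_swap hmeas.aemeasurable]
    simp only [lintegral_add_right_eq_self]
    rw [setLIntegral_const]
    exact ENNReal.mul_ne_top hfin measure_ball_lt_top.ne
  have h2 := ae_lt_top (hmeas.lintegral_prod_right') h1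
  filter_upwards [h2] with x hx using hx.ne

/-- The quotient is defined as the circle mean of `a / d` in a direction `e` along which `d` has no
zero on the circle. This mean is analytic in the centre wherever or not `d` vanishes there. By
Tonelli and the one-variable mean value property, `d` times the mean equals `a` almost everywhere,
hence everywhere near `0` by continuity. -/
theorem exists_eq_mul_of_lintegral_div_sq_zero {a d : E → ℂ} (ha : AnalyticAt ℂ a 0)
    (hd : AnalyticAt ℂ d 0) (hd0 : ¬ ∀ᶠ x in 𝓝 0, d x = 0) {s : Set E} (hs : s ∈ 𝓝 0)
    (hL : ∫⁻ x in s, ‖a x / d x‖ₑ ^ 2 ∂μ ≠ ⊤) :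
    ∃ b : E → ℂ, AnalyticAt ℂ b 0 ∧ ∀ᶠ x in 𝓝 0, a x = d x * b x := by
  obtain ⟨p, R₁, hp⟩ := ha
  obtain ⟨q, R₂, hq⟩ := hd
  have hR : 0 < min R₁ R₂ := lt_min hp.r_pos hq.r_pos
  replace hp := hp.mono hR (min_le_left _ _)
  replace hq := hq.mono hR (min_le_right _ _)
  set R := min R₁ R₂
  have haR : ∀ x ∈ eball (0 : E) R, AnalyticAt ℂ a x := fun x hx => hp.analyticAt_of_mem hx
  have hdR : ∀ x ∈ eball (0 : E) R, AnalyticAt ℂ d x := fun x hx => hq.analyticAt_of_mem hx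
  obtain ⟨ρ, hρ, hρs⟩ := Metric.mem_nhds_iff.1
    (inter_mem hs (Metric.isOpen_eball.mem_nhds (mem_eball_self hR) : eball (0 : E) R ∈ 𝓝 0))
  obtain ⟨e, her, ε, ⟨hε0, hε1⟩, hde⟩ := exists_line_ne_zero hq.analyticAt hd0 hρ
  have hεe : ∀ z ∈ closedBall (0 : ℂ) ε, z • e ∈ ball (0 : E) ρ := by
    intro z hz
    rw [mem_ball_zero_iff, norm_smul]
    rw [mem_closedBall_zero_iff] at hz
    exact lt_of_le_of_lt (mul_le_of_le_one_left (norm_nonneg _) (hz.trans hε1.le)) her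
  let γ : C(sphere (0 : ℂ) ε, E) := ⟨fun z => (z : ℂ) • e, by fun_prop⟩
  have hγ : γ ∈ eball (0 : C(sphere (0 : ℂ) ε, E)) R := by
    have h1 : (ε : ℂ) • e ∈ eball (0 : E) R :=
      (hρs (hεe ε (by simp [abs_of_pos hε0]))).2
    rw [mem_eball_zero_iff] at h1 ⊢
    refine lt_of_le_of_lt (enorm_le_iff_norm_le.2 ?_) h1
    rw [ContinuousMap.norm_le _ (norm_nonneg _)]
    intro t
    have : ‖(t : ℂ)‖ = ε := by simp
    simp [γ, norm_smul, this, abs_of_pos hε0]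
  obtain ⟨g, hga, hg⟩ := exists_analyticAt_div_comp_add hp hq γ hγ fun t => hde t t.2
  have hba : AnalyticAt ℂ (fun x => circleAverageCLM hε0.le (g x)) 0 :=
    ((circleAverageCLM hε0.le).analyticAt _).fun_comp_of_eq hga rfl
  refine ⟨_, hba, ?_⟩
  -- points `x` such that the translated disc stays in the ball
  obtain ⟨η, hη0, hηe⟩ : ∃ η > 0, ∀ x ∈ ball (0 : E) η, ∀ z ∈ closedBall (0 : ℂ) ε,
      x + z • e ∈ ball (0 : E) ρ := by
    refine ⟨ρ - ‖e‖, sub_pos.2 her, fun x hx z hz => ?_⟩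
    rw [mem_ball_zero_iff] at hx ⊢
    rw [mem_closedBall_zero_iff] at hz
    have h1 : ‖z • e‖ ≤ ‖e‖ := by
      rw [norm_smul]; exact mul_le_of_le_one_left (norm_nonneg _) (hz.trans hε1.le)
    linarith [norm_add_le x (z • e)]
  have hdne : ∀ᶠ x in 𝓝 (0 : E), ∀ z ∈ sphere (0 : ℂ) ε, d (x + z • e) ≠ 0 := by
    refine (isCompact_sphere (0 : ℂ) ε).eventually_forall_of_forall_eventually fun z hz => ?_
    have h1 : ContinuousAt (fun p : E × ℂ => d (p.1 + p.2 • e)) (0, z) := by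
      have h2 : ContinuousAt d ((0 : E) + z • e) := by
        rw [zero_add]
        exact (hdR _ (hρs (hεe z (sphere_subset_closedBall hz))).2).continuousAt
      exact ContinuousAt.comp (f := fun p : E × ℂ => p.1 + p.2 • e) h2 (by fun_prop)
    exact h1.eventually_ne (by simpa using hde z hz)
  obtain ⟨η', hη', hη'd⟩ := Metric.eventually_nhds_iff_ball.1
    ((hdne.and hg).and (hba.eventually_analyticAt.and (ball_mem_nhds 0 hη0)))
  have hcont : ContinuousOn (fun x => a x / d x) (ball 0 ρ ∩ {x | d x ≠ 0}) := fun x hx =>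
    ((haR x (hρs hx.1).2).continuousAt.div (hdR x (hρs hx.1).2).continuousAt
      hx.2).continuousWithinAt
  have hdcont : ContinuousOn d (ball 0 ρ) := fun x hx =>
    (hdR x (hρs hx).2).continuousAt.continuousWithinAt
  have hopen : IsOpen (ball (0 : E) ρ ∩ {x | d x ≠ 0}) :=
    hdcont.isOpen_inter_preimage isOpen_ball isOpen_compl_singleton
  classical
  -- Cutting off to the open set where `d ≠ 0` secures measurability on all of `E`. On the ball
  -- nothing changes, as division by zero returns `0`.
  let h : E → ENNReal := (ball (0 : E) ρ ∩ {x | d x ≠ 0}).indicator fun x => ‖a x / d x‖ₑ ^ 2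
  have hm : Measurable h := by
    have h1 : Measurable ((ball (0 : E) ρ ∩ {x | d x ≠ 0}).indicator fun x => a x / d x) := by
      have := hcont.measurable_piecewise (g := (0 : E → ℂ)) continuousOn_const
        hopen.measurableSet
      rwa [Set.piecewise_eq_indicator] at this
    convert (h1.enorm.pow_const 2) using 1
    ext x
    by_cases hx : x ∈ ball (0 : E) ρ ∩ {x | d x ≠ 0}
    · simp only [h, Set.indicator_of_mem hx]
    · simp only [h, Set.indicator_of_notMem hx]; simp
  have hh : ∀ x ∈ ball (0 : E) ρ, h x = ‖a x / d x‖ₑ ^ 2 := by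
    intro x hx
    by_cases hx' : d x = 0
    · simp [h, hx']
    · simp only [h]
      rw [Set.indicator_of_mem]
      exact ⟨hx, hx'⟩
  have hfin : ∫⁻ x, h x ∂μ ≠ ⊤ := by
    refine ne_top_of_le_ne_top hL ?_
    rw [lintegral_indicator hopen.measurableSet]
    exact lintegral_mono_set fun x hx => (hρs hx.1).1
  have hae := ae_lintegral_line_ne_top μ hm hfin e ε
  have hEq : (ball (0 : E) η').EqOn a (fun x => d x * circleAverageCLM hε0.le (g x)) := by
    refine Measure.eqOn_open_of_ae_eq (μ := μ) ?_ isOpen_ball ?_ ?_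
    · filter_upwards [ae_restrict_of_ae hae, ae_restrict_mem measurableSet_ball] with x hx hxb
      obtain ⟨⟨h1, h2⟩, h3, h4⟩ := hη'd x hxb
      have hline : ∀ z ∈ closedBall (0 : ℂ) ε, x + z • e ∈ ball (0 : E) ρ := hηe x h4
      have haff : ∀ z : ℂ, AnalyticAt ℂ (fun z : ℂ => x + z • e) z := fun z =>
        analyticAt_const.add (analyticAt_id.smul analyticAt_const)
      have := mul_circleAverage_div_eq (a := fun z => a (x + z • e)) (d := fun z => d (x + z • e))
        hε0 (fun z hz => (haR _ (hρs (hline z hz)).2).fun_comp_of_eq (haff z) rfl)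
        (fun z hz => (hdR _ (hρs (hline z hz)).2).fun_comp_of_eq (haff z) rfl) h1 (by
          rw [setLIntegral_congr_fun measurableSet_ball
            (fun z hz => (hh _ (hline z (ball_subset_closedBall hz))).symm)]
          exact hx)
      simp only [zero_smul, add_zero] at this
      rw [circleAverageCLM_eq hε0.le (g x) (f := fun z => a (x + z • e) / d (x + z • e)) h2, this]
    · intro x hx
      have hx' : x ∈ ball (0 : E) ρ := by
        simpa using hηe x (hη'd x hx).2.2 0 (by simp [hε0.le])
      exact (haR x (hρs hx').2).continuousAt.continuousWithinAt
    · intro x hx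
      have hx' : x ∈ ball (0 : E) ρ := by
        simpa using hηe x (hη'd x hx).2.2 0 (by simp [hε0.le])
      exact ((hdR x (hρs hx').2).continuousAt.mul
        (hη'd x hx).2.1.continuousAt).continuousWithinAt
  filter_upwards [ball_mem_nhds 0 hη'] with x hx using hEq hx

/-- An `L²` quotient of holomorphic functions is holomorphic. -/
theorem exists_eq_mul_of_lintegral_div_sq {a d : E → ℂ} {x₀ : E} (ha : AnalyticAt ℂ a x₀)
    (hd : AnalyticAt ℂ d x₀) (hd0 : ¬ ∀ᶠ x in 𝓝 x₀, d x = 0) {s : Set E} (hs : s ∈ 𝓝 x₀)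
    (hL : ∫⁻ x in s, ‖a x / d x‖ₑ ^ 2 ∂μ ≠ ⊤) :
    ∃ b : E → ℂ, AnalyticAt ℂ b x₀ ∧ ∀ᶠ x in 𝓝 x₀, a x = d x * b x := by
  have hmap : Tendsto (fun x : E => x - x₀) (𝓝 x₀) (𝓝 0) := by
    have : ContinuousAt (fun x : E => x - x₀) x₀ := by fun_prop
    simpa [ContinuousAt] using this
  have hmap' : Tendsto (fun x : E => x₀ + x) (𝓝 0) (𝓝 x₀) := by
    have : ContinuousAt (fun x : E => x₀ + x) 0 := by fun_prop
    simpa [ContinuousAt] using this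
  have hT : AnalyticAt ℂ (fun x : E => x₀ + x) 0 := analyticAt_const.add analyticAt_id
  obtain ⟨b, hb, hab⟩ := exists_eq_mul_of_lintegral_div_sq_zero μ (a := fun x => a (x₀ + x))
    (d := fun x => d (x₀ + x)) (ha.fun_comp_of_eq hT (add_zero _)) (hd.fun_comp_of_eq hT (add_zero _))
    (fun h => hd0 ((hmap.eventually h).mono fun x hx => by simpa using hx))
    (s := (fun x => x₀ + x) ⁻¹' s) (hmap' hs) (by
      have hmp := measurePreserving_add_left μ x₀
      rwa [hmp.setLIntegral_comp_preimage_emb (MeasurableEquiv.addLeft x₀).measurableEmbedding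
        (fun x => ‖a x / d x‖ₑ ^ 2)])
  refine ⟨fun x => b (x - x₀), hb.fun_comp_of_eq (analyticAt_id.sub analyticAt_const) (by simp), ?_⟩
  filter_upwards [hmap.eventually hab] with x hx
  simpa using hx

end Division

/-! ### Infinite common fibres of few holomorphic functions -/

section InfiniteFibre

open Filter Topology Metric Module

/-- Fewer than `dim E` holomorphic functions on a nonempty open set of `E` have an infinite common
fibre. -/
theorem exists_infinite_fibre (k : ℕ) : ∀ (E : Type) [NormedAddCommGroup E] [NormedSpace ℂ E]
    [FiniteDimensional ℂ E], k < finrank ℂ E → ∀ O : Set E, IsOpen O → O.Nonempty →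
    ∀ F : Fin k → E → ℂ, (∀ i, ContDiffOn ℂ 1 (F i) O) →
    ∃ c : Fin k → ℂ, {x ∈ O | ∀ i, F i x = c i}.Infinite := by
  induction k with
  | zero =>
    intro E _ _ _ hk O hO ⟨x, hx⟩ F _
    have : Nontrivial E := nontrivial_of_finrank_pos hk
    have : (𝓝[≠] x).NeBot := Module.punctured_nhds_neBot ℂ E x
    refine ⟨fun i => i.elim0, ?_⟩
    simpa using infinite_of_mem_nhds x (hO.mem_nhds hx)
  | succ k ih =>
    intro E _ _ _ hk O hO hne F hF
    -- If the last function has zero derivative it is constant on a ball and can be dropped.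
    -- Otherwise the implicit function theorem parametrizes a level set of it by the kernel of the
    -- derivative, losing one function and one dimension. This change of space is why `E` is
    -- quantified inside the induction.
    by_cases hz : ∀ x ∈ O, fderiv ℂ (F (Fin.last k)) x = 0
    · obtain ⟨x, hx⟩ := hne
      obtain ⟨r, hr, hrO⟩ := Metric.isOpen_iff.1 hO x hx
      have hconst : ∀ y ∈ ball x r, F (Fin.last k) y = F (Fin.last k) x := fun y hy =>
        (convex_ball x r).is_const_of_fderivWithin_eq_zero
          (fun z hz' => (((hF _).differentiableOn one_ne_zero).mono hrO) z hz')
          (fun z hz' => by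
            rw [fderivWithin_of_isOpen isOpen_ball hz']
            exact hz z (hrO hz')) hy (mem_ball_self hr)
      obtain ⟨c, hc⟩ := ih E (by omega) (ball x r) isOpen_ball ⟨x, mem_ball_self hr⟩
        (fun i => F i.castSucc) fun i => (hF _).mono hrO
      refine ⟨Fin.snoc c (F (Fin.last k) x), hc.mono ?_⟩
      rintro y ⟨hy, hyc⟩
      refine ⟨hrO hy, fun i => ?_⟩
      refine Fin.lastCases ?_ (fun j => ?_) i
      · simpa using hconst y hy
      · simpa using hyc j
    · push Not at hz
      obtain ⟨x, hx, hL⟩ := hz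
      have hcd : ∀ i, ContDiffAt ℂ 1 (F i) x := fun i => (hF i).contDiffAt (hO.mem_nhds hx)
      set L := fderiv ℂ (F (Fin.last k)) x with hLdef
      have hstrict : HasStrictFDerivAt (F (Fin.last k)) L x :=
        (hcd _).hasStrictFDerivAt one_ne_zero
      have hrange : L.range = ⊤ := by
        refine LinearMap.range_eq_top.2 (LinearMap.surjective_of_ne_zero fun h => hL ?_)
        ext v
        exact congrArg (fun f : E →ₗ[ℂ] ℂ => f v) h
      have hker := ContinuousLinearMap.ker_closedComplemented_of_finiteDimensional_range L
      let φ : ImplicitFunctionData ℂ E ℂ L.ker :=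
        hstrict.implicitFunctionDataOfComplemented _ _ hrange hker
      have hpt : φ.pt = x := rfl
      have hleft : φ.leftFun = F (Fin.last k) := rfl
      have hright : ContDiffAt ℂ 1 φ.rightFun φ.pt := by
        change ContDiffAt ℂ 1 (fun y => Classical.choose hker (y - x)) x
        fun_prop
      have hψ : ContDiffAt ℂ 1 φ.implicitFunction.uncurry (φ.prodFun φ.pt) :=
        φ.contDiffAt_implicitFunction (hcd _) hright one_ne_zero
      have hψx : φ.implicitFunction.uncurry (φ.prodFun φ.pt) = x :=
        φ.implicitFunction_apply_image.self_of_nhds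
      set c₀ := F (Fin.last k) x with hc₀
      set t₀ := φ.rightFun x with ht₀
      have hp : φ.prodFun φ.pt = (c₀, t₀) := rfl
      let g : L.ker → E := fun t => φ.implicitFunction c₀ t
      have hg : ContDiffAt ℂ 1 g t₀ := by
        rw [hp] at hψ
        exact ContDiffAt.comp (f := fun t : L.ker => (c₀, t)) t₀ hψ (by fun_prop)
      have hgx : g t₀ = x := hψx
      have htend : Tendsto (fun t : L.ker => (c₀, t)) (𝓝 t₀) (𝓝 (φ.prodFun φ.pt)) := by
        rw [hp]
        exact Continuous.continuousAt (by fun_prop)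
      have h1 : ∀ᶠ t in 𝓝 t₀, φ.prodFun (g t) = (c₀, t) := htend.eventually
        φ.prodFun_implicitFunction
      have h2 : ∀ᶠ t in 𝓝 t₀, ContDiffAt ℂ 1 g t := hg.eventually (by simp)
      have h3 : ∀ᶠ t in 𝓝 t₀, g t ∈ O := hg.continuousAt.eventually_mem (by
        rw [hgx]; exact hO.mem_nhds hx)
      obtain ⟨r, hr, hr'⟩ := Metric.eventually_nhds_iff_ball.1 (h1.and (h2.and h3))
      have hdim : k < finrank ℂ L.ker := by
        have := LinearMap.finrank_range_add_finrank_ker (L : E →ₗ[ℂ] ℂ)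
        have h4 : finrank ℂ (L : E →ₗ[ℂ] ℂ).range = 1 := by
          rw [show (L : E →ₗ[ℂ] ℂ).range = ⊤ from hrange, finrank_top, finrank_self]
        have h5 : finrank ℂ L.ker = finrank ℂ (L : E →ₗ[ℂ] ℂ).ker := rfl
        omega
      obtain ⟨c, hc⟩ := ih L.ker hdim (ball t₀ r) isOpen_ball ⟨t₀, mem_ball_self hr⟩
        (fun i t => F i.castSucc (g t)) fun i t ht => by
          obtain ⟨-, h4, h5⟩ := hr' t ht
          exact (((hF i.castSucc).contDiffAt (hO.mem_nhds h5)).comp t h4).contDiffWithinAt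
      refine ⟨Fin.snoc c c₀, ?_⟩
      -- The parameter `t` is recovered from `g t` as its component in the kernel, so an infinite
      -- fibre in the kernel stays infinite in `E`.
      have hinj : Set.InjOn g (ball t₀ r) := by
        intro s hs t ht hst
        have h4 := (hr' s hs).1
        rw [hst, (hr' t ht).1] at h4
        exact (Prod.ext_iff.1 h4).2.symm
      refine (hc.image (hinj.mono fun t ht => ht.1)).mono ?_
      rintro - ⟨t, ⟨ht, htc⟩, rfl⟩
      refine ⟨(hr' t ht).2.2, fun i => ?_⟩
      refine Fin.lastCases ?_ (fun j => ?_) i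
      · rw [Fin.snoc_last]
        exact (Prod.ext_iff.1 (hr' t ht).1).1
      · simpa using htc j

end InfiniteFibre

/-! ### Change of variables without injectivity -/

section ChangeOfVariables

open MeasureTheory Module

variable {E : Type*} [NormedAddCommGroup E] [NormedSpace ℝ E] [FiniteDimensional ℝ E]
  [MeasurableSpace E] [BorelSpace E] (μ : Measure E) [μ.IsAddHaarMeasure]

/-- The bound `μ (f '' A) ≤ ∫ |det f'|` over `A` says that `μ` restricted to the image is dominated
by the push-forward of the density `|det f'|`. Points covered several times only enlarge the right
side. -/
theorem lintegral_image_le_lintegral_abs_det_fderiv_mul {f : E → E} {f' : E → E →L[ℝ] E}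
    {s : Set E} (hs : MeasurableSet s) (hf' : ∀ x ∈ s, HasFDerivWithinAt f (f' x) s x)
    (h : E → ENNReal) :
    ∫⁻ y in f '' s, h y ∂μ ≤ ∫⁻ x in s, ENNReal.ofReal |(f' x).det| * h (f x) ∂μ := by
  have hρ : AEMeasurable (fun x => ENNReal.ofReal |(f' x).det|) (μ.restrict s) :=
    aemeasurable_ofReal_abs_det_fderivWithin μ hs hf'
  have hcont : ContinuousOn f s := fun x hx => (hf' x hx).continuousWithinAt
  set ν := (μ.restrict s).withDensity fun x => ENNReal.ofReal |(f' x).det| with hν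
  have hf : AEMeasurable f ν :=
    (hcont.aemeasurable hs).mono_ac (withDensity_absolutelyContinuous _ _)
  have hle : μ.restrict (f '' s) ≤ ν.map f := by
    refine Measure.le_iff.2 fun T hT => ?_
    have hsT : MeasurableSet (s ∩ f ⁻¹' T) := by
      have := hs.subtype_image (hcont.domRestrict.measurable hT)
      rwa [Set.domRestrict_eq, Set.preimage_comp, Subtype.image_preimage_coe] at this
    rw [Measure.restrict_apply hT, Measure.map_apply_of_aemeasurable hf hT]
    calc μ (T ∩ f '' s) = μ (f '' (s ∩ f ⁻¹' T)) := by rw [Set.image_inter_preimage, Set.inter_comm]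
      _ ≤ ∫⁻ x in s ∩ f ⁻¹' T, ENNReal.ofReal |(f' x).det| ∂μ :=
        addHaar_image_le_lintegral_abs_det_fderiv μ hsT fun x hx =>
          (hf' x hx.1).mono Set.inter_subset_left
      _ = ν (s ∩ f ⁻¹' T) := by
        rw [hν, withDensity_apply _ hsT, Measure.restrict_restrict hsT,
          Set.inter_eq_self_of_subset_left Set.inter_subset_left]
      _ ≤ ν (f ⁻¹' T) := measure_mono Set.inter_subset_right
  calc ∫⁻ y in f '' s, h y ∂μ ≤ ∫⁻ y, h y ∂(ν.map f) := lintegral_mono' hle le_rfl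
    _ ≤ ∫⁻ x, h (f x) ∂ν := lintegral_map_le _ _
    _ = _ := lintegral_withDensity_eq_lintegral_mul_non_measurable₀ _ hρ
        (Filter.Eventually.of_forall fun _ => ENNReal.ofReal_lt_top) _

end ChangeOfVariables

/-! ### Complex Jacobians and Sard's lemma -/

section ComplexJacobian

open MeasureTheory Module

variable {E : Type*} [NormedAddCommGroup E] [NormedSpace ℂ E]

/-- The real determinant is the field norm from `ℂ` to `ℝ` of the complex one. Hence boundedness
after multiplication by the complex Jacobian matches square integrability. -/
theorem abs_det_restrictScalars (L : E →L[ℂ] E) :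
    |(L.restrictScalars ℝ).det| = ‖L.det‖ ^ 2 := by
  have h : (L.restrictScalars ℝ).det = Algebra.norm ℝ L.det :=
    LinearMap.det_restrictScalars (R := ℝ) (S := ℂ) (f := (L : E →ₗ[ℂ] E))
  rw [h, Algebra.norm_complex_apply, Complex.normSq_eq_norm_sq, abs_of_nonneg (by positivity)]

variable [FiniteDimensional ℂ E]
  [MeasurableSpace E] [BorelSpace E] (μ : Measure E) [μ.IsAddHaarMeasure]

/-- Change of variables for a possibly noninjective holomorphic map. -/
theorem lintegral_image_le_lintegral_norm_det_sq_mul {f : E → E} {f' : E → E →L[ℂ] E}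
    {s : Set E} (hs : MeasurableSet s) (hf' : ∀ x ∈ s, HasFDerivAt f (f' x) x) (h : E → ENNReal) :
    ∫⁻ y in f '' s, h y ∂μ ≤ ∫⁻ x in s, ‖(f' x).det‖ₑ ^ 2 * h (f x) ∂μ := by
  refine (lintegral_image_le_lintegral_abs_det_fderiv_mul μ hs
    (fun x hx => ((hf' x hx).restrictScalars ℝ).hasFDerivWithinAt) h).trans_eq ?_
  congr 1
  ext x
  rw [abs_det_restrictScalars, ← ofReal_norm, ENNReal.ofReal_pow (norm_nonneg _)]

/-- **Sard's lemma** for holomorphic maps that do not decrease dimension. -/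
theorem measure_image_eq_zero_of_not_surjective {D : Type*} [NormedAddCommGroup D]
    [NormedSpace ℂ D] [FiniteDimensional ℂ D] (hdim : finrank ℂ D ≤ finrank ℂ E)
    {f : D → E} {f' : D → D →L[ℂ] E} {s : Set D} (hf' : ∀ x ∈ s, HasFDerivAt f (f' x) x)
    (hs : ∀ x ∈ s, ¬ Function.Surjective (f' x)) : μ (f '' s) = 0 := by
  -- Precomposing with a linear surjection `E → D` keeps the image and gives a self-map of `E` with
  -- vanishing determinant.
  obtain ⟨j, hj⟩ := finrank_le_iff_exists_linearMap.1 hdim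
  obtain ⟨q, hq⟩ := j.exists_leftInverse_of_injective (LinearMap.ker_eq_bot.2 hj)
  let ϖ : E →L[ℂ] D := q.toContinuousLinearMap
  have hϖ : Function.Surjective ϖ := fun x => ⟨j x, congrArg (fun f : D →ₗ[ℂ] D => f x) hq⟩
  have himage : f '' s = (fun y => f (ϖ y)) '' (ϖ ⁻¹' s) := by
    rw [← Set.image_image f ϖ, Set.image_preimage_eq _ hϖ]
  rw [himage]
  refine addHaar_image_eq_zero_of_det_fderivWithin_eq_zero μ
    (f' := fun y => ((f' (ϖ y)).comp ϖ).restrictScalars ℝ) (fun y hy => ?_) fun y hy => ?_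
  · exact (((hf' _ hy).comp y ϖ.hasFDerivAt).restrictScalars ℝ).hasFDerivWithinAt
  · by_contra hdet
    have h1 : ‖((f' (ϖ y)).comp ϖ).det‖ ^ 2 ≠ 0 := by
      rw [← abs_det_restrictScalars]
      exact abs_ne_zero.2 hdet
    have h2 : LinearMap.det (((f' (ϖ y)).comp ϖ : E →L[ℂ] E) : E →ₗ[ℂ] E) ≠ 0 := fun h =>
      h1 (by rw [ContinuousLinearMap.det, h]; simp)
    have h3 : Function.Surjective (f' (ϖ y) ∘ ϖ) :=
      (LinearMap.equivOfDetNeZero _ h2).surjective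
    exact hs _ hy h3.of_comp

end ComplexJacobian

/-! ### Fields and forms in charts -/

section Coordinates

open Filter Topology

variable {n : ℕ} {M : Type*} [TopologicalSpace M] [ChartedSpace (EuclideanSpace ℂ (Fin n)) M]
  [IsManifold (modelC n) ω M]

/-- Coordinates of tangent vectors at `x` in the chart around `x₀`. -/
noncomputable def toCoord (x₀ x : M) : TanC n M x →L[ℂ] EuclideanSpace ℂ (Fin n) :=
  (trivializationAt (EuclideanSpace ℂ (Fin n)) (TanC n M) x₀).continuousLinearMapAt ℂ x

/-- The tangent vector at `x` with given coordinates in the chart around `x₀`. -/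
noncomputable def ofCoord (x₀ x : M) : EuclideanSpace ℂ (Fin n) →L[ℂ] TanC n M x :=
  (trivializationAt (EuclideanSpace ℂ (Fin n)) (TanC n M) x₀).symmL ℂ x

theorem mem_trivializationAt_baseSet {x₀ x : M}
    (hx : x ∈ (chartAt (EuclideanSpace ℂ (Fin n)) x₀).source) :
    x ∈ (trivializationAt (EuclideanSpace ℂ (Fin n)) (TanC n M) x₀).baseSet := by
  rwa [TangentBundle.trivializationAt_baseSet]

theorem toCoord_ofCoord {x₀ x : M} (hx : x ∈ (chartAt (EuclideanSpace ℂ (Fin n)) x₀).source)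
    (v : EuclideanSpace ℂ (Fin n)) : toCoord x₀ x (ofCoord x₀ x v) = v :=
  Trivialization.continuousLinearMapAt_symmL _ (mem_trivializationAt_baseSet hx) v

theorem ofCoord_toCoord {x₀ x : M} (hx : x ∈ (chartAt (EuclideanSpace ℂ (Fin n)) x₀).source)
    (v : TanC n M x) : ofCoord x₀ x (toCoord x₀ x v) = v :=
  Trivialization.symmL_continuousLinearMapAt _ (mem_trivializationAt_baseSet hx) v

theorem toCoord_injective {x₀ x : M} (hx : x ∈ (chartAt (EuclideanSpace ℂ (Fin n)) x₀).source) :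
    Function.Injective (toCoord (n := n) x₀ x) :=
  Function.LeftInverse.injective (ofCoord_toCoord hx)

theorem isHolSection_tangent_iff {V : Opens M} {x₀ : M}
    (hV : (V : Set M) ⊆ (chartAt (EuclideanSpace ℂ (Fin n)) x₀).source) {X : Π x, TanC n M x} :
    IsHolSection (n := n) (EuclideanSpace ℂ (Fin n)) (TanC n M) V X ↔
      ContMDiffOn (modelC n) (modelC n) ω (fun x => toCoord x₀ x (X x)) V := by
  rw [IsHolSection, Trivialization.contMDiffOn_section_iff
    (trivializationAt (EuclideanSpace ℂ (Fin n)) (TanC n M) x₀) V.isOpen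
    (fun x hx => mem_trivializationAt_baseSet (hV hx))]
  refine contMDiffOn_congr fun x hx => ?_
  rw [toCoord, Trivialization.continuousLinearMapAt_apply_of_mem _ _
    (mem_trivializationAt_baseSet (hV hx))]

/-- Coordinates of a cotangent vector at `x` in the chart around `x₀`. -/
noncomputable def formCoord (x₀ x : M) (θ : CotC n M x) : EuclideanSpace ℂ (Fin n) →L[ℂ] ℂ :=
  by exact θ.comp (ofCoord x₀ x)

theorem formCoord_apply (x₀ x : M) (θ : CotC n M x) (v : EuclideanSpace ℂ (Fin n)) :
    formCoord x₀ x θ v = θ (ofCoord x₀ x v) := rfl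

theorem isHolSection_cotangent_iff {V : Opens M} {x₀ : M}
    (hV : (V : Set M) ⊆ (chartAt (EuclideanSpace ℂ (Fin n)) x₀).source) {θ : Π x, CotC n M x} :
    IsHolSection (n := n) (EuclideanSpace ℂ (Fin n) →L[ℂ] ℂ) (CotC n M) V θ ↔
      ContMDiffOn (modelC n) (modelWithCornersSelf ℂ (EuclideanSpace ℂ (Fin n) →L[ℂ] ℂ)) ω
        (fun x => formCoord x₀ x (θ x)) V := by
  rw [IsHolSection, Trivialization.contMDiffOn_section_iff
    (trivializationAt (EuclideanSpace ℂ (Fin n) →L[ℂ] ℂ) (CotC n M) x₀) V.isOpen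
    (fun x hx => ?_)]
  · refine contMDiffOn_congr fun x hx => ?_
    rw [hom_trivializationAt_apply]
    ext v
    simp [ContinuousLinearMap.inCoordinates, formCoord_apply, ofCoord]
  · rw [hom_trivializationAt_baseSet]
    exact ⟨mem_trivializationAt_baseSet (hV hx), trivial⟩

theorem IsHolSection.isHolFun_apply {V : Opens M} {θ : Π x, CotC n M x} {X : Π x, TanC n M x}
    (hθ : IsHolSection (n := n) (EuclideanSpace ℂ (Fin n) →L[ℂ] ℂ) (CotC n M) V θ)
    (hX : IsHolSection (n := n) (EuclideanSpace ℂ (Fin n)) (TanC n M) V X) :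
    IsHolFun (n := n) V (fun x => θ x (X x)) := by
  intro x hx
  have h := ContMDiffOn.clm_bundle_apply hθ hX x hx
  exact (contMDiffWithinAt_section.1 h :)

/-- The tangent trivialization is the derivative of the chart; this identifies `jacobian` with an
ordinary Fréchet derivative. -/
theorem hasMFDerivAt_extChartAt_toCoord {x₀ x : M}
    (hx : x ∈ (chartAt (EuclideanSpace ℂ (Fin n)) x₀).source) :
    HasMFDerivAt (modelC n) (modelC n) (extChartAt (modelC n) x₀) x (toCoord x₀ x) := by
  have : IsManifold (modelC n) 1 M := IsManifold.of_le (n := ω) le_top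
  rw [toCoord, TangentBundle.continuousLinearMapAt_trivializationAt hx]
  exact (mdifferentiableAt_extChartAt hx).hasMFDerivAt

theorem hasMFDerivAt_extChartAt_symm_ofCoord {x₀ : M} {z : EuclideanSpace ℂ (Fin n)}
    (hz : z ∈ (extChartAt (modelC n) x₀).target) :
    HasMFDerivAt (modelC n) (modelC n) (extChartAt (modelC n) x₀).symm z
      (ofCoord x₀ ((extChartAt (modelC n) x₀).symm z)) := by
  have : IsManifold (modelC n) 1 M := IsManifold.of_le (n := ω) le_top
  have hx : (extChartAt (modelC n) x₀).symm z ∈ (chartAt (EuclideanSpace ℂ (Fin n)) x₀).source := by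
    rw [← extChartAt_source (modelC n)]
    exact (extChartAt (modelC n) x₀).map_target hz
  have h := TangentBundle.symmL_trivializationAt (I := modelC n) hx
  rw [(extChartAt (modelC n) x₀).right_inv hz] at h
  have h2 := (mdifferentiableWithinAt_extChartAt_symm (I := modelC n) hz).hasMFDerivWithinAt
  rw [← h, ModelWithCorners.range_eq_univ] at h2
  exact hasMFDerivWithinAt_univ.1 h2

variable {F : Type*} [NormedAddCommGroup F] [NormedSpace ℂ F]

theorem ContMDiffAt.analyticAt_comp_extChartAt_symm {x₀ : M} {f : M → F}
    {z : EuclideanSpace ℂ (Fin n)} (hz : z ∈ (extChartAt (modelC n) x₀).target)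
    (hf : ContMDiffAt (modelC n) (modelWithCornersSelf ℂ F) ω f
      ((extChartAt (modelC n) x₀).symm z)) :
    AnalyticAt ℂ (fun w => f ((extChartAt (modelC n) x₀).symm w)) z := by
  have h1 : ContMDiffAt (modelC n) (modelC n) ω (extChartAt (modelC n) x₀).symm z :=
    (contMDiffOn_extChartAt_symm x₀).contMDiffAt ((isOpen_extChartAt_target x₀).mem_nhds hz)
  have h2 := hf.comp z h1
  exact h2.contDiffAt.analyticAt

theorem AnalyticAt.contMDiffAt_comp_extChartAt [CompleteSpace F] {x₀ x : M}
    (hx : x ∈ (chartAt (EuclideanSpace ℂ (Fin n)) x₀).source) {g : EuclideanSpace ℂ (Fin n) → F}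
    (hg : AnalyticAt ℂ g (extChartAt (modelC n) x₀ x)) :
    ContMDiffAt (modelC n) (modelWithCornersSelf ℂ F) ω
      (fun y => g (extChartAt (modelC n) x₀ y)) x := by
  have h1 : ContMDiffAt (modelC n) (modelC n) ω (extChartAt (modelC n) x₀) x :=
    contMDiffAt_extChartAt' hx
  exact (ContDiffAt.contMDiffAt hg.contDiffAt).comp x h1

end Coordinates

/-! ### The Jacobian of a holomorphic map -/

section Jacobian

open Filter Topology

variable {m n : ℕ} {M : Type*} [TopologicalSpace M] [ChartedSpace (EuclideanSpace ℂ (Fin m)) M]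
  [IsManifold (modelC m) ω M]
  {N : Type*} [TopologicalSpace N] [ChartedSpace (EuclideanSpace ℂ (Fin n)) N]
  [IsManifold (modelC n) ω N]

/-- The Jacobian matrix of `η` at `x` in the charts around `x₀` and `y₀`. -/
noncomputable def jacobian (η : M → N) (x₀ : M) (y₀ : N) (x : M) :
    EuclideanSpace ℂ (Fin m) →L[ℂ] EuclideanSpace ℂ (Fin n) :=
  (toCoord y₀ (η x)).comp ((mfderiv (modelC m) (modelC n) η x).comp (ofCoord x₀ x))

theorem jacobian_apply (η : M → N) (x₀ : M) (y₀ : N) (x : M) (v : EuclideanSpace ℂ (Fin m)) :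
    jacobian (m := m) (n := n) η x₀ y₀ x v =
      toCoord y₀ (η x) (mfderiv (modelC m) (modelC n) η x (ofCoord x₀ x v)) := rfl

theorem hasFDerivAt_jacobian {η : M → N} (hη : ContMDiff (modelC m) (modelC n) ω η) {x₀ : M}
    {y₀ : N} {z : EuclideanSpace ℂ (Fin m)} (hz : z ∈ (extChartAt (modelC m) x₀).target)
    (hy : η ((extChartAt (modelC m) x₀).symm z) ∈
      (chartAt (EuclideanSpace ℂ (Fin n)) y₀).source) :
    HasFDerivAt (fun w => extChartAt (modelC n) y₀ (η ((extChartAt (modelC m) x₀).symm w)))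
      (jacobian η x₀ y₀ ((extChartAt (modelC m) x₀).symm z)) z := by
  have h1 := hasMFDerivAt_extChartAt_symm_ofCoord hz
  have h2 := ((hη.contMDiffAt (x := (extChartAt (modelC m) x₀).symm z)).mdifferentiableAt
    (by simp)).hasMFDerivAt
  have h3 := hasMFDerivAt_extChartAt_toCoord hy
  exact (h3.comp z (h2.comp z h1)).hasFDerivAt

theorem analyticAt_writtenIn {η : M → N} (hη : ContMDiff (modelC m) (modelC n) ω η) {x₀ : M}
    {y₀ : N} {z : EuclideanSpace ℂ (Fin m)} (hz : z ∈ (extChartAt (modelC m) x₀).target)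
    (hy : η ((extChartAt (modelC m) x₀).symm z) ∈
      (chartAt (EuclideanSpace ℂ (Fin n)) y₀).source) :
    AnalyticAt ℂ (fun w => extChartAt (modelC n) y₀ (η ((extChartAt (modelC m) x₀).symm w))) z := by
  refine ContMDiffAt.analyticAt_comp_extChartAt_symm (f := fun x => extChartAt (modelC n) y₀ (η x))
    hz ?_
  exact (contMDiffAt_extChartAt' hy).comp _ hη.contMDiffAt

/-- Near `x` it is the Fréchet derivative of the analytic coordinate expression of `η`, and
derivatives of analytic maps are analytic. -/
theorem contMDiffAt_jacobian {η : M → N} (hη : ContMDiff (modelC m) (modelC n) ω η) {x₀ x : M}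
    {y₀ : N} (hx : x ∈ (chartAt (EuclideanSpace ℂ (Fin m)) x₀).source)
    (hy : η x ∈ (chartAt (EuclideanSpace ℂ (Fin n)) y₀).source) :
    ContMDiffAt (modelC m)
      (modelWithCornersSelf ℂ (EuclideanSpace ℂ (Fin m) →L[ℂ] EuclideanSpace ℂ (Fin n))) ω
      (jacobian (m := m) (n := n) η x₀ y₀) x := by
  have hx' : x ∈ (extChartAt (modelC m) x₀).source := by rwa [extChartAt_source]
  have hz := (extChartAt (modelC m) x₀).map_source hx'
  have hinv := (extChartAt (modelC m) x₀).left_inv hx'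
  have h1 := (analyticAt_writtenIn hη hz (by rwa [hinv])).fderiv
  have h2 := h1.contMDiffAt_comp_extChartAt hx
  refine h2.congr_of_eventuallyEq ?_
  have h3 : ∀ᶠ x' in 𝓝 x, η x' ∈ (chartAt (EuclideanSpace ℂ (Fin n)) y₀).source :=
    hη.continuous.continuousAt.eventually_mem ((chartAt _ y₀).open_source.mem_nhds hy)
  filter_upwards [h3, (chartAt _ x₀).open_source.mem_nhds hx] with x' hy' hx'
  have hx'' : x' ∈ (extChartAt (modelC m) x₀).source := by rwa [extChartAt_source]
  have hinv' := (extChartAt (modelC m) x₀).left_inv hx''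
  have h4 := (hasFDerivAt_jacobian (y₀ := y₀) hη ((extChartAt (modelC m) x₀).map_source hx'')
    (by rwa [hinv'])).fderiv
  rw [h4, hinv']

theorem formCoord_pullbackForm (η : M → N) {x₀ x : M} {y₀ : N}
    (hy : η x ∈ (chartAt (EuclideanSpace ℂ (Fin n)) y₀).source) (θ : Π y, CotC n N y) :
    formCoord x₀ x (pullbackForm (m := m) η θ x) =
      (formCoord y₀ (η x) (θ (η x))).comp (jacobian (m := m) η x₀ y₀ x) := by
  ext v
  rw [ContinuousLinearMap.comp_apply, formCoord_apply, formCoord_apply, jacobian_apply,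
    ofCoord_toCoord hy]
  rfl

theorem IsHolSection.of_forall_contMDiffAt_toCoord {V : Opens M} {X : Π x, TanC m M x}
    (h : ∀ x₀ ∈ V, ∀ᶠ x in 𝓝 x₀,
      ContMDiffAt (modelC m) (modelC m) ω (fun x => toCoord x₀ x (X x)) x) :
    IsHolSection (n := m) (EuclideanSpace ℂ (Fin m)) (TanC m M) V X := by
  refine IsHolSection.of_locally fun x₀ hx₀ => ?_
  have h1 : ∀ᶠ x in 𝓝 x₀, x ∈ (chartAt (EuclideanSpace ℂ (Fin m)) x₀).source :=
    chart_source_mem_nhds _ x₀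
  have h2 : ∀ᶠ x in 𝓝 x₀, x ∈ V := V.isOpen.mem_nhds hx₀
  obtain ⟨O, hO, hOo, hxO⟩ := eventually_nhds_iff.1 ((h x₀ hx₀).and (h1.and h2))
  refine ⟨⟨O, hOo⟩, fun x hx => (hO x hx).2.2, hxO, X, ?_, fun _ _ => rfl⟩
  rw [isHolSection_tangent_iff (V := ⟨O, hOo⟩) (x₀ := x₀) fun x hx => (hO x hx).2.1]
  exact fun x hx => (hO x hx).1.contMDiffWithinAt

/-- The pull-back of a holomorphic form is holomorphic. -/
theorem isHolSection_pullbackForm {η : M → N} (hη : ContMDiff (modelC m) (modelC n) ω η)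
    {O : Opens N} {θ : Π y, CotC n N y}
    (hθ : IsHolSection (n := n) (EuclideanSpace ℂ (Fin n) →L[ℂ] ℂ) (CotC n N) O θ) {V : Opens M}
    (hV : Set.MapsTo η V O) :
    IsHolSection (n := m) (EuclideanSpace ℂ (Fin m) →L[ℂ] ℂ) (CotC m M) V
      (pullbackForm (m := m) η θ) := by
  refine IsHolSection.of_locally fun x₀ hx₀ => ?_
  let y₀ := η x₀
  let S : Opens N := O ⊓ ⟨_, (chartAt (EuclideanSpace ℂ (Fin n)) y₀).open_source⟩
  let T : Opens M := V ⊓ ⟨_, (chartAt (EuclideanSpace ℂ (Fin m)) x₀).open_source⟩ ⊓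
    ⟨η ⁻¹' S, S.isOpen.preimage hη.continuous⟩
  refine ⟨T, fun x hx => hx.1.1,
    ⟨⟨hx₀, mem_chart_source _ x₀⟩, ⟨hV hx₀, mem_chart_source _ y₀⟩⟩, _, ?_, fun _ _ => rfl⟩
  rw [isHolSection_cotangent_iff (V := T) (x₀ := x₀) fun x hx => hx.1.2]
  have h1 := (isHolSection_cotangent_iff (x₀ := y₀) (V := S) fun x hx => hx.2).1
    (hθ.mono fun x hx => hx.1)
  intro x hx
  have h2 := (h1.contMDiffAt (S.isOpen.mem_nhds hx.2)).comp x hη.contMDiffAt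
  have h3 := contMDiffAt_jacobian (x₀ := x₀) hη hx.1.2 hx.2.2
  refine ((h2.clm_comp h3).congr_of_eventuallyEq ?_).contMDiffWithinAt
  filter_upwards [T.isOpen.mem_nhds hx] with x' hx'
  exact formCoord_pullbackForm η hx'.2.2 θ

end Jacobian

/-! ### Equality of dimensions and generic submersivity -/

section Dimension

open Filter Topology MeasureTheory Module

variable {m n : ℕ} {M : Type*} [TopologicalSpace M] [ChartedSpace (EuclideanSpace ℂ (Fin m)) M]
  [IsManifold (modelC m) ω M]
  {N : Type*} [TopologicalSpace N] [ChartedSpace (EuclideanSpace ℂ (Fin n)) N]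
  [IsManifold (modelC n) ω N]

theorem isOpen_preimage_writtenIn {M N : Type*} [TopologicalSpace M] [TopologicalSpace N]
    [ChartedSpace (EuclideanSpace ℂ (Fin m)) M] {η : M → N} (hη : Continuous η) (x₀ : M) {O : Set N}
    (hO : IsOpen O) : IsOpen {z ∈ (extChartAt (modelC m) x₀).target |
      η ((extChartAt (modelC m) x₀).symm z) ∈ O} :=
  (continuousOn_extChartAt_symm x₀).isOpen_inter_preimage (isOpen_extChartAt_target x₀)
    (hO.preimage hη)

theorem surjective_mfderiv_of_jacobian {η : M → N} {x₀ x : M} {y₀ : N}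
    (hy : η x ∈ (chartAt (EuclideanSpace ℂ (Fin n)) y₀).source)
    (h : Function.Surjective (jacobian (m := m) (n := n) η x₀ y₀ x)) :
    Function.Surjective (mfderiv (modelC m) (modelC n) η x) := by
  intro v
  obtain ⟨u, hu⟩ := h (toCoord y₀ (η x) v)
  exact ⟨ofCoord x₀ x u, toCoord_injective hy hu⟩

/-- Over every nonempty open set a holomorphic map which is surjective and does not decrease
dimension has a point at which its differential is surjective. -/
theorem exists_surjective_mfderiv [SecondCountableTopology M] (hmn : m ≤ n) {η : M → N}
    (hη : ContMDiff (modelC m) (modelC n) ω η) (hsurj : Function.Surjective η) {O : Opens N}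
    (hO : (O : Set N).Nonempty) :
    ∃ x, η x ∈ O ∧ Function.Surjective (mfderiv (modelC m) (modelC n) η x) := by
  by_contra! hcon
  obtain ⟨y₀, hy₀⟩ := hO
  let S : Set N := O ∩ (chartAt (EuclideanSpace ℂ (Fin n)) y₀).source
  have hS : IsOpen S := O.isOpen.inter (chartAt _ y₀).open_source
  let G : Set (EuclideanSpace ℂ (Fin n)) :=
    {z ∈ (extChartAt (modelC n) y₀).target | id ((extChartAt (modelC n) y₀).symm z) ∈ S}
  have hG : IsOpen G := isOpen_preimage_writtenIn (η := (id : N → N)) continuous_id y₀ hS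
  have hGne : G.Nonempty := by
    refine ⟨extChartAt (modelC n) y₀ y₀, mem_extChartAt_target y₀, ?_⟩
    rw [extChartAt_to_inv]
    exact ⟨hy₀, mem_chart_source _ y₀⟩
  let μ : Measure (EuclideanSpace ℂ (Fin n)) := Measure.addHaar
  have hpos : 0 < μ G := hG.measure_pos μ hGne
  -- Second countability leaves countably many charts upstairs. If all points over `O` were
  -- critical, each chart would contribute a null set, yet together these cover a nonempty open set.
  obtain ⟨t, htc, htU⟩ := countable_cover_nhds
    (f := fun x : M => (chartAt (EuclideanSpace ℂ (Fin m)) x).source)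
    fun x => chart_source_mem_nhds _ x
  let f : M → EuclideanSpace ℂ (Fin m) → EuclideanSpace ℂ (Fin n) := fun x₀ z =>
    extChartAt (modelC n) y₀ (η ((extChartAt (modelC m) x₀).symm z))
  let s : M → Set (EuclideanSpace ℂ (Fin m)) := fun x₀ =>
    {z ∈ (extChartAt (modelC m) x₀).target | η ((extChartAt (modelC m) x₀).symm z) ∈ S}
  have hnull : ∀ x₀, μ (f x₀ '' s x₀) = 0 := by
    intro x₀
    refine measure_image_eq_zero_of_not_surjective μ (by simpa using hmn)
      (f' := fun z => jacobian η x₀ y₀ ((extChartAt (modelC m) x₀).symm z))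
      (fun z hz => hasFDerivAt_jacobian hη hz.1 hz.2.2) fun z hz h => ?_
    exact hcon _ hz.2.1 (surjective_mfderiv_of_jacobian hz.2.2 h)
  have hcov : G ⊆ ⋃ x₀ ∈ t, f x₀ '' s x₀ := by
    intro z hz
    obtain ⟨x, hx⟩ := hsurj ((extChartAt (modelC n) y₀).symm z)
    have hxU : x ∈ ⋃ x ∈ t, (chartAt (EuclideanSpace ℂ (Fin m)) x).source := htU ▸ trivial
    obtain ⟨x₀, hx₀, hxs⟩ := Set.mem_iUnion₂.1 hxU
    rw [← extChartAt_source (modelC m)] at hxs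
    refine Set.mem_iUnion₂.2 ⟨x₀, hx₀, extChartAt (modelC m) x₀ x,
      ⟨(extChartAt (modelC m) x₀).map_source hxs, ?_⟩, ?_⟩
    · rw [(extChartAt (modelC m) x₀).left_inv hxs, hx]
      exact hz.2
    · simp only [f]
      rw [(extChartAt (modelC m) x₀).left_inv hxs, hx, (extChartAt (modelC n) y₀).right_inv hz.1]
  exact hpos.ne' (measure_mono_null hcov ((measure_biUnion_null_iff htc).2 fun x₀ _ => hnull x₀))

/-- A holomorphic map with finite fibres does not decrease dimension. -/
theorem dim_le_of_finite_fibres [Nonempty M] {η : M → N}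
    (hη : ContMDiff (modelC m) (modelC n) ω η) (hfin : ∀ y, (η ⁻¹' {y}).Finite) : m ≤ n := by
  by_contra! hmn
  obtain ⟨x₀⟩ := ‹Nonempty M›
  let S := (chartAt (EuclideanSpace ℂ (Fin n)) (η x₀)).source
  have hS : IsOpen S := (chartAt _ (η x₀)).open_source
  let f : EuclideanSpace ℂ (Fin m) → EuclideanSpace ℂ (Fin n) := fun z =>
    extChartAt (modelC n) (η x₀) (η ((extChartAt (modelC m) x₀).symm z))
  -- The `n` coordinates of `η` are too few for `m > n` variables; the resulting infinite level set
  -- is carried injectively by the inverse chart into a single fibre of `η`.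
  obtain ⟨c, hc⟩ := exists_infinite_fibre n (EuclideanSpace ℂ (Fin m)) (by simpa using hmn)
    {z ∈ (extChartAt (modelC m) x₀).target | η ((extChartAt (modelC m) x₀).symm z) ∈ S}
    (isOpen_preimage_writtenIn hη.continuous x₀ hS)
    ⟨extChartAt (modelC m) x₀ x₀, mem_extChartAt_target x₀, by
      rw [extChartAt_to_inv]; exact mem_chart_source _ _⟩
    (fun i z => f z i) (fun i z hz => by
      have h1 := (analyticAt_writtenIn hη hz.1 hz.2).contDiffAt (n := 1)
      exact ((EuclideanSpace.proj (𝕜 := ℂ) i).contDiff.contDiffAt.comp z h1).contDiffWithinAt)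
  refine (hc.image ((extChartAt (modelC m) x₀).symm.injOn.mono fun z hz => hz.1.1)) ?_
  refine (hfin ((extChartAt (modelC n) (η x₀)).symm (WithLp.toLp 2 c))).subset ?_
  rintro - ⟨z, ⟨hz, hzc⟩, rfl⟩
  have h1 : f z = WithLp.toLp 2 c := by
    ext i
    exact hzc i
  rw [Set.mem_preimage, Set.mem_singleton_iff, ← h1]
  simp only [f]
  rw [(extChartAt (modelC n) (η x₀)).left_inv (by rw [extChartAt_source]; exact hz.2)]

theorem IsFiniteSurjective.dim_eq [SecondCountableTopology M] [Nonempty M] {η : M → N}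
    (hη : IsFiniteSurjective m n η) : m = n := by
  have hle : m ≤ n := dim_le_of_finite_fibres hη.isHol hη.finite_fibres
  refine le_antisymm hle ?_
  obtain ⟨x₀⟩ := ‹Nonempty M›
  obtain ⟨x, -, hx⟩ := exists_surjective_mfderiv hle hη.isHol hη.surjective (O := ⊤)
    ⟨η x₀, trivial⟩
  have h1 : Function.Surjective (jacobian (m := m) (n := n) η x (η x) x) := by
    intro v
    obtain ⟨u, hu⟩ := hx (ofCoord (η x) (η x) v)
    refine ⟨toCoord x x u, ?_⟩
    rw [jacobian_apply, ofCoord_toCoord (mem_chart_source _ x), hu,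
      toCoord_ofCoord (mem_chart_source _ (η x))]
  have h2 := LinearMap.finrank_le_finrank_of_surjective
    (f := (jacobian (m := m) (n := n) η x (η x) x).toLinearMap) h1
  simpa using h2

end Dimension

/-! ### Liftings and the differential -/

section LiftedFields

open Filter Topology

variable {n : ℕ} {M : Type*} [TopologicalSpace M] [ChartedSpace (EuclideanSpace ℂ (Fin n)) M]
  [IsManifold (modelC n) ω M]
  {N : Type*} [TopologicalSpace N] [ChartedSpace (EuclideanSpace ℂ (Fin n)) N]
  [IsManifold (modelC n) ω N]

/-- The pull-back of `θ` lies in the image of `η^*Q`, hence in its saturation, so a section of the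
lifting annihilates it. -/
theorem apply_mfderiv_eq_zero_of_mem_lifting {η : M → N}
    (hη : ContMDiff (modelC n) (modelC n) ω η) {W : TangentSubsheaf n N} {V : Opens M}
    {X : Π x, TanC n M x} (hX : X ∈ (lifting (m := n) η W).sec V) {O : Opens N}
    {θ : Π y, CotC n N y} (hθ : θ ∈ (formsVanishingOn W).sec O) {x : M} (hx : x ∈ V)
    (hxO : η x ∈ O) : θ (η x) (mfderiv (modelC n) (modelC n) η x (X x)) = 0 := by
  let V' : Opens M := V ⊓ ⟨η ⁻¹' O, O.isOpen.preimage hη.continuous⟩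
  have hV' : Set.MapsTo η V' O := fun z hz => hz.2
  have hhol := isHolSection_pullbackForm hη hθ.1 hV'
  have h1 : pullbackForm (m := n) η θ ∈ (pullbackForms (m := n) η (formsVanishingOn W)).sec V' :=
    ⟨hhol, fun z hz => ⟨V', le_rfl, hz, O, hV', 1, fun _ _ => 1, fun _ => θ,
      fun _ => contMDiffOn_const, fun _ => hθ, fun z _ => by simp⟩⟩
  have h2 : pullbackForm (m := n) η θ ∈
      (pullbackForms (m := n) η (formsVanishingOn W)).saturation.sec V' :=
    ⟨hhol, fun z hz => ⟨V', le_rfl, hz, fun _ => 1, contMDiffOn_const,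
      fun O _ ⟨y, hy⟩ => ⟨y, hy, one_ne_zero⟩, by simpa using h1⟩⟩
  exact hX.2 V' inf_le_left _ h2 x ⟨hx, hxO⟩

/-- A lift of a holomorphic field along a map with injective differential is holomorphic. -/
theorem isHolSection_of_mfderiv_eq {η : M → N} (hη : ContMDiff (modelC n) (modelC n) ω η)
    {O : Opens N} {s : Π y, TanC n N y}
    (hs : IsHolSection (n := n) (EuclideanSpace ℂ (Fin n)) (TanC n N) O s) {V : Opens M}
    (hV : Set.MapsTo η V O)
    (hinj : ∀ x ∈ V, Function.Injective (mfderiv (modelC n) (modelC n) η x))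
    {X : Π x, TanC n M x} (hX : ∀ x ∈ V, mfderiv (modelC n) (modelC n) η x (X x) = s (η x)) :
    IsHolSection (n := n) (EuclideanSpace ℂ (Fin n)) (TanC n M) V X := by
  refine IsHolSection.of_forall_contMDiffAt_toCoord fun x₀ hx₀ => ?_
  let y₀ := η x₀
  let S : Opens N := O ⊓ ⟨_, (chartAt (EuclideanSpace ℂ (Fin n)) y₀).open_source⟩
  let T : Opens M := V ⊓ ⟨_, (chartAt (EuclideanSpace ℂ (Fin n)) x₀).open_source⟩ ⊓
    ⟨η ⁻¹' S, S.isOpen.preimage hη.continuous⟩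
  have hx₀T : x₀ ∈ T :=
    ⟨⟨hx₀, mem_chart_source _ x₀⟩, ⟨hV hx₀, mem_chart_source _ y₀⟩⟩
  have hsS := (isHolSection_tangent_iff (x₀ := y₀) (V := S) fun x hx => hx.2).1
    (hs.mono fun x hx => hx.1)
  have hJinj : ∀ x ∈ T, Function.Injective (jacobian (m := n) (n := n) η x₀ y₀ x) := by
    intro x hx u v huv
    have h1 := hinj x hx.1.1 (toCoord_injective hx.2.2 huv)
    rw [← toCoord_ofCoord hx.1.2 u, ← toCoord_ofCoord hx.1.2 v]
    exact congrArg (toCoord x₀ x) h1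
  have hequiv : ∀ x ∈ T, ∃ e : EuclideanSpace ℂ (Fin n) ≃L[ℂ] EuclideanSpace ℂ (Fin n),
      (e : EuclideanSpace ℂ (Fin n) →L[ℂ] EuclideanSpace ℂ (Fin n))
        = jacobian (m := n) (n := n) η x₀ y₀ x := by
    intro x hx
    refine ⟨(LinearEquiv.ofInjectiveEndo
      (jacobian (m := n) (n := n) η x₀ y₀ x).toLinearMap (hJinj x hx)).toContinuousLinearEquiv, ?_⟩
    ext v
    rfl
  have hcoord : ∀ x ∈ T, toCoord x₀ x (X x) =
      (jacobian (m := n) (n := n) η x₀ y₀ x).inverse (toCoord y₀ (η x) (s (η x))) := by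
    intro x hx
    obtain ⟨e, he⟩ := hequiv x hx
    rw [← he, ContinuousLinearMap.inverse_equiv, ContinuousLinearEquiv.coe_coe,
      ContinuousLinearEquiv.eq_symm_apply, ← ContinuousLinearEquiv.coe_coe, he, jacobian_apply,
      ofCoord_toCoord hx.1.2, hX x hx.1.1]
  filter_upwards [T.isOpen.mem_nhds hx₀T] with x hx
  obtain ⟨e, he⟩ := hequiv x hx
  have h1 := contMDiffAt_jacobian (x₀ := x₀) hη hx.1.2 hx.2.2
  have h2 : ContDiffAt ℂ ω (ContinuousLinearMap.inverse (M := EuclideanSpace ℂ (Fin n))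
      (M₂ := EuclideanSpace ℂ (Fin n)) (R := ℂ)) (jacobian (m := n) (n := n) η x₀ y₀ x) := by
    rw [← he]
    exact contDiffAt_map_inverse e
  have h3 := (h2.contMDiffAt).comp x h1
  have h4 := (hsS.contMDiffAt (S.isOpen.mem_nhds hx.2)).comp x hη.contMDiffAt
  refine (h3.clm_apply h4).congr_of_eventuallyEq ?_
  filter_upwards [T.isOpen.mem_nhds hx] with x' hx'
  exact hcoord x' hx'

/-- Lifts of sections of `W` along a map with injective differential belong to the lifting. -/
theorem mem_lifting_of_mfderiv_eq {η : M → N} (hη : ContMDiff (modelC n) (modelC n) ω η)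
    {W : TangentSubsheaf n N} {O : Opens N} {s : Π y, TanC n N y} (hs : s ∈ W.sec O)
    {V : Opens M} (hV : Set.MapsTo η V O)
    (hinj : ∀ x ∈ V, Function.Injective (mfderiv (modelC n) (modelC n) η x))
    {X : Π x, TanC n M x} (hX : ∀ x ∈ V, mfderiv (modelC n) (modelC n) η x (X x) = s (η x)) :
    X ∈ (lifting (m := n) η W).sec V := by
  have hXhol := isHolSection_of_mfderiv_eq hη (W.isHol hs) hV hinj hX
  refine ⟨hXhol, fun V' hV' θ hθ x hx => ?_⟩
  obtain ⟨A, hA, hxA, f, hf, hf0, hfθ⟩ := hθ.2 x hx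
  -- A multiple `f θ` is a combination of pull-backs `η^*ξᵢ`, and these take on `X` the values
  -- `ξᵢ(s) = 0`. Since `f` is nowhere locally zero, continuity then removes it.
  have hzero : ∀ z ∈ A, f z * θ z (X z) = 0 := by
    intro z hz
    obtain ⟨B, -, hzB, P, hP, k, c, ξ, -, hξ, hsum⟩ := hfθ.2 z hz
    have h1 : f z • θ z (X z) = ∑ i, c i z • (pullbackForm (m := n) η (ξ i) z) (X z) := by
      have h2 := congrArg (fun L : CotC n M z => L (X z)) (hsum z hzB)
      simpa [sum_apply] using h2
    rw [smul_eq_mul] at h1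
    rw [h1]
    refine Finset.sum_eq_zero fun i _ => ?_
    have h3 : pullbackForm (m := n) η (ξ i) z (X z) = ξ i (η z) (s (η z)) := by
      rw [← hX z (hV' (hA hz))]
      rfl
    rw [h3, (hξ i).2 (P ⊓ O) inf_le_left s (W.restrict inf_le_right hs) (η z)
      ⟨hP hzB, hV (hV' (hA hz))⟩]
    exact smul_zero _
  have hcont : ContinuousOn (fun z => θ z (X z)) A :=
    ((hθ.1.mono hA).isHolFun_apply (hXhol.mono (hA.trans hV'))).continuousOn
  by_contra hne
  have hopen : IsOpen ((A : Set M) ∩ (fun z => θ z (X z)) ⁻¹' {0}ᶜ) :=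
    hcont.isOpen_inter_preimage A.isOpen isOpen_compl_singleton
  obtain ⟨z, hz, hfz⟩ := hf0 ⟨_, hopen⟩ (fun z hz => hz.1) ⟨x, hxA, hne⟩
  exact (mul_ne_zero hfz hz.2) (hzero z hz.1)

theorem eventually_bijective_mfderiv {η : M → N} (hη : ContMDiff (modelC n) (modelC n) ω η)
    {x₀ : M} (h : Function.Surjective (mfderiv (modelC n) (modelC n) η x₀)) :
    ∀ᶠ x in 𝓝 x₀, Function.Bijective (mfderiv (modelC n) (modelC n) η x) := by
  let y₀ := η x₀
  have hJ : ∀ {x}, x ∈ (chartAt (EuclideanSpace ℂ (Fin n)) x₀).source →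
      η x ∈ (chartAt (EuclideanSpace ℂ (Fin n)) y₀).source → ∀ u : TanC n M x,
      jacobian (m := n) (n := n) η x₀ y₀ x (toCoord x₀ x u) =
        toCoord y₀ (η x) (mfderiv (modelC n) (modelC n) η x u) := by
    intro x hx hy u
    rw [jacobian_apply, ofCoord_toCoord hx]
  have hs : Function.Surjective (jacobian (m := n) (n := n) η x₀ y₀ x₀) := by
    intro v
    obtain ⟨u, hu⟩ := h (ofCoord y₀ (η x₀) v)
    exact ⟨toCoord x₀ x₀ u, by rw [hJ (mem_chart_source _ _) (mem_chart_source _ _), hu,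
      toCoord_ofCoord (mem_chart_source _ _)]⟩
  have hdet : (jacobian (m := n) (n := n) η x₀ y₀ x₀).det ≠ 0 :=
    (LinearEquiv.isUnit_det' (LinearEquiv.ofBijective
      (jacobian (m := n) (n := n) η x₀ y₀ x₀).toLinearMap
      ⟨LinearMap.injective_iff_surjective.2 hs, hs⟩)).ne_zero
  have hcont : ContinuousAt (fun x => (jacobian (m := n) (n := n) η x₀ y₀ x).det) x₀ :=
    ContinuousLinearMap.continuous_det.continuousAt.comp
      (contMDiffAt_jacobian hη (mem_chart_source _ _) (mem_chart_source _ _)).continuousAt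
  have hy : ∀ᶠ x in 𝓝 x₀, η x ∈ (chartAt (EuclideanSpace ℂ (Fin n)) y₀).source :=
    hη.continuous.continuousAt.eventually_mem (chart_source_mem_nhds _ _)
  have hx : ∀ᶠ x in 𝓝 x₀, x ∈ (chartAt (EuclideanSpace ℂ (Fin n)) x₀).source :=
    chart_source_mem_nhds _ _
  filter_upwards [hcont.eventually_ne hdet, hx, hy] with x h1 h2 h3
  have hbij : Function.Bijective (jacobian (m := n) (n := n) η x₀ y₀ x) :=
    (LinearMap.equivOfDetNeZero _ h1).bijective
  refine ⟨fun u v huv => ?_, fun v => ?_⟩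
  · refine toCoord_injective h2 (hbij.1 ?_)
    rw [hJ h2 h3, hJ h2 h3, huv]
  · obtain ⟨u, hu⟩ := hbij.2 (toCoord y₀ (η x) v)
    refine ⟨ofCoord x₀ x u, toCoord_injective h3 ?_⟩
    rw [← hu, jacobian_apply]

/-- If the liftings of `W₁` and `W₂` have zero intersection, so do `W₁` and `W₂`. -/
theorem eq_zero_of_mem_of_lifting [SecondCountableTopology M] {η : M → N}
    (hη : ContMDiff (modelC n) (modelC n) ω η) (hsurj : Function.Surjective η)
    {W₁ W₂ : TangentSubsheaf n N}
    (h : ∀ (V : Opens M), ∀ X ∈ (lifting (m := n) η W₁).sec V ∩ (lifting (m := n) η W₂).sec V,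
      ∀ x ∈ V, X x = 0)
    {V : Opens N} {s : Π y, TanC n N y} (h₁ : s ∈ W₁.sec V) (h₂ : s ∈ W₂.sec V) :
    ∀ y ∈ V, s y = 0 := by
  intro y hy
  by_contra hne
  let V' : Opens N := V ⊓ ⟨_, (chartAt (EuclideanSpace ℂ (Fin n)) y).open_source⟩
  have hcont : ContinuousOn (fun z => toCoord y z (s z)) V' :=
    ((isHolSection_tangent_iff (V := V') fun z hz => hz.2).1
      ((W₁.isHol h₁).mono inf_le_left)).continuousOn
  have hopen : IsOpen ((V' : Set N) ∩ (fun z => toCoord y z (s z)) ⁻¹' {0}ᶜ) :=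
    hcont.isOpen_inter_preimage V'.isOpen isOpen_compl_singleton
  -- The set where `s` is nonzero is open, so it contains the image of a point with bijective
  -- differential, near which `s` can be lifted.
  obtain ⟨x, hx, hxs⟩ := exists_surjective_mfderiv le_rfl hη hsurj (O := ⟨_, hopen⟩)
    ⟨y, ⟨hy, mem_chart_source _ y⟩, fun h0 => hne (toCoord_injective (mem_chart_source _ y)
      (by rw [map_zero]; exact h0))⟩
  obtain ⟨T, hT, hTo, hxT⟩ := eventually_nhds_iff.1 ((eventually_bijective_mfderiv hη hxs).and
    (hη.continuous.continuousAt.eventually_mem (hopen.mem_nhds hx)))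
  choose! X hX using fun z (hz : z ∈ T) => (hT z hz).1.2 (s (η z))
  have hmem : ∀ {W : TangentSubsheaf n N}, s ∈ W.sec V →
      X ∈ (lifting (m := n) η W).sec ⟨T, hTo⟩ := fun hs =>
    mem_lifting_of_mfderiv_eq hη hs (fun z hz => (hT z hz).2.1.1) (fun z hz => (hT z hz).1.1) hX
  have h0 := h ⟨T, hTo⟩ X ⟨hmem h₁, hmem h₂⟩ x hxT
  have h1 := hX x hxT
  rw [h0, map_zero] at h1
  refine hx.2 ?_
  change toCoord y (η x) (s (η x)) = 0
  rw [← h1, map_zero]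

end LiftedFields

/-! ### Linear algebra with parameters -/

section Linear

open Filter Topology

/-- Take `I` maximal among the index sets independent at some point of `O`. Independence is an open
condition, and wherever it holds maximality forces the other vectors into the span. -/
theorem exists_isOpen_linearIndepOn_span {X E ι : Type*} [TopologicalSpace X]
    [NormedAddCommGroup E] [NormedSpace ℂ E] [Finite ι] {O : Set X} (hO : IsOpen O)
    (hne : O.Nonempty) {v : ι → X → E} (hv : ∀ i, ContinuousOn (v i) O) :
    ∃ O' ⊆ O, IsOpen O' ∧ O'.Nonempty ∧ ∃ I : Set ι, ∀ x ∈ O',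
      LinearIndepOn ℂ (fun i => v i x) I ∧
        ∀ j, v j x ∈ Submodule.span ℂ ((fun i => v i x) '' I) := by
  obtain ⟨x₀, hx₀⟩ := hne
  have hfin : {I : Set ι | ∃ x ∈ O, LinearIndepOn ℂ (fun i => v i x) I}.Finite := Set.toFinite _
  obtain ⟨I, ⟨x, hx, hI⟩, hmax⟩ := hfin.exists_maximal
    ⟨∅, x₀, hx₀, linearIndepOn_empty ℂ _⟩
  have hcont : ContinuousOn (fun x => fun i : I => v i x) O := continuousOn_pi.2 fun i => hv i
  refine ⟨O ∩ (fun x => fun i : I => v i x) ⁻¹' {f | LinearIndependent ℂ f},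
    Set.inter_subset_left, hcont.isOpen_inter_preimage hO isOpen_setOfPred_linearIndependent,
    ⟨x, hx, hI⟩, I, fun z hz => ⟨hz.2, fun j => ?_⟩⟩
  by_contra hj
  have hIz : LinearIndepOn ℂ (fun i => v i z) I := hz.2
  have h1 : LinearIndepOn ℂ (fun i => v i z) (insert j I) := hIz.insert hj
  have h2 := hmax ⟨z, hz.1, h1⟩ (Set.subset_insert j I)
  exact hj (Submodule.subset_span ⟨j, h2 (Set.mem_insert j I), rfl⟩)

/-- The adjugate of an endomorphism of a finite-dimensional space. -/
theorem exists_continuous_adjugate (E : Type*) [NormedAddCommGroup E] [NormedSpace ℂ E]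
    [FiniteDimensional ℂ E] : ∃ adj : (E →L[ℂ] E) → (E →L[ℂ] E), Continuous adj ∧
      ∀ (L : E →L[ℂ] E) (v : E), adj L (L v) = L.det • v := by
  classical
  let b := Module.finBasis ℂ E
  let A : (E →L[ℂ] E) →ₗ[ℂ] Matrix (Fin (Module.finrank ℂ E)) (Fin (Module.finrank ℂ E)) ℂ :=
    (LinearMap.toMatrix b b).toLinearMap ∘ₗ ContinuousLinearMap.coeLM ℂ
  let B : Matrix (Fin (Module.finrank ℂ E)) (Fin (Module.finrank ℂ E)) ℂ →ₗ[ℂ] (E →L[ℂ] E) :=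
    LinearMap.toContinuousLinearMap.toLinearMap ∘ₗ (Matrix.toLin b b).toLinearMap
  refine ⟨fun L => B (A L).adjugate, ?_, fun L v => ?_⟩
  · exact B.continuous_of_finiteDimensional.comp
      (Continuous.matrix_adjugate A.continuous_of_finiteDimensional)
  · have h1 : Matrix.toLin b b (A L) = (L : E →ₗ[ℂ] E) := Matrix.toLin_toMatrix b b _
    have h2 : (A L).det = L.det := LinearMap.det_toMatrix b _
    change Matrix.toLin b b (A L).adjugate ((L : E →ₗ[ℂ] E) v) = _
    rw [← h1, ← Matrix.toLin_mul_apply, Matrix.adjugate_mul, h2]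
    simp

end Linear

/-! ### The pointwise polar of the forms vanishing on a distribution -/

section PolarFibre

open Filter Topology

variable {n : ℕ} {N : Type*} [TopologicalSpace N] [ChartedSpace (EuclideanSpace ℂ (Fin n)) N]
  [IsManifold (modelC n) ω N]

/-- The tangent vectors at `y` killed by the germs at `y` of forms vanishing on `W`. -/
def polarFibre (W : TangentSubsheaf n N) (y : N) : Submodule ℂ (TanC n N y) where
  carrier := {u | ∀ O : Opens N, y ∈ O → ∀ θ ∈ (formsVanishingOn W).sec O, θ y u = 0}
  zero_mem' O _ θ _ := map_zero (θ y)
  add_mem' {u v} hu hv O hO θ hθ := by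
    refine (map_add (θ y) u v).trans ?_
    rw [hu O hO θ hθ, hv O hO θ hθ]
    exact add_zero _
  smul_mem' c u hu O hO θ hθ := by
    refine (map_smul (θ y) c u).trans ?_
    rw [hu O hO θ hθ]
    exact smul_zero _

/-- Where `W` is spanned by a frame, tangent vectors killed by all forms vanishing on `W` lie in the
span of the frame. -/
theorem polarFibre_le_span {W : TangentSubsheaf n N} {V : Opens N} {y₀ : N} (hy₀ : y₀ ∈ V)
    {ι : Type*} [Finite ι] {g : ι → Π y, TanC n N y}
    (hg : ∀ i, IsHolSection (n := n) (EuclideanSpace ℂ (Fin n)) (TanC n N) V (g i))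
    (hli : LinearIndependent ℂ fun i => g i y₀)
    (hspan : ∀ V' ≤ V, ∀ s ∈ W.sec V', ∀ y ∈ V', s y ∈ Submodule.span ℂ (Set.range fun i => g i y)) :
    polarFibre W y₀ ≤ Submodule.span ℂ (Set.range fun i => g i y₀) := by
  intro u hu
  by_contra hnot
  have := Fintype.ofFinite ι
  let V₁ : Opens N := V ⊓ ⟨_, (chartAt (EuclideanSpace ℂ (Fin n)) y₀).open_source⟩
  have hy₁ : y₀ ∈ V₁ := ⟨hy₀, mem_chart_source _ y₀⟩
  let G : ι → N → EuclideanSpace ℂ (Fin n) := fun i y => toCoord y₀ y (g i y)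
  have hG : ∀ i, ContMDiffOn (modelC n) (modelC n) ω (G i) V₁ := fun i =>
    (isHolSection_tangent_iff (V := V₁) fun z hz => hz.2).1 ((hg i).mono inf_le_left)
  -- A linear form at `y₀` that kills the frame but not `u` is to be extended to a holomorphic form
  -- that kills the frame at all nearby points, contradicting the choice of `u`.
  obtain ⟨l, hlu, hl⟩ := Submodule.exists_le_ker_of_notMem hnot
  let φ : EuclideanSpace ℂ (Fin n) →L[ℂ] ℂ :=
    LinearMap.toContinuousLinearMap (l ∘ₗ (ofCoord y₀ y₀).toLinearMap)
  have hφ : ∀ w, φ (toCoord y₀ y₀ w) = l w := fun w =>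
    congrArg l (ofCoord_toCoord (mem_chart_source _ y₀) w)
  have hGli : LinearIndependent ℂ fun i => G i y₀ :=
    hli.map' (toCoord y₀ y₀).toLinearMap
      (LinearMap.ker_eq_bot.2 (toCoord_injective (mem_chart_source _ y₀)))
  obtain ⟨L, hL⟩ := LinearMap.exists_leftInverse_of_injective
    (Finsupp.linearCombination ℂ fun i => G i y₀) (LinearMap.ker_eq_bot.2 hGli)
  let ℓ : ι → EuclideanSpace ℂ (Fin n) →L[ℂ] ℂ := fun i =>
    LinearMap.toContinuousLinearMap (Finsupp.lapply i ∘ₗ L)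
  have hℓ : ∀ i j, ℓ i (G j y₀) = Finsupp.single j (1 : ℂ) i := by
    intro i j
    have h1 := LinearMap.congr_fun hL (Finsupp.single j 1)
    simp only [LinearMap.comp_apply, Finsupp.linearCombination_single, one_smul,
      LinearMap.id_apply] at h1
    change L (G j y₀) i = _
    rw [h1]
  -- With `ℓ` dual to the frame at `y₀`, `B y` carries the frame at `y₀` to the frame at `y` and is
  -- the identity at `y₀`. Hence `φ ∘ (B y)⁻¹` is the required extension where `B` is invertible.
  let B : N → EuclideanSpace ℂ (Fin n) →L[ℂ] EuclideanSpace ℂ (Fin n) := fun y =>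
    ContinuousLinearMap.id ℂ _ + ∑ i, (ℓ i).smulRight (G i y - G i y₀)
  have hB₀ : B y₀ = ContinuousLinearMap.id ℂ _ := by
    ext v
    simp [B]
  have hBG : ∀ y j, B y (G j y₀) = G j y := by
    classical
    intro y j
    have h1 : ∀ i, Finsupp.single j (1 : ℂ) i • (G i y - G i y₀) =
        if i = j then G i y - G i y₀ else 0 := by
      intro i
      rcases eq_or_ne i j with h | h
      · subst h; simp
      · rw [Finsupp.single_eq_of_ne h, if_neg h, zero_smul]
    simp [B, sum_apply, hℓ, h1]
  have hBhol : ContMDiffOn (modelC n)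
      (modelWithCornersSelf ℂ (EuclideanSpace ℂ (Fin n) →L[ℂ] EuclideanSpace ℂ (Fin n))) ω B
      V₁ := by
    refine contMDiffOn_const.add (contMDiffOn_finsetSum fun i _ => ?_)
    have h1 : ContMDiffOn (modelC n) (modelC n) ω (fun y => G i y - G i y₀) V₁ :=
      (hG i).sub contMDiffOn_const
    exact ((ContinuousLinearMap.smulRightL ℂ (EuclideanSpace ℂ (Fin n))
      (EuclideanSpace ℂ (Fin n)) (ℓ i)).contMDiff (n := ω)).comp_contMDiffOn h1
  have hdet : ContinuousOn (fun y => (B y).det) V₁ :=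
    ContinuousLinearMap.continuous_det.comp_continuousOn hBhol.continuousOn
  let V₂ : Opens N := ⟨(V₁ : Set N) ∩ (fun y => (B y).det) ⁻¹' {0}ᶜ,
    hdet.isOpen_inter_preimage V₁.isOpen isOpen_compl_singleton⟩
  have hy₂ : y₀ ∈ V₂ := ⟨hy₁, by simp [hB₀, ContinuousLinearMap.det]⟩
  have hequiv : ∀ y ∈ V₂, ∃ e : EuclideanSpace ℂ (Fin n) ≃L[ℂ] EuclideanSpace ℂ (Fin n),
      (e : EuclideanSpace ℂ (Fin n) →L[ℂ] EuclideanSpace ℂ (Fin n)) = B y := by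
    intro y hy
    refine ⟨(LinearMap.equivOfDetNeZero (B y).toLinearMap hy.2).toContinuousLinearEquiv, ?_⟩
    ext v
    rfl
  let θ : Π y, CotC n N y := fun y => by
    exact (φ.comp (B y).inverse).comp (toCoord y₀ y)
  have hθ_apply : ∀ y w, θ y w = φ ((B y).inverse (toCoord y₀ y w)) := fun _ _ => rfl
  have hθ : θ ∈ (formsVanishingOn W).sec V₂ := by
    refine ⟨(isHolSection_cotangent_iff (V := V₂) (x₀ := y₀) fun z hz => hz.1.2).2 ?_, ?_⟩
    · have h1 : ContMDiffOn (modelC n)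
          (modelWithCornersSelf ℂ (EuclideanSpace ℂ (Fin n) →L[ℂ] ℂ)) ω
          (fun y => φ.comp (B y).inverse) V₂ := by
        intro y hy
        obtain ⟨e, he⟩ := hequiv y hy
        have h2 : ContDiffAt ℂ ω (ContinuousLinearMap.inverse (M := EuclideanSpace ℂ (Fin n))
            (M₂ := EuclideanSpace ℂ (Fin n)) (R := ℂ)) (B y) := by
          rw [← he]
          exact contDiffAt_map_inverse e
        have h3 := h2.contMDiffAt.comp y (hBhol.contMDiffAt (V₁.isOpen.mem_nhds hy.1))
        exact (contMDiffAt_const.clm_comp h3).contMDiffWithinAt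
      refine h1.congr fun y hy => ?_
      ext v
      rw [formCoord_apply, hθ_apply, toCoord_ofCoord hy.1.2]
      rfl
    · intro V' hV' X hX y hy
      have h1 : X y ∈ Submodule.span ℂ (Set.range fun i => g i y) :=
        hspan V' (fun z hz => (hV' hz).1.1) X hX y hy
      have h2 : Submodule.span ℂ (Set.range fun i => g i y) ≤
          LinearMap.ker (θ y).toLinearMap := by
        rw [Submodule.span_le]
        rintro _ ⟨i, rfl⟩
        obtain ⟨e, he⟩ := hequiv y (hV' hy)
        change θ y (g i y) = 0
        rw [hθ_apply]
        have h3 : toCoord y₀ y (g i y) = e (G i y₀) := by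
          rw [← ContinuousLinearEquiv.coe_coe, he, hBG]
        rw [h3, ← he, ContinuousLinearMap.inverse_equiv, ContinuousLinearEquiv.coe_coe,
          ContinuousLinearEquiv.symm_apply_apply, hφ]
        exact hl (Submodule.subset_span ⟨i, rfl⟩)
      exact h2 h1
  have h1 := hu V₂ hy₂ θ hθ
  rw [hθ_apply, hB₀, ContinuousLinearMap.inverse_id, ContinuousLinearMap.id_apply, hφ] at h1
  exact hlu h1

end PolarFibre

/-! ### The projection upstairs -/

section LiftedDecomposition

variable {n : ℕ} {M : Type*} [TopologicalSpace M] [ChartedSpace (EuclideanSpace ℂ (Fin n)) M]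
  [IsManifold (modelC n) ω M]
  {N : Type*} [TopologicalSpace N] [ChartedSpace (EuclideanSpace ℂ (Fin n)) N]
  [IsManifold (modelC n) ω N]

/-- The projection to the first summand, in the chart around `x₀`. -/
theorem exists_continuousOn_projection {η : M → N} (hη : ContMDiff (modelC n) (modelC n) ω η)
    {W₁ W₂ : TangentSubsheaf n N}
    (h : (lifting (m := n) η W₁).IsDirectSum (lifting (m := n) η W₂)) (x₀ : M) :
    ∃ p : M → EuclideanSpace ℂ (Fin n) →L[ℂ] EuclideanSpace ℂ (Fin n),
      ContinuousOn p (chartAt (EuclideanSpace ℂ (Fin n)) x₀).source ∧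
      ∀ x ∈ (chartAt (EuclideanSpace ℂ (Fin n)) x₀).source, ∀ v,
        mfderiv (modelC n) (modelC n) η x (ofCoord x₀ x (p x v)) ∈ polarFibre W₁ (η x) ∧
        mfderiv (modelC n) (modelC n) η x (ofCoord x₀ x (v - p x v)) ∈ polarFibre W₂ (η x) := by
  let V : Opens M := ⟨_, (chartAt (EuclideanSpace ℂ (Fin n)) x₀).open_source⟩
  let b := EuclideanSpace.basisFun (Fin n) ℂ
  have hhol : ∀ i, IsHolSection (n := n) (EuclideanSpace ℂ (Fin n)) (TanC n M) V
      (fun x => ofCoord x₀ x (b i)) := by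
    intro i
    refine (isHolSection_tangent_iff (V := V) (x₀ := x₀) subset_rfl).2 ?_
    exact contMDiffOn_const.congr fun x hx => toCoord_ofCoord hx _
  -- Splitting only the coordinate fields suffices: the projection is their linear extension, and
  -- holomorphy of the summands gives its continuity.
  choose X hX Y hY hXY using fun i => (h V).1 _ (hhol i)
  let p : M → EuclideanSpace ℂ (Fin n) →L[ℂ] EuclideanSpace ℂ (Fin n) := fun x =>
    ∑ i, (EuclideanSpace.proj i : EuclideanSpace ℂ (Fin n) →L[ℂ] ℂ).smulRight
      (toCoord x₀ x (X i x))
  have hp : ∀ x v, p x v = ∑ i, v i • toCoord x₀ x (X i x) := fun x v => by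
    simp [p, sum_apply]
  have hpX : ∀ x ∈ V, ∀ v, ofCoord x₀ x (p x v) = ∑ i, v i • X i x := by
    intro x hx v
    rw [hp, map_sum]
    exact Finset.sum_congr rfl fun i _ => by rw [map_smul, ofCoord_toCoord hx]
  have hpY : ∀ x ∈ V, ∀ v, ofCoord x₀ x (v - p x v) = ∑ i, v i • Y i x := by
    intro x hx v
    have h1 : v = ∑ i, v i • b i := by
      have := b.sum_repr v
      simpa [b] using this.symm
    have h2 : ofCoord x₀ x v = ∑ i, v i • (X i x + Y i x) := by
      conv_lhs => rw [h1]
      rw [map_sum]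
      exact Finset.sum_congr rfl fun i _ => by rw [map_smul, hXY i x hx]
    rw [map_sub, h2, hpX x hx, sub_eq_iff_eq_add, ← Finset.sum_add_distrib]
    exact Finset.sum_congr rfl fun i _ => by rw [smul_add, add_comm]
  have hmem : ∀ {W : TangentSubsheaf n N} {Z : Π x, TanC n M x},
      Z ∈ (lifting (m := n) η W).sec V → ∀ x ∈ V,
      mfderiv (modelC n) (modelC n) η x (Z x) ∈ polarFibre W (η x) :=
    fun hZ x hx O hO θ hθ => apply_mfderiv_eq_zero_of_mem_lifting hη hZ hθ hx hO
  refine ⟨p, ?_, fun x hx v => ⟨?_, ?_⟩⟩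
  · refine continuousOn_finsetSum _ fun i _ => ?_
    have h1 : ContinuousOn (fun x => toCoord x₀ x (X i x)) V :=
      ((isHolSection_tangent_iff (V := V) subset_rfl).1
        ((lifting (m := n) η W₁).isHol (hX i))).continuousOn
    exact (ContinuousLinearMap.smulRightL ℂ (EuclideanSpace ℂ (Fin n))
      (EuclideanSpace ℂ (Fin n)) (EuclideanSpace.proj i)).continuous.comp_continuousOn h1
  · rw [hpX x hx, map_sum]
    exact Submodule.sum_mem _ fun i _ => by
      rw [map_smul]; exact Submodule.smul_mem _ _ (hmem (hX i) x hx)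
  · rw [hpY x hx, map_sum]
    exact Submodule.sum_mem _ fun i _ => by
      rw [map_smul]; exact Submodule.smul_mem _ _ (hmem (hY i) x hx)

end LiftedDecomposition

/-! ### Holomorphic determinants and the identity theorem -/

section Holomorphic

variable {n : ℕ} {M : Type*} [TopologicalSpace M] [ChartedSpace (EuclideanSpace ℂ (Fin n)) M]

theorem IsHolFun.det {V : Opens M} {k : ℕ} {A : M → Matrix (Fin k) (Fin k) ℂ}
    (hA : ∀ i j, IsHolFun (n := n) V fun x => A x i j) :
    IsHolFun (n := n) V fun x => (A x).det := by
  simp only [Matrix.det_apply']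
  exact contMDiffOn_finsetSum fun σ _ =>
    contMDiffOn_const.mul (contMDiffOn_finsetProd fun i _ => hA (σ i) i)

theorem IsHolFun.cramer {V : Opens M} {k : ℕ} {A : M → Matrix (Fin k) (Fin k) ℂ}
    {b : M → Fin k → ℂ} (hA : ∀ i j, IsHolFun (n := n) V fun x => A x i j)
    (hb : ∀ i, IsHolFun (n := n) V fun x => b x i) (j : Fin k) :
    IsHolFun (n := n) V fun x => (A x).cramer (b x) j := by
  simp only [Matrix.cramer_apply]
  refine IsHolFun.det fun i l => ?_
  simp only [Matrix.updateCol_apply]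
  split_ifs
  · exact hb i
  · exact hA i l

variable [IsManifold (modelC n) ω M]

/-- Small coordinate balls satisfy the identity theorem. -/
theorem exists_opens_nowhereLocallyZero {O : Opens M} {x₀ : M} (hx₀ : x₀ ∈ O) :
    ∃ V ≤ O, x₀ ∈ V ∧ (V : Set M) ⊆ (chartAt (EuclideanSpace ℂ (Fin n)) x₀).source ∧
      ∀ f : M → ℂ, IsHolFun (n := n) V f → (∃ x ∈ V, f x ≠ 0) → NowhereLocallyZero V f := by
  let ψ := extChartAt (modelC n) x₀
  have hcont : ContinuousOn ψ.symm ψ.target := continuousOn_extChartAt_symm x₀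
  have hnhds : ψ.target ∩ ψ.symm ⁻¹' O ∈ nhds (ψ x₀) :=
    (hcont.isOpen_inter_preimage (isOpen_extChartAt_target x₀) O.isOpen).mem_nhds
      ⟨mem_extChartAt_target x₀, by
        change ψ.symm (ψ x₀) ∈ O
        rwa [ψ.left_inv (mem_extChartAt_source x₀)]⟩
  obtain ⟨r, hr, hball⟩ := Metric.mem_nhds_iff.1 hnhds
  have hsource : ψ.source = (chartAt (EuclideanSpace ℂ (Fin n)) x₀).source :=
    extChartAt_source (modelC n) x₀
  let V : Opens M := ⟨ψ.source ∩ ψ ⁻¹' Metric.ball (ψ x₀) r,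
    (continuousOn_extChartAt x₀).isOpen_inter_preimage (isOpen_extChartAt_source x₀)
      Metric.isOpen_ball⟩
  have hVmem : ∀ z ∈ Metric.ball (ψ x₀) r, ψ.symm z ∈ V := fun z hz =>
    ⟨ψ.map_target (hball hz).1, by
      change ψ (ψ.symm z) ∈ Metric.ball (ψ x₀) r
      rwa [ψ.right_inv (hball hz).1]⟩
  refine ⟨V, fun x hx => ?_, ⟨mem_extChartAt_source x₀, Metric.mem_ball_self hr⟩,
    fun x hx => hsource ▸ hx.1, fun f hf ⟨x₁, hx₁, hne⟩ T hT ⟨x₂, hx₂⟩ => ?_⟩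
  · have h1 := (hball hx.2).2
    change ψ.symm (ψ x) ∈ O at h1
    rwa [ψ.left_inv hx.1] at h1
  · by_contra! h0
    have han : AnalyticOnNhd ℂ (fun z => f (ψ.symm z)) (Metric.ball (ψ x₀) r) := fun z hz =>
      ContMDiffAt.analyticAt_comp_extChartAt_symm (hball hz).1
        (hf.contMDiffAt (V.isOpen.mem_nhds (hVmem z hz)))
    have hz₂ : ψ x₂ ∈ Metric.ball (ψ x₀) r := (hT hx₂).2
    have hev : (fun z => f (ψ.symm z)) =ᶠ[nhds (ψ x₂)] 0 := by
      have h1 : Filter.Tendsto ψ.symm (nhds (ψ x₂)) (nhds x₂) := by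
        have := hcont.continuousAt ((isOpen_extChartAt_target x₀).mem_nhds (hball hz₂).1)
        rw [ContinuousAt, ψ.left_inv (hT hx₂).1] at this
        exact this
      filter_upwards [h1 (T.isOpen.mem_nhds hx₂)] with z hz
      exact h0 _ hz
    have h2 := han.eqOn_zero_of_preconnected_of_eventuallyEq_zero
      (convex_ball _ _).isPreconnected hz₂ hev hx₁.2
    refine hne ?_
    rw [← ψ.left_inv hx₁.1]
    exact h2

end Holomorphic

/-! ### Module operations in a subsheaf -/

section Subsheaf

variable {n : ℕ} {M : Type*} [TopologicalSpace M] [ChartedSpace (EuclideanSpace ℂ (Fin n)) M]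
  [IsManifold (modelC n) ω M] {W : TangentSubsheaf n M} {V : Opens M}

namespace ModuleSubsheaf

theorem congr_mem {s t : Π x, TanC n M x} (hs : s ∈ W.sec V) (h : ∀ x ∈ V, t x = s x) :
    t ∈ W.sec V :=
  W.mem_of_locally fun _ hx => ⟨V, le_rfl, hx, s, hs, h⟩

theorem sum_smul_mem {ι : Type*} (I : Finset ι) {c : ι → M → ℂ} {g : ι → Π x, TanC n M x}
    (hc : ∀ i ∈ I, IsHolFun (n := n) V (c i)) (hg : ∀ i ∈ I, g i ∈ W.sec V) :
    (fun x => ∑ i ∈ I, c i x • g i x) ∈ W.sec V := by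
  classical
  induction I using Finset.induction_on with
  | empty => exact congr_mem (W.zero_mem V) fun x _ => by simp
  | insert a I ha ih =>
    have h1 := W.add_mem (W.smul_mem (hc a (Finset.mem_insert_self a I))
      (hg a (Finset.mem_insert_self a I))) (ih (fun i hi => hc i (Finset.mem_insert_of_mem hi))
        fun i hi => hg i (Finset.mem_insert_of_mem hi))
    exact congr_mem h1 fun x _ => by rw [Finset.sum_insert ha]; rfl

theorem sub_mem {s t : Π x, TanC n M x} (hs : s ∈ W.sec V) (ht : t ∈ W.sec V) :
    (fun x => s x - t x) ∈ W.sec V := by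
  refine congr_mem (W.add_mem hs (W.smul_mem (f := fun _ => -1) contMDiffOn_const ht))
    fun x _ => ?_
  change s x - t x = s x + (-1 : ℂ) • t x
  rw [neg_one_smul, sub_eq_add_neg]

end ModuleSubsheaf

end Subsheaf

/-! ### Frames adapted to the two distributions -/

section Frame

open Filter Topology

variable {n : ℕ} {N : Type*} [TopologicalSpace N] [ChartedSpace (EuclideanSpace ℂ (Fin n)) N]
  [IsManifold (modelC n) ω N]

/-- The matrix of the vectors `g j y` in the chart around `y₀`. -/
noncomputable def frameMatrix (y₀ : N) (g : Fin n → Π y, TanC n N y) (y : N) :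
    Matrix (Fin n) (Fin n) ℂ :=
  Matrix.of fun i j => toCoord y₀ y (g j y) i

theorem isHolFun_toCoord_apply {y₀ : N} {V : Opens N}
    (hV : (V : Set N) ⊆ (chartAt (EuclideanSpace ℂ (Fin n)) y₀).source) {s : Π y, TanC n N y}
    (hs : IsHolSection (n := n) (EuclideanSpace ℂ (Fin n)) (TanC n N) V s) (i : Fin n) :
    IsHolFun (n := n) V fun y => toCoord y₀ y (s y) i :=
  ((EuclideanSpace.proj i : EuclideanSpace ℂ (Fin n) →L[ℂ] ℂ).contMDiff (n := ω)).comp_contMDiffOn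
    ((isHolSection_tangent_iff hV).1 hs)

theorem linearIndependent_iff_det_ne_zero (v : Fin n → EuclideanSpace ℂ (Fin n)) :
    LinearIndependent ℂ v ↔ (Matrix.of fun i j => v j i).det ≠ 0 := by
  rw [← isUnit_iff_ne_zero, ← Matrix.isUnit_iff_isUnit_det, ← Matrix.linearIndependent_cols_iff_isUnit]
  exact (LinearMap.linearIndependent_iff (WithLp.linearEquiv 2 ℂ (Fin n → ℂ)).toLinearMap
    (LinearEquiv.ker _)).symm

theorem linearIndependent_of_frameMatrix_det_ne_zero {y₀ y : N} {g : Fin n → Π y, TanC n N y}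
    (h : (frameMatrix y₀ g y).det ≠ 0) : LinearIndependent ℂ fun i => g i y :=
  LinearIndependent.of_comp (toCoord y₀ y).toLinearMap
    ((linearIndependent_iff_det_ne_zero fun i => toCoord y₀ y (g i y)).2 h)

/-- Cramer's rule. -/
theorem sum_cramer_smul {y₀ y : N} (hy : y ∈ (chartAt (EuclideanSpace ℂ (Fin n)) y₀).source)
    (g : Fin n → Π y, TanC n N y) (u : TanC n N y) :
    ∑ j, (frameMatrix y₀ g y).cramer (toCoord y₀ y u).ofLp j • g j y =
      (frameMatrix y₀ g y).det • u := by
  refine toCoord_injective hy ?_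
  rw [map_sum, map_smul]
  have h := Matrix.mulVec_cramer (frameMatrix y₀ g y) (toCoord y₀ y u).ofLp
  ext i
  have hi := congrFun h i
  simp only [Matrix.mulVec, dotProduct, Pi.smul_apply] at hi
  rw [PiLp.smul_apply, ← hi, WithLp.ofLp_sum, Finset.sum_apply]
  refine Finset.sum_congr rfl fun j _ => ?_
  rw [map_smul]
  exact mul_comm _ _

theorem isHolFun_frameMatrix {y₀ : N} {V : Opens N}
    (hV : (V : Set N) ⊆ (chartAt (EuclideanSpace ℂ (Fin n)) y₀).source)
    {g : Fin n → Π y, TanC n N y}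
    (hg : ∀ i, IsHolSection (n := n) (EuclideanSpace ℂ (Fin n)) (TanC n N) V (g i)) (i j : Fin n) :
    IsHolFun (n := n) V fun y => frameMatrix y₀ g y i j :=
  isHolFun_toCoord_apply hV (hg j) i

theorem mem_span_of_toCoord_mem_span {y₀ y : N}
    (hy : y ∈ (chartAt (EuclideanSpace ℂ (Fin n)) y₀).source) {S : Set (TanC n N y)}
    {u : TanC n N y} (h : toCoord y₀ y u ∈ Submodule.span ℂ (toCoord y₀ y '' S)) :
    u ∈ Submodule.span ℂ S := by
  have h1 : Submodule.span ℂ (toCoord y₀ y '' S) =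
      (Submodule.span ℂ S).map (toCoord y₀ y).toLinearMap :=
    (Submodule.map_span (toCoord y₀ y).toLinearMap S).symm
  rw [h1] at h
  obtain ⟨w, hw, hwu⟩ := h
  rwa [← toCoord_injective hy hwu]

/-- Where a frame splits into sections of `W₁` and sections of `W₂`, the vectors killed by the forms
vanishing on `W₁` lie in the span of the first part. -/
theorem polarFibre_le_span_of_adapted_frame {W₁ W₂ : TangentSubsheaf n N}
    (hzero : ∀ (V : Opens N) (s : Π y, TanC n N y), s ∈ W₁.sec V → s ∈ W₂.sec V →
      ∀ y ∈ V, s y = 0) {y₀ : N} {V : Opens N}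
    (hV : (V : Set N) ⊆ (chartAt (EuclideanSpace ℂ (Fin n)) y₀).source)
    {g : Fin n → Π y, TanC n N y} {I : Finset (Fin n)} (h₁ : ∀ i ∈ I, g i ∈ W₁.sec V)
    (h₂ : ∀ i ∉ I, g i ∈ W₂.sec V) {y : N} (hy : y ∈ V) (hdet : (frameMatrix y₀ g y).det ≠ 0) :
    polarFibre W₁ y ≤ Submodule.span ℂ ((fun i => g i y) '' I) := by
  have hg : ∀ i, IsHolSection (n := n) (EuclideanSpace ℂ (Fin n)) (TanC n N) V (g i) := fun i => by
    by_cases hi : i ∈ I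
    exacts [W₁.isHol (h₁ i hi), W₂.isHol (h₂ i hi)]
  have hmat := isHolFun_frameMatrix hV hg
  have hδ : IsHolFun (n := n) V fun y => (frameMatrix y₀ g y).det := IsHolFun.det hmat
  let V' : Opens N := ⟨(V : Set N) ∩ (fun y => (frameMatrix y₀ g y).det) ⁻¹' {0}ᶜ,
    (ContMDiffOn.continuousOn hδ).isOpen_inter_preimage V.isOpen isOpen_compl_singleton⟩
  have hV'V : V' ≤ V := fun z hz => hz.1
  have hy' : y ∈ V' := ⟨hy, hdet⟩
  rw [Set.image_eq_range]
  refine polarFibre_le_span hy' (g := fun i : (I : Set (Fin n)) => g i)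
    (fun i => (hg i).mono hV'V)
    ((linearIndependent_of_frameMatrix_det_ne_zero hdet).comp _ Subtype.val_injective) ?_
  intro T hT s hs z hz
  let c : Fin n → N → ℂ := fun j y => ((frameMatrix y₀ g y).det)⁻¹ *
    (frameMatrix y₀ g y).cramer (toCoord y₀ y (s y)).ofLp j
  have hTV : T ≤ V := hT.trans hV'V
  have hc : ∀ j, IsHolFun (n := n) T (c j) := fun j =>
    IsHolFun.mul (ContMDiffOn.inv₀ (hδ.mono hTV) fun x hx => (hT hx).2)
      (IsHolFun.cramer (fun i j => (hmat i j).mono hTV)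
        (isHolFun_toCoord_apply ((Set.Subset.trans hTV hV)) (W₁.isHol hs)) j)
  have hsum : ∀ x ∈ T, s x = ∑ j, c j x • g j x := by
    intro x hx
    have h := sum_cramer_smul (hV (hTV hx)) g (s x)
    simp only [c, mul_smul, ← Finset.smul_sum]
    rw [h, inv_smul_smul₀ (hT hx).2]
  have ht : (fun x => ∑ i ∈ I, c i x • g i x) ∈ W₁.sec T :=
    ModuleSubsheaf.sum_smul_mem I (fun i _ => hc i) fun i hi => W₁.restrict hTV (h₁ i hi)
  have ht' : (fun x => ∑ i ∈ Iᶜ, c i x • g i x) ∈ W₂.sec T :=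
    ModuleSubsheaf.sum_smul_mem Iᶜ (fun i _ => hc i) fun i hi =>
      W₂.restrict hTV (h₂ i (Finset.mem_compl.1 hi))
  -- For a section of `W₁`, the part along the `W₂`-vectors of the frame is a difference of sections
  -- of `W₁`, hence lies in `W₁ ∩ W₂` and vanishes. So the first part of the frame spans `W₁` where
  -- `δ ≠ 0`.
  have hst := hzero T _ (ModuleSubsheaf.sub_mem hs ht) (ModuleSubsheaf.congr_mem ht' fun x hx => by
    rw [hsum x hx, ← Finset.sum_add_sum_compl I]
    abel) z hz
  rw [sub_eq_zero.1 hst]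
  exact Submodule.sum_mem _ fun i hi => Submodule.smul_mem _ _ (Submodule.subset_span ⟨⟨i, hi⟩, rfl⟩)

/-- On `O` the subfamily indexed by `I` has the same span as all the generators and is independent,
so it is a frame to which `polarFibre_le_span` applies. -/
theorem polarFibre_le_span_of_linearIndepOn {W : TangentSubsheaf n N} {y₀ : N} {V O : Opens N}
    (hV : (V : Set N) ⊆ (chartAt (EuclideanSpace ℂ (Fin n)) y₀).source) (hO : O ≤ V)
    {ι : Type*} [Finite ι] {g : ι → Π y, TanC n N y}
    (hg : ∀ i, IsHolSection (n := n) (EuclideanSpace ℂ (Fin n)) (TanC n N) V (g i))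
    (hs : ∀ V' ≤ V, ∀ s ∈ W.sec V', ∀ y ∈ V', s y ∈ Submodule.span ℂ (Set.range fun i => g i y))
    {I : Set ι} (hI : ∀ y ∈ O, LinearIndepOn ℂ (fun i => toCoord y₀ y (g i y)) I ∧
      ∀ j, toCoord y₀ y (g j y) ∈ Submodule.span ℂ ((fun i => toCoord y₀ y (g i y)) '' I))
    {y : N} (hy : y ∈ O) : polarFibre W y ≤ Submodule.span ℂ (Set.range fun i => g i y) := by
  have hspan : ∀ V' ≤ O, ∀ s ∈ W.sec V', ∀ y ∈ V',
      s y ∈ Submodule.span ℂ (Set.range fun i : I => g i y) := by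
    intro V' hV' s hsW y hy
    have h1 : Submodule.span ℂ (Set.range fun i => g i y) ≤
        Submodule.span ℂ (Set.range fun i : I => g i y) := by
      rw [Submodule.span_le]
      rintro _ ⟨j, rfl⟩
      have h2 := (hI y (hV' hy)).2 j
      rw [← Set.image_image (toCoord y₀ y) (fun i => g i y)] at h2
      rw [← Set.image_eq_range (fun i => g i y) I]
      exact mem_span_of_toCoord_mem_span (hV (hO (hV' hy))) h2
    exact h1 (hs V' (hV'.trans hO) s hsW y hy)
  have hli : LinearIndependent ℂ fun i : I => g i y :=
    LinearIndependent.of_comp (toCoord y₀ y).toLinearMap (hI y hy).1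
  refine (polarFibre_le_span hy (g := fun i : I => g i) (fun i => (hg i).mono hO) hli hspan).trans
    (Submodule.span_mono ?_)
  rintro _ ⟨i, rfl⟩
  exact ⟨i, rfl⟩

variable {M : Type*} [TopologicalSpace M] [ChartedSpace (EuclideanSpace ℂ (Fin n)) M]
  [IsManifold (modelC n) ω M]

/-- On a smaller open set both generating families have constant rank, so their spans contain the
polar fibres. Under a point with surjective `dη`, each tangent vector lifts, splits upstairs, and
its two parts map into these polar fibres. -/
theorem exists_sup_span_eq_top [SecondCountableTopology M] {η : M → N}
    (hη : ContMDiff (modelC n) (modelC n) ω η) (hsurj : Function.Surjective η)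
    {W₁ W₂ : TangentSubsheaf n N}
    (h : (lifting (m := n) η W₁).IsDirectSum (lifting (m := n) η W₂))
    {y₀ : N} {V : Opens N} (hne : (V : Set N).Nonempty)
    (hV : (V : Set N) ⊆ (chartAt (EuclideanSpace ℂ (Fin n)) y₀).source) {ι κ : Type*} [Finite ι]
    [Finite κ] {g₁ : ι → Π y, TanC n N y} {g₂ : κ → Π y, TanC n N y}
    (hg₁ : ∀ i, IsHolSection (n := n) (EuclideanSpace ℂ (Fin n)) (TanC n N) V (g₁ i))
    (hg₂ : ∀ i, IsHolSection (n := n) (EuclideanSpace ℂ (Fin n)) (TanC n N) V (g₂ i))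
    (hs₁ : ∀ V' ≤ V, ∀ s ∈ W₁.sec V', ∀ y ∈ V', s y ∈ Submodule.span ℂ (Set.range fun i => g₁ i y))
    (hs₂ : ∀ V' ≤ V, ∀ s ∈ W₂.sec V', ∀ y ∈ V', s y ∈ Submodule.span ℂ (Set.range fun i => g₂ i y)) :
    ∃ y ∈ V, Submodule.span ℂ (Set.range fun i => g₁ i y) ⊔
      Submodule.span ℂ (Set.range fun i => g₂ i y) = ⊤ := by
  have hcoord : ∀ {s : Π y, TanC n N y},
      IsHolSection (n := n) (EuclideanSpace ℂ (Fin n)) (TanC n N) V s →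
      ContinuousOn (fun y => toCoord y₀ y (s y)) V := fun hs =>
    ((isHolSection_tangent_iff hV).1 hs).continuousOn
  obtain ⟨O₁, hO₁V, hO₁, hO₁ne, I₁, hI₁⟩ := exists_isOpen_linearIndepOn_span V.isOpen hne
    (v := fun i y => toCoord y₀ y (g₁ i y)) fun i => hcoord (hg₁ i)
  obtain ⟨O₂, hO₂O₁, hO₂, hO₂ne, I₂, hI₂⟩ := exists_isOpen_linearIndepOn_span hO₁ hO₁ne
    (v := fun i y => toCoord y₀ y (g₂ i y)) fun i => (hcoord (hg₂ i)).mono hO₁V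
  obtain ⟨x, hxO, hx⟩ := exists_surjective_mfderiv le_rfl hη hsurj (O := ⟨O₂, hO₂⟩) hO₂ne
  have hO₂V : (⟨O₂, hO₂⟩ : Opens N) ≤ V := hO₂O₁.trans hO₁V
  have hk₁ := polarFibre_le_span_of_linearIndepOn hV hO₂V hg₁ hs₁ (fun y hy => hI₁ y (hO₂O₁ hy)) hxO
  have hk₂ := polarFibre_le_span_of_linearIndepOn hV hO₂V hg₂ hs₂ hI₂ hxO
  refine ⟨η x, hO₂V hxO, eq_top_iff.2 fun w _ => ?_⟩
  obtain ⟨u, rfl⟩ := hx w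
  obtain ⟨p, -, hp⟩ := exists_continuousOn_projection hη h x
  obtain ⟨hp₁, hp₂⟩ := hp x (mem_chart_source _ x) (toCoord x x u)
  have h3 : u = ofCoord x x (p x (toCoord x x u)) +
      ofCoord x x (toCoord x x u - p x (toCoord x x u)) := by
    rw [← map_add, add_sub_cancel, ofCoord_toCoord (mem_chart_source _ x)]
  rw [h3, map_add]
  exact Submodule.add_mem_sup (hk₁ hp₁) (hk₂ hp₂)

/-- Around each point there is a generic frame consisting of sections of `W₁` and of `W₂`. -/
theorem exists_adapted_frame [SecondCountableTopology M] {η : M → N}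
    (hη : ContMDiff (modelC n) (modelC n) ω η) (hsurj : Function.Surjective η)
    {W₁ W₂ : TangentSubsheaf n N} (hW₁ : W₁.IsFiniteType) (hW₂ : W₂.IsFiniteType)
    (h : (lifting (m := n) η W₁).IsDirectSum (lifting (m := n) η W₂)) {O : Opens N} {y₀ : N}
    (hy₀ : y₀ ∈ O) :
    ∃ V ≤ O, y₀ ∈ V ∧ (V : Set N) ⊆ (chartAt (EuclideanSpace ℂ (Fin n)) y₀).source ∧
      ∃ (g : Fin n → Π y, TanC n N y) (I : Finset (Fin n)), (∀ i ∈ I, g i ∈ W₁.sec V) ∧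
        (∀ i ∉ I, g i ∈ W₂.sec V) ∧
        NowhereLocallyZero V fun y => (frameMatrix y₀ g y).det := by
  classical
  obtain ⟨V₁, hy₁, k₁, g₁, hg₁, hs₁⟩ := hW₁ y₀
  obtain ⟨V₂, hy₂, k₂, g₂, hg₂, hs₂⟩ := hW₂ y₀
  obtain ⟨V, hVO, hy₀V, hV, hid⟩ := exists_opens_nowhereLocallyZero (n := n)
    (O := O ⊓ (V₁ ⊓ V₂)) ⟨hy₀, hy₁, hy₂⟩
  have hVV₁ : V ≤ V₁ := hVO.trans (inf_le_right.trans inf_le_left)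
  have hVV₂ : V ≤ V₂ := hVO.trans (inf_le_right.trans inf_le_right)
  have hspan : ∀ {W : TangentSubsheaf n N} {T : Opens N} {k : ℕ} {g : Fin k → Π y, TanC n N y},
      V ≤ T → (∀ V' ≤ T, ∀ s ∈ W.sec V', ∀ y ∈ V', ∃ V'' ≤ V', y ∈ V'' ∧
        ∃ f : Fin k → N → ℂ, (∀ i, IsHolFun (n := n) V'' (f i)) ∧
          ∀ z ∈ V'', s z = ∑ i, f i z • g i z) →
      ∀ V' ≤ V, ∀ s ∈ W.sec V', ∀ y ∈ V',
        s y ∈ Submodule.span ℂ (Set.range fun i => g i y) := by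
    intro W T k g hVT hs V' hV' s hsW y hy
    obtain ⟨V'', -, hyV, f, -, hf⟩ := hs V' (hV'.trans hVT) s hsW y hy
    rw [hf y hyV]
    exact Submodule.sum_mem _ fun i _ => Submodule.smul_mem _ _ (Submodule.subset_span ⟨i, rfl⟩)
  have hg₁V : ∀ i, g₁ i ∈ W₁.sec V := fun i => W₁.restrict hVV₁ (hg₁ i)
  have hg₂V : ∀ i, g₂ i ∈ W₂.sec V := fun i => W₂.restrict hVV₂ (hg₂ i)
  obtain ⟨y, hy, htop⟩ := exists_sup_span_eq_top hη hsurj h ⟨y₀, hy₀V⟩ hV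
    (fun i => W₁.isHol (hg₁V i)) (fun i => W₂.isHol (hg₂V i)) (hspan hVV₁ hs₁) (hspan hVV₂ hs₂)
  let G : Fin k₁ ⊕ Fin k₂ → Π y, TanC n N y := Sum.elim g₁ g₂
  have hGtop : Submodule.span ℂ (Set.range fun i => toCoord y₀ y (G i y)) = ⊤ := by
    have h1 : (Set.range fun i => G i y) =
        (Set.range fun i => g₁ i y) ∪ Set.range fun i => g₂ i y := by
      ext u
      simp [G]
    have h2 : (Set.range fun i => toCoord y₀ y (G i y)) =
        (toCoord y₀ y).toLinearMap '' Set.range fun i => G i y := (Set.range_comp _ _)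
    rw [h2, ← Submodule.map_span, h1, Submodule.span_union, htop, Submodule.map_top,
      LinearMap.range_eq_top]
    exact fun v => ⟨ofCoord y₀ y v, toCoord_ofCoord (hV hy) v⟩
  -- A basis at the single point `y` is extracted from the generators; the identity theorem later
  -- spreads the nonvanishing of its determinant over `V`.
  obtain ⟨κ, a, ha, hspan', hli⟩ := exists_linearIndependent' ℂ fun i => toCoord y₀ y (G i y)
  have := Finite.of_injective a ha
  have := Fintype.ofFinite κ
  rw [hGtop] at hspan'
  have hcard : Fintype.card κ = n := by
    rw [← Module.finrank_eq_card_basis (Module.Basis.mk hli hspan'.ge), finrank_euclideanSpace_fin]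
  let e : Fin n ≃ κ := (Fintype.equivFinOfCardEq hcard).symm
  refine ⟨V, hVO.trans inf_le_left, hy₀V, hV, fun i => G (a (e i)),
    Finset.univ.filter fun i => (a (e i)).isLeft, fun i hi => ?_, fun i hi => ?_, ?_⟩
  · obtain ⟨j, hj⟩ := Sum.isLeft_iff.1 (Finset.mem_filter.1 hi).2
    change G (a (e i)) ∈ W₁.sec V
    rw [hj]
    exact hg₁V j
  · have hi' : (a (e i)).isRight := by
      simpa using hi
    obtain ⟨j, hj⟩ := Sum.isRight_iff.1 hi'
    change G (a (e i)) ∈ W₂.sec V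
    rw [hj]
    exact hg₂V j
  · refine hid _ (IsHolFun.det (isHolFun_frameMatrix hV fun i => ?_)) ⟨y, hy, ?_⟩
    · rcases hj : a (e i) with j | j
      exacts [W₁.isHol (hg₁V j), W₂.isHol (hg₂V j)]
    · exact (linearIndependent_iff_det_ne_zero fun i => toCoord y₀ y (G (a (e i)) y)).1
        (hli.comp e e.injective)

end Frame

/-! ### Dividing by the frame determinant -/

section Division

open Filter Topology MeasureTheory

variable {n : ℕ} {M : Type*} [TopologicalSpace M] [ChartedSpace (EuclideanSpace ℂ (Fin n)) M]
  [IsManifold (modelC n) ω M]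
  {N : Type*} [TopologicalSpace N] [ChartedSpace (EuclideanSpace ℂ (Fin n)) N]
  [IsManifold (modelC n) ω N]

/-- The first component of a field, possibly meromorphic downstairs, becomes bounded upstairs after
multiplication by the Jacobian determinant. -/
theorem exists_norm_det_jacobian_mul_le {η : M → N} (hη : ContMDiff (modelC n) (modelC n) ω η)
    {W₁ W₂ : TangentSubsheaf n N}
    (h : (lifting (m := n) η W₁).IsDirectSum (lifting (m := n) η W₂))
    (hzero : ∀ (V : Opens N) (s : Π y, TanC n N y), s ∈ W₁.sec V → s ∈ W₂.sec V →
      ∀ y ∈ V, s y = 0) {y₀ : N} {V : Opens N}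
    (hV : (V : Set N) ⊆ (chartAt (EuclideanSpace ℂ (Fin n)) y₀).source)
    {g : Fin n → Π y, TanC n N y} {I : Finset (Fin n)} (h₁ : ∀ i ∈ I, g i ∈ W₁.sec V)
    (h₂ : ∀ i ∉ I, g i ∈ W₂.sec V) {s A₁ A₂ : Π y, TanC n N y}
    (hs : IsHolSection (n := n) (EuclideanSpace ℂ (Fin n)) (TanC n N) V s)
    (hA₁ : ∀ y ∈ V, A₁ y ∈ Submodule.span ℂ ((fun i => g i y) '' I))
    (hA₂ : ∀ y ∈ V, A₂ y ∈ Submodule.span ℂ ((fun i => g i y) '' (Iᶜ : Finset (Fin n))))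
    (hsum : ∀ y ∈ V, (frameMatrix y₀ g y).det • s y = A₁ y + A₂ y) {x₀ : M} (hx₀ : η x₀ ∈ V) :
    ∃ C : ℝ, ∀ᶠ x in 𝓝 x₀, ‖(jacobian (m := n) (n := n) η x₀ y₀ x).det‖ *
      ‖((frameMatrix y₀ g (η x)).det)⁻¹ • toCoord y₀ (η x) (A₁ (η x))‖ ≤ C := by
  obtain ⟨adj, hadj, hadj'⟩ := exists_continuous_adjugate (EuclideanSpace ℂ (Fin n))
  obtain ⟨p, hp, hpW⟩ := exists_continuousOn_projection hη h x₀
  have hx₀s := mem_chart_source (EuclideanSpace ℂ (Fin n)) x₀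
  let J := jacobian (m := n) (n := n) η x₀ y₀
  -- This is `det J` times the first component of `s`. The adjugate in place of `J⁻¹` keeps it
  -- continuous across the branch locus, which gives the bound.
  let F : M → EuclideanSpace ℂ (Fin n) := fun x =>
    J x (p x (adj (J x) (toCoord y₀ (η x) (s (η x)))))
  have hF : ContinuousAt F x₀ := by
    have hJ : ContinuousAt J x₀ := (contMDiffAt_jacobian hη hx₀s (hV hx₀)).continuousAt
    have hp₀ : ContinuousAt p x₀ := hp.continuousAt (chart_source_mem_nhds _ x₀)
    have hs₀ : ContinuousAt (fun y => toCoord y₀ y (s y)) (η x₀) :=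
      ((isHolSection_tangent_iff hV).1 hs).continuousOn.continuousAt (V.isOpen.mem_nhds hx₀)
    have hsη : ContinuousAt (fun x => toCoord y₀ (η x) (s (η x))) x₀ :=
      ContinuousAt.comp (f := η) hs₀ hη.continuous.continuousAt
    exact hJ.clm_apply (hp₀.clm_apply ((hadj.continuousAt.comp hJ).clm_apply hsη))
  refine ⟨‖F x₀‖ + 1, ?_⟩
  filter_upwards [hF.norm.eventually_lt_const (lt_add_one ‖F x₀‖),
    chart_source_mem_nhds (EuclideanSpace ℂ (Fin n)) x₀,
    hη.continuous.continuousAt.eventually_mem (V.isOpen.mem_nhds hx₀)] with x hFx hx hxV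
  -- In the two degenerate cases the quantity is `0`: the Jacobian factor vanishes, or the inverse
  -- of `δ = 0` is `0` by convention.
  by_cases hJ0 : (J x).det = 0
  · have h0 : (jacobian (m := n) (n := n) η x₀ y₀ x).det = 0 := hJ0
    rw [h0, norm_zero, zero_mul]
    positivity
  by_cases hδ : (frameMatrix y₀ g (η x)).det = 0
  · rw [hδ, inv_zero, zero_smul, norm_zero, mul_zero]
    positivity
  refine le_trans (le_of_eq ?_) hFx.le
  obtain ⟨w, hw⟩ : ∃ w, J x w = toCoord y₀ (η x) (s (η x)) :=
    (LinearMap.equivOfDetNeZero (J x).toLinearMap hJ0).surjective _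
  let u₁ : TanC n N (η x) := mfderiv (modelC n) (modelC n) η x (ofCoord x₀ x (p x w))
  let u₂ : TanC n N (η x) := mfderiv (modelC n) (modelC n) η x (ofCoord x₀ x (w - p x w))
  have hu : s (η x) = u₁ + u₂ := by
    refine toCoord_injective (hV hxV) ?_
    rw [← hw, ← map_add, ← map_add, add_sub_cancel]
    rfl
  have hu₁ : u₁ ∈ Submodule.span ℂ ((fun i => g i (η x)) '' I) :=
    polarFibre_le_span_of_adapted_frame hzero hV h₁ h₂ hxV hδ (hpW x hx w).1
  have hu₂ : u₂ ∈ Submodule.span ℂ ((fun i => g i (η x)) '' (Iᶜ : Finset (Fin n))) :=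
    polarFibre_le_span_of_adapted_frame (fun V s hs₂ hs₁ => hzero V s hs₁ hs₂) hV
      (fun i hi => h₂ i (Finset.mem_compl.1 hi))
      (fun i hi => h₁ i (by simpa using hi)) hxV hδ (hpW x hx w).2
  have hdisj := (linearIndependent_of_frameMatrix_det_ne_zero hδ).disjoint_span_image
    (s := (I : Set (Fin n))) (t := ((Iᶜ : Finset (Fin n)) : Set (Fin n)))
    (Finset.disjoint_coe.2 disjoint_compl_right)
  -- Both `A₁ + A₂` and `δ u₁ + δ u₂` decompose `δ s` along the two complementary parts of the
  -- frame, so the components agree.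
  have hA : A₁ (η x) = (frameMatrix y₀ g (η x)).det • u₁ := by
    have h3 : A₁ (η x) - (frameMatrix y₀ g (η x)).det • u₁ =
        (frameMatrix y₀ g (η x)).det • u₂ - A₂ (η x) := by
      have h4 := hsum (η x) hxV
      rw [hu, smul_add] at h4
      rw [sub_eq_sub_iff_add_eq_add, ← h4, add_comm]
    have h5 := Submodule.disjoint_def.1 hdisj (A₁ (η x) - (frameMatrix y₀ g (η x)).det • u₁)
      (Submodule.sub_mem _ (hA₁ _ hxV) (Submodule.smul_mem _ _ hu₁))
      (h3 ▸ Submodule.sub_mem _ (Submodule.smul_mem _ _ hu₂) (hA₂ _ hxV))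
    exact sub_eq_zero.1 h5
  have hFeq : F x = (J x).det • toCoord y₀ (η x) u₁ := by
    change J x (p x (adj (J x) (toCoord y₀ (η x) (s (η x))))) = _
    rw [← hw, hadj', map_smul, map_smul]
    rfl
  rw [hFeq, hA, map_smul, inv_smul_smul₀ hδ, norm_smul]

/-- Functions that are locally bounded upstairs after multiplication by the Jacobian determinant are
square integrable downstairs. -/
theorem exists_lintegral_sq_ne_top [MeasurableSpace (EuclideanSpace ℂ (Fin n))]
    [BorelSpace (EuclideanSpace ℂ (Fin n))] (μ : Measure (EuclideanSpace ℂ (Fin n)))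
    [μ.IsAddHaarMeasure] {η : M → N} (hη : IsFiniteSurjective n n η) {y₀ : N} {V : Opens N}
    (hy₀ : y₀ ∈ V) (hV : (V : Set N) ⊆ (chartAt (EuclideanSpace ℂ (Fin n)) y₀).source)
    {q : N → EuclideanSpace ℂ (Fin n)}
    (hq : ∀ x₀, η x₀ ∈ V → ∃ C : ℝ, ∀ᶠ x in 𝓝 x₀,
      ‖(jacobian (m := n) (n := n) η x₀ y₀ x).det‖ * ‖q (η x)‖ ≤ C) :
    ∃ S ∈ 𝓝 (extChartAt (modelC n) y₀ y₀),
      ∫⁻ z in S, ‖q ((extChartAt (modelC n) y₀).symm z)‖ₑ ^ 2 ∂μ ≠ ⊤ := by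
  let ψ := extChartAt (modelC n) y₀
  let H : EuclideanSpace ℂ (Fin n) → ENNReal := fun z => ‖q (ψ.symm z)‖ₑ ^ 2
  have hsource : ψ.source = (chartAt (EuclideanSpace ℂ (Fin n)) y₀).source :=
    extChartAt_source (modelC n) y₀
  -- The Jacobian of the change of variables is `‖det J‖ ^ 2`, so the integrand upstairs is at most
  -- `C ^ 2` on a ball.
  have hlocal : ∀ x₀, η x₀ ∈ V → ∃ B ∈ 𝓝 x₀, ∫⁻ z in ψ '' (η '' B), H z ∂μ < ⊤ := by
    intro x₀ hx₀
    obtain ⟨C, hC⟩ := hq x₀ hx₀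
    let φ := extChartAt (modelC n) x₀
    have hφcont : ContinuousAt φ.symm (φ x₀) := continuousAt_extChartAt_symm x₀
    have hφx : φ.symm (φ x₀) = x₀ := extChartAt_to_inv x₀
    have hev : ∀ᶠ z in 𝓝 (φ x₀), z ∈ φ.target ∧ η (φ.symm z) ∈ V ∧
        ‖(jacobian (m := n) (n := n) η x₀ y₀ (φ.symm z)).det‖ * ‖q (η (φ.symm z))‖ ≤ C := by
      have h1 : Tendsto φ.symm (𝓝 (φ x₀)) (𝓝 x₀) := by
        rw [ContinuousAt, hφx] at hφcont
        exact hφcont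
      exact Filter.Eventually.and (extChartAt_target_mem_nhds x₀) ((h1.eventually
        (hη.isHol.continuous.continuousAt.eventually_mem (V.isOpen.mem_nhds hx₀))).and
        (h1.eventually hC))
    obtain ⟨r, hr, hball⟩ := Metric.eventually_nhds_iff_ball.1 hev
    let f : EuclideanSpace ℂ (Fin n) → EuclideanSpace ℂ (Fin n) := fun z => ψ (η (φ.symm z))
    have hsub : ψ '' (η '' (φ.source ∩ φ ⁻¹' Metric.ball (φ x₀) r)) ⊆
        f '' Metric.ball (φ x₀) r := by
      rintro _ ⟨_, ⟨x, hx, rfl⟩, rfl⟩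
      exact ⟨φ x, hx.2, by simp only [f, φ.left_inv hx.1]⟩
    refine ⟨φ.source ∩ φ ⁻¹' Metric.ball (φ x₀) r,
      inter_mem (extChartAt_source_mem_nhds x₀)
        ((continuousAt_extChartAt x₀).preimage_mem_nhds (Metric.ball_mem_nhds _ hr)), ?_⟩
    calc ∫⁻ z in ψ '' (η '' (φ.source ∩ φ ⁻¹' Metric.ball (φ x₀) r)), H z ∂μ
        ≤ ∫⁻ z in f '' Metric.ball (φ x₀) r, H z ∂μ := lintegral_mono_set hsub
      _ ≤ ∫⁻ z in Metric.ball (φ x₀) r,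
            ‖(jacobian (m := n) (n := n) η x₀ y₀ (φ.symm z)).det‖ₑ ^ 2 * H (f z) ∂μ :=
          lintegral_image_le_lintegral_norm_det_sq_mul μ measurableSet_ball
            (fun z hz => hasFDerivAt_jacobian hη.isHol (hball z hz).1 (hV (hball z hz).2.1)) H
      _ ≤ ∫⁻ _ in Metric.ball (φ x₀) r, ENNReal.ofReal C ^ 2 ∂μ := by
          refine setLIntegral_mono measurable_const fun z hz => ?_
          have h1 : ψ.symm (f z) = η (φ.symm z) := ψ.left_inv (hsource ▸ hV (hball z hz).2.1)
          simp only [H, h1]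
          rw [← mul_pow, ← enorm_norm (q _), ← enorm_norm (ContinuousLinearMap.det _), ← enorm_mul]
          gcongr
          rw [Real.enorm_of_nonneg (by positivity)]
          exact ENNReal.ofReal_le_ofReal (hball z hz).2.2
      _ < ⊤ := by
          rw [setLIntegral_const]
          exact ENNReal.mul_lt_top (ENNReal.pow_lt_top ENNReal.ofReal_lt_top) measure_ball_lt_top
  have : LocallyCompactSpace N := Manifold.locallyCompact_of_finiteDimensional (modelC n)
  obtain ⟨K, hK, hKV, hKc⟩ := local_compact_nhds (V.isOpen.mem_nhds hy₀)
  -- Properness makes `η ⁻¹' K` compact, so finitely many local bounds suffice; surjectivity then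
  -- makes its image all of `K`.
  have hfin : ∫⁻ z in ψ '' (η '' (η ⁻¹' K)), H z ∂μ < ⊤ := by
    refine (hη.isProper.isCompact_preimage hKc).induction_on
      (p := fun B => ∫⁻ z in ψ '' (η '' B), H z ∂μ < ⊤) (by simp) ?_ ?_ ?_
    · exact fun B B' hB hB' => (lintegral_mono_set (Set.image_mono (Set.image_mono hB))).trans_lt hB'
    · intro B B' hB hB'
      rw [Set.image_union, Set.image_union]
      exact (lintegral_union_le _ _ _).trans_lt (ENNReal.add_lt_top.2 ⟨hB, hB'⟩)
    · intro x hx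
      obtain ⟨B, hB, hBfin⟩ := hlocal x (hKV hx)
      exact ⟨B, mem_nhdsWithin_of_mem_nhds hB, hBfin⟩
  rw [Set.image_preimage_eq _ hη.surjective] at hfin
  refine ⟨ψ '' K, ?_, hfin.ne⟩
  have h1 : ContinuousAt ψ.symm (ψ y₀) := continuousAt_extChartAt_symm y₀
  have h2 : ψ.symm ⁻¹' K ∈ 𝓝 (ψ y₀) := h1.preimage_mem_nhds (by rwa [extChartAt_to_inv y₀])
  filter_upwards [h2, extChartAt_target_mem_nhds y₀] with z hz hzt
  exact ⟨ψ.symm z, hz, ψ.right_inv hzt⟩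

/-- The only candidate for the first component is `A₁ / δ`. Its coordinates are square-integrable
quotients, hence holomorphic, and saturation returns both components to `W₁` and `W₂`. -/
theorem exists_local_decomposition [SecondCountableTopology M] {η : M → N}
    (hη : IsFiniteSurjective n n η) {W₁ W₂ : TangentSubsheaf n N} (hW₁ : IsDistribution W₁)
    (hW₂ : IsDistribution W₂)
    (h : (lifting (m := n) η W₁).IsDirectSum (lifting (m := n) η W₂))
    (hzero : ∀ (V : Opens N) (s : Π y, TanC n N y), s ∈ W₁.sec V → s ∈ W₂.sec V →
      ∀ y ∈ V, s y = 0) {O : Opens N} {s : Π y, TanC n N y}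
    (hs : IsHolSection (n := n) (EuclideanSpace ℂ (Fin n)) (TanC n N) O s) {y₀ : N}
    (hy₀ : y₀ ∈ O) : ∃ V ≤ O, y₀ ∈ V ∧ ∃ s₁ ∈ W₁.sec V, ∃ s₂ ∈ W₂.sec V,
      ∀ y ∈ V, s y = s₁ y + s₂ y := by
  obtain ⟨V, hVO, hy₀V, hV, g, I, h₁, h₂, hδ0⟩ :=
    exists_adapted_frame hη.isHol hη.surjective hW₁.1 hW₂.1 h hy₀
  have hg : ∀ i, IsHolSection (n := n) (EuclideanSpace ℂ (Fin n)) (TanC n N) V (g i) := fun i => by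
    by_cases hi : i ∈ I
    exacts [W₁.isHol (h₁ i hi), W₂.isHol (h₂ i hi)]
  have hsV := hs.mono hVO
  have hmat := isHolFun_frameMatrix hV hg
  let δ : N → ℂ := fun y => (frameMatrix y₀ g y).det
  have hδ : IsHolFun (n := n) V δ := IsHolFun.det hmat
  let c : Fin n → N → ℂ := fun j y => (frameMatrix y₀ g y).cramer (toCoord y₀ y (s y)).ofLp j
  have hc : ∀ j, IsHolFun (n := n) V (c j) := fun j =>
    IsHolFun.cramer hmat (isHolFun_toCoord_apply hV hsV) j
  let A₁ : Π y, TanC n N y := fun y => ∑ i ∈ I, c i y • g i y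
  let A₂ : Π y, TanC n N y := fun y => ∑ i ∈ Iᶜ, c i y • g i y
  have hA₁ : A₁ ∈ W₁.sec V := ModuleSubsheaf.sum_smul_mem I (fun i _ => hc i) h₁
  have hA₂ : A₂ ∈ W₂.sec V := ModuleSubsheaf.sum_smul_mem Iᶜ (fun i _ => hc i)
    fun i hi => h₂ i (Finset.mem_compl.1 hi)
  have hsum : ∀ y ∈ V, δ y • s y = A₁ y + A₂ y := fun y hy => by
    rw [← sum_cramer_smul (hV hy) g (s y), ← Finset.sum_add_sum_compl I]
  let ψ := extChartAt (modelC n) y₀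
  let q : N → EuclideanSpace ℂ (Fin n) := fun y => (δ y)⁻¹ • toCoord y₀ y (A₁ y)
  have hspan : ∀ (T : Finset (Fin n)) (y : N), ∑ i ∈ T, c i y • g i y ∈
      Submodule.span ℂ ((fun i => g i y) '' T) := fun T y =>
    Submodule.sum_mem _ fun i hi => Submodule.smul_mem _ _ (Submodule.subset_span ⟨i, hi, rfl⟩)
  let μ : Measure (EuclideanSpace ℂ (Fin n)) := Measure.addHaar
  obtain ⟨S, hS, hfin⟩ := exists_lintegral_sq_ne_top μ hη hy₀V hV (q := q) fun x₀ hx₀ =>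
    exists_norm_det_jacobian_mul_le hη.isHol h hzero hV h₁ h₂ hsV (fun y _ => hspan I y)
      (fun y _ => hspan Iᶜ y) hsum hx₀
  have hy₀ψ : ψ.symm (ψ y₀) = y₀ := extChartAt_to_inv y₀
  have hψcont : Tendsto ψ.symm (𝓝 (ψ y₀)) (𝓝 y₀) := by
    have h3 : ContinuousAt ψ.symm (ψ y₀) := continuousAt_extChartAt_symm y₀
    rwa [ContinuousAt, hy₀ψ] at h3
  have han : ∀ {f : N → ℂ}, IsHolFun (n := n) V f → AnalyticAt ℂ (fun z => f (ψ.symm z)) (ψ y₀) :=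
    fun hf => ContMDiffAt.analyticAt_comp_extChartAt_symm (mem_extChartAt_target y₀) (by
      change ContMDiffAt _ _ _ _ (ψ.symm (ψ y₀))
      rw [hy₀ψ]
      exact hf.contMDiffAt (V.isOpen.mem_nhds hy₀V))
  have hδne : ¬ ∀ᶠ z in 𝓝 (ψ y₀), δ (ψ.symm z) = 0 := by
    intro h0
    have h3 : ∀ᶠ y in 𝓝 y₀, δ y = 0 := by
      filter_upwards [(continuousAt_extChartAt (I := modelC n) y₀).eventually h0,
        extChartAt_source_mem_nhds (I := modelC n) y₀] with y hy hys
      rwa [ψ.left_inv hys] at hy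
    obtain ⟨T, hT, hTo, hyT⟩ := eventually_nhds_iff.1 (h3.and (V.isOpen.mem_nhds hy₀V))
    obtain ⟨y, hy, hne⟩ := hδ0 ⟨T, hTo⟩ (fun y hy => (hT y hy).2) ⟨y₀, hyT⟩
    exact hne (hT y hy).1
  have hdiv : ∀ i, ∃ b, AnalyticAt ℂ b (ψ y₀) ∧ ∀ᶠ z in 𝓝 (ψ y₀),
      toCoord y₀ (ψ.symm z) (A₁ (ψ.symm z)) i = δ (ψ.symm z) * b z := by
    intro i
    -- Each coordinate of `q` is bounded by its norm and so inherits square integrability.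
    refine exists_eq_mul_of_lintegral_div_sq μ
      (han (isHolFun_toCoord_apply hV (W₁.isHol hA₁) i)) (han hδ) hδne hS
      (ne_top_of_le_ne_top hfin (lintegral_mono fun z => ?_))
    gcongr
    rw [div_eq_inv_mul]
    exact enorm_le_iff_norm_le.2 (PiLp.norm_apply_le (q (ψ.symm z)) i)
  choose b hb hab using hdiv
  let B : EuclideanSpace ℂ (Fin n) → EuclideanSpace ℂ (Fin n) := fun z => WithLp.toLp 2 fun i => b i z
  have hB : AnalyticAt ℂ B (ψ y₀) :=
    ((PiLp.continuousLinearEquiv 2 ℂ fun _ : Fin n => ℂ).symm.toContinuousLinearMap.analyticAt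
      _).comp (analyticAt_pi_iff.2 hb)
  have hev : ∀ᶠ y in 𝓝 y₀, y ∈ V ∧ AnalyticAt ℂ B (ψ y) ∧
      ∀ i, toCoord y₀ y (A₁ y) i = δ y * b i (ψ y) := by
    have h3 : ContinuousAt ψ y₀ := continuousAt_extChartAt y₀
    filter_upwards [V.isOpen.mem_nhds hy₀V, h3.eventually hB.eventually_analyticAt,
      h3.eventually (eventually_all.2 hab), extChartAt_source_mem_nhds (I := modelC n) y₀]
      with y hyV hyB hyab hys
    refine ⟨hyV, hyB, fun i => ?_⟩
    have h4 := hyab i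
    rwa [ψ.left_inv hys] at h4
  obtain ⟨T, hT, hTo, hyT⟩ := eventually_nhds_iff.1 hev
  let V' : Opens N := ⟨T, hTo⟩
  have hV'V : V' ≤ V := fun y hy => (hT y hy).1
  have hV' : (V' : Set N) ⊆ (chartAt (EuclideanSpace ℂ (Fin n)) y₀).source :=
    fun y hy => hV (hV'V hy)
  let s₁ : Π y, TanC n N y := fun y => ofCoord y₀ y (B (ψ y))
  have hs₁ : IsHolSection (n := n) (EuclideanSpace ℂ (Fin n)) (TanC n N) V' s₁ := by
    refine (isHolSection_tangent_iff hV').2 ?_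
    have h3 : ContMDiffOn (modelC n) (modelC n) ω (fun y => B (ψ y)) V' := fun y hy =>
      (AnalyticAt.contMDiffAt_comp_extChartAt (hV' hy) (hT y hy).2.1).contMDiffWithinAt
    exact h3.congr fun y hy => toCoord_ofCoord (hV' hy) _
  have hδs₁ : ∀ y ∈ V', δ y • s₁ y = A₁ y := by
    intro y hy
    refine toCoord_injective (hV' hy) ?_
    rw [map_smul, toCoord_ofCoord (hV' hy)]
    ext i
    exact ((hT y hy).2.2 i).symm
  have hs₁W : s₁ ∈ W₁.sec V' := hW₁.2 V' δ s₁ (hδ.mono hV'V) (hδ0.mono hV'V) hs₁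
    (ModuleSubsheaf.congr_mem (W₁.restrict hV'V hA₁) hδs₁)
  have hs₂ : IsHolSection (n := n) (EuclideanSpace ℂ (Fin n)) (TanC n N) V'
      fun y => s y - s₁ y := by
    refine (isHolSection_tangent_iff hV').2 ?_
    refine (((isHolSection_tangent_iff hV').1 (hsV.mono hV'V)).sub
      ((isHolSection_tangent_iff hV').1 hs₁)).congr fun y hy => ?_
    rw [map_sub]
  have hs₂W : (fun y => s y - s₁ y) ∈ W₂.sec V' :=
    hW₂.2 V' δ _ (hδ.mono hV'V) (hδ0.mono hV'V) hs₂
      (ModuleSubsheaf.congr_mem (W₂.restrict hV'V hA₂) fun y hy => by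
        rw [smul_sub, hsum y (hV'V hy), hδs₁ y hy, add_sub_cancel_left])
  exact ⟨V', hV'V.trans hVO, hyT, s₁, hs₁W, _, hs₂W, fun y _ => (add_sub_cancel _ _).symm⟩

end Division

/-! ### Gluing the local decompositions -/

theorem lemma3p5 {m n : ℕ}
    {U' : Type*} [TopologicalSpace U'] [T2Space U'] [SecondCountableTopology U']
    [ConnectedSpace U'] [ChartedSpace (EuclideanSpace ℂ (Fin m)) U'] [IsManifold (modelC m) ω U']
    {U : Type*} [TopologicalSpace U] [T2Space U] [SecondCountableTopology U]
    [ConnectedSpace U] [ChartedSpace (EuclideanSpace ℂ (Fin n)) U] [IsManifold (modelC n) ω U]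
    (η : U' → U) (hη : IsFiniteSurjective m n η)
    (W₁ W₂ : TangentSubsheaf n U) (hW₁ : IsDistribution W₁) (hW₂ : IsDistribution W₂)
    (h : (lifting (m := m) η W₁).IsDirectSum (lifting (m := m) η W₂)) :
    W₁.IsDirectSum W₂ := by
  obtain rfl : m = n := hη.dim_eq
  have hzero : ∀ (V : Opens U) (s : Π y, TanC m U y), s ∈ W₁.sec V → s ∈ W₂.sec V →
      ∀ y ∈ V, s y = 0 := fun V s h₁ h₂ =>
    eq_zero_of_mem_of_lifting hη.isHol hη.surjective (fun V X hX => (h V).2 X hX) h₁ h₂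
  refine fun V => ⟨fun s hs => ?_, fun s hs => hzero V s hs.1 hs.2⟩
  choose! T hTV hyT s₁ hs₁ s₂ hs₂ hsum using fun y (hy : y ∈ V) =>
    exists_local_decomposition hη hW₁ hW₂ h hzero hs hy
  -- On an overlap, the difference of the first components is minus that of the second, hence lies
  -- in `W₁ ∩ W₂ = 0`. The diagonal choices `s₁ x x` and `s₂ x x` therefore agree locally with
  -- actual sections.
  have huniq : ∀ x ∈ V, ∀ y ∈ V, ∀ z ∈ T x ⊓ T y, s₁ x z = s₁ y z ∧ s₂ x z = s₂ y z := by
    intro x hx y hy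
    have h₁ := ModuleSubsheaf.sub_mem (W₁.restrict (inf_le_left (b := T y)) (hs₁ x hx))
      (W₁.restrict inf_le_right (hs₁ y hy))
    have h₂ := ModuleSubsheaf.sub_mem (W₂.restrict (inf_le_right (a := T x)) (hs₂ y hy))
      (W₂.restrict inf_le_left (hs₂ x hx))
    have h₃ : ∀ z ∈ T x ⊓ T y, s₁ x z - s₁ y z = s₂ y z - s₂ x z := by
      intro z hz
      rw [sub_eq_sub_iff_add_eq_add, ← hsum x hx z hz.1, hsum y hy z hz.2, add_comm]
    intro z hz
    have h₄ := hzero _ _ h₁ (ModuleSubsheaf.congr_mem h₂ h₃) z hz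
    refine ⟨sub_eq_zero.1 h₄, ?_⟩
    have h₅ := h₃ z hz
    rw [h₄] at h₅
    exact (sub_eq_zero.1 h₅.symm).symm
  refine ⟨fun x => s₁ x x, W₁.mem_of_locally fun y hy => ⟨T y, hTV y hy, hyT y hy, s₁ y, hs₁ y hy,
    fun x hx => ?_⟩, fun x => s₂ x x, W₂.mem_of_locally fun y hy => ⟨T y, hTV y hy, hyT y hy, s₂ y,
    hs₂ y hy, fun x hx => ?_⟩, fun x hx => hsum x hx x (hyT x hx)⟩
  · exact (huniq x (hTV y hy hx) y hy x ⟨hyT x (hTV y hy hx), hx⟩).1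
  · exact (huniq x (hTV y hy hx) y hy x ⟨hyT x (hTV y hy hx), hx⟩).2
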